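/- **Setting.** An instance of the processed flow routing problem consists of a finite directed graph $G=(V,E)$ (no parallel edges), edge capacities $B:E\to(0,\infty)$, vertex processing capacities $C:V\to[0,\infty)$, and a finite list $D$ of source–destination pairs $(s_i,t_i)\in V\times V$. A *2-walk* from $s$ to $t$ is a directed walk from $s$ to $t$ that visits every vertex at most twice; let $P_i$ be the set of 2-walks from $s_i$ to $t_i$, and let $m_e(\pi)\in\{0,1,2\}$ be the number of times $\pi$ traverses $e$. A *feasible processed flow* is a family of numbers $p_{i,\pi}^v\ge 0$ ($1\le i\le|D|$, $\pi\in P_i$, $v\in V$) such that, with $p_{i,\pi}=\sum_{v\in\pi}p_{i,\pi}^v$, $$\sum_i\sum_{\pi\in P_i} m_e(\pi)\,p_{i,\pi}\le B(e)\quad(e\in E),\qquad \sum_i\sum_{\pi\in P_i}p_{i,\pi}^v\le C(v)\quad(v\in V).$$ Its *value* is $\sum_i\sum_{\pi\in P_i}p_{i,\pi}$, and $\mathrm{OPT}$ is the supremum of the values of the feasible processed flows. A *flow-2-walk* is an amount $f$ of flow sent along some $\pi\in P_i$ and processed at one vertex $v\in\pi$; a list of flow-2-walks describes the family in which $p_{i,\pi}^v$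 is the sum of the amounts with these $i,\pi,v$. **Multiplicative weight updates.** There is one expert for each edge and one for each vertex. A run with learning rate $\eta>0$ and initial weight $\delta\in(0,1)$ starts with all weights $w_e=q_v=\delta$. In each round, an optimal 2-walk oracle chooses $i$, $\pi\in P_i$ and $v\in\pi$ with $C(v)>0$ that minimize $$\sum_{e}m_e(\pi)\frac{w_e}{B(e)}+\frac{q_v}{C(v)},$$ and the largest amount $f$ with $f\le C(v)$ and $m_e(\pi)f\le B(e)$ for all $e$ is sent along $\pi$ and processed at $v$. Then $w_e$ is multiplied by $1+\eta\, m_e(\pi)f/B(e)$ for every edge $e$, and $q_v$ by $1+\eta f/C(v)$. The run ends as soon as some weight is at least $1$ (or at once, if no 2-walk of any pair contains a vertex of positive capacity). Finally all amounts are divided by $\log_{1+\eta}\frac{1+\eta}{\delta}$. **Theorem.** There are a program for a real random access machine (unit-cost arithmetic and comparisons of real numbers, unit-cost addition, subtraction and comparison of natural numbers used as indices, no rounding of reals to integers) and a constant $K>0$ such that, for every instance and every $\varepsilon\in(0,1)$, the program halts on this input and outputs a list of flow-2-walks with the following properties. 1. The list is the scaled result of a complete multiplicative weight update run, for some $\eta\in(0,\varepsilon]$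 and some $\delta\in(0,1)$. 2. The list describes a feasible processed flow. 3. The value of this flow is at least $(1-\varepsilon)\cdot\mathrm{OPT}$. 4. If $|V|\ge2$, $|E|\ge1$ and $|D|\ge1$, then the number of steps is at most $$K\cdot\frac{|D|\cdot|E|\cdot(|E|+|V|\log|V|)\cdot\log^2|V|}{\varepsilon^2}.$$ -/

import Mathlib

namespace ProcFlow

/-! ### Networks and 2-walks -/

/-- An instance of the processed flow routing problem: a finite directed graph with vertices
`0, …, nV - 1` and `nE` distinct edges (ordered pairs of vertices), edge capacities
`B : E → (0, ∞)`, vertex processing capacities `C : V → [0, ∞)`, and `nD` source-destination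
pairs (repetitions allowed). -/
structure Network where
  nV : ℕ
  nE : ℕ
  nD : ℕ
  edge : Fin nE → Fin nV × Fin nV
  edge_injective : Function.Injective edge
  B : Fin nE → ℝ
  B_pos : ∀ e, 0 < B e
  C : Fin nV → ℝ
  C_nonneg : ∀ v, 0 ≤ C v
  src : Fin nD → Fin nV
  dst : Fin nD → Fin nV

/-- `π` lists the vertices of a directed walk from `s` to `t` that visits every vertex at most
twice. As there are no parallel edges, the vertices determine the edges of the walk. -/
def IsTwoWalk (N : Network) (s t : Fin N.nV) (π : List (Fin N.nV)) : Prop :=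
  π.head? = some s ∧ π.getLast? = some t ∧
    π.IsChain (fun u v => ∃ e, N.edge e = (u, v)) ∧ ∀ v, π.count v ≤ 2

/-- The 2-walks of the `i`-th source-destination pair. -/
def TwoWalk (N : Network) (i : Fin N.nD) : Type :=
  {π : List (Fin N.nV) // IsTwoWalk N (N.src i) (N.dst i) π}

theorem twoWalk_finite (N : Network) (i : Fin N.nD) : Finite (TwoWalk N i) := by
  have h : {π : List (Fin N.nV) | π.length ≤ 2 * N.nV}.Finite := List.finite_length_le _ _
  have hs : {π | IsTwoWalk N (N.src i) (N.dst i) π} ⊆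
      {π : List (Fin N.nV) | π.length ≤ 2 * N.nV} := by
    rintro π ⟨-, -, -, hc⟩
    have h1 : ∑ v : Fin N.nV, π.count v = π.length := by
      simpa using Multiset.sum_count_eq_card (s := Finset.univ)
        (m := (π : Multiset (Fin N.nV))) (by simp)
    have h2 : ∑ v : Fin N.nV, π.count v ≤ ∑ _v : Fin N.nV, 2 :=
      Finset.sum_le_sum fun v _ => hc v
    simp only [Finset.sum_const, Finset.card_univ, Fintype.card_fin, smul_eq_mul] at h2
    show π.length ≤ 2 * N.nV
    omega
  exact (h.subset hs).to_subtype

noncomputable instance (N : Network) (i : Fin N.nD) : Fintype (TwoWalk N i) :=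
  @Fintype.ofFinite _ (twoWalk_finite N i)

/-- The number of times that the walk `π` traverses the edge `e`. -/
def mult (N : Network) (e : Fin N.nE) (π : List (Fin N.nV)) : ℕ :=
  (π.zip π.tail).count (N.edge e)

/-! ### The 2-walk-based linear program -/

/-- The variables `p i π v`: the amount of flow of the `i`-th pair that is sent along the 2-walk
`π` and is processed at the vertex `v`. -/
abbrev Solution (N : Network) : Type := (i : Fin N.nD) → TwoWalk N i → Fin N.nV → ℝ

/-- The amount of (processed) flow that is sent along `π`: the sum over the vertices of `π`. -/
def walkFlow {N : Network} (p : Solution N) (i : Fin N.nD) (π : TwoWalk N i) : ℝ :=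
  ∑ v ∈ π.1.toFinset, p i π v

/-- Feasibility. A walk that traverses `e` twice uses the capacity of `e` twice. -/
structure Feasible (N : Network) (p : Solution N) : Prop where
  nonneg : ∀ i π v, 0 ≤ p i π v
  edge_cap : ∀ e, ∑ i, ∑ π : TwoWalk N i, (mult N e π.1 : ℝ) * walkFlow p i π ≤ N.B e
  vertex_cap : ∀ v, ∑ i, ∑ π : TwoWalk N i, p i π v ≤ N.C v

/-- The objective: the total amount of processed flow. -/
noncomputable def value {N : Network} (p : Solution N) : ℝ :=
  ∑ i, ∑ π : TwoWalk N i, walkFlow p i π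

/-- The optimal value of the linear program. -/
noncomputable def opt (N : Network) : ℝ := sSup {x | ∃ p, Feasible N p ∧ value p = x}

/-- The supremum in `opt` is one of a nonempty set that is bounded above. -/
theorem isLUB_opt (N : Network) : IsLUB {x | ∃ p, Feasible N p ∧ value p = x} (opt N) := by
  refine isLUB_csSup ⟨0, fun _ _ _ => 0, ⟨?_, ?_, ?_⟩, ?_⟩ ⟨∑ v, N.C v, ?_⟩
  · intros; exact le_rfl
  · intro e; simpa [walkFlow] using (N.B_pos e).le
  · intro v; simpa using N.C_nonneg v
  · simp [value, walkFlow]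
  · rintro x ⟨p, hp, rfl⟩
    calc value p ≤ ∑ i, ∑ π : TwoWalk N i, ∑ v, p i π v :=
          Finset.sum_le_sum fun i _ => Finset.sum_le_sum fun π _ =>
            Finset.sum_le_sum_of_subset_of_nonneg (Finset.subset_univ _)
              fun v _ _ => hp.nonneg i π v
      _ = ∑ v, ∑ i, ∑ π : TwoWalk N i, p i π v := by
          rw [Finset.sum_comm]
          refine Finset.sum_congr rfl fun i _ => ?_
          rw [Finset.sum_comm]
      _ ≤ ∑ v, N.C v := Finset.sum_le_sum fun v _ => hp.vertex_cap v

/-- A flow-2-walk: `amount` units of flow of one of the pairs, sent along one of its 2-walks and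
processed at the vertex `proc` of that walk. -/
structure FlowWalk (N : Network) where
  pair : Fin N.nD
  walk : TwoWalk N pair
  proc : Fin N.nV
  proc_mem : proc ∈ walk.1
  amount : ℝ

/-- The values of the variables of the linear program that a list of flow-2-walks describes. -/
def solutionOf {N : Network} (l : List (FlowWalk N)) : Solution N := fun i π v =>
  (l.map fun r => if r.pair = i ∧ r.walk.1 = π.1 ∧ r.proc = v then r.amount else 0).sum

/-- The same flow-2-walk with its amount multiplied by `c`. -/
def FlowWalk.scale {N : Network} (c : ℝ) (r : FlowWalk N) : FlowWalk N :=
  { r with amount := c * r.amount }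

/-! ### The multiplicative weight update method

There is one expert for each edge and one for each vertex. -/

/-- The gain of the expert of the edge `e` from `r`: the fraction of `B e` that `r` uses. -/
noncomputable def edgeGain {N : Network} (r : FlowWalk N) (e : Fin N.nE) : ℝ :=
  (mult N e r.walk.1 : ℝ) * r.amount / N.B e

/-- The gain of the expert of the vertex `v` from `r`: the fraction of `C v` that `r` uses. -/
noncomputable def vertexGain {N : Network} (r : FlowWalk N) (v : Fin N.nV) : ℝ :=
  if r.proc = v then r.amount / N.C v else 0

/-- The weight of the expert of `e` after the rounds `l`: initially `δ`, and multiplied by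
`1 + η * gain` in each round. -/
noncomputable def edgeWeight {N : Network} (η δ : ℝ) (l : List (FlowWalk N)) (e : Fin N.nE) : ℝ :=
  δ * (l.map fun r => 1 + η * edgeGain r e).prod

/-- The weight of the expert of `v` after the rounds `l`. -/
noncomputable def vertexWeight {N : Network} (η δ : ℝ) (l : List (FlowWalk N)) (v : Fin N.nV) :
    ℝ :=
  δ * (l.map fun r => 1 + η * vertexGain r v).prod

/-- The cost of the walk `π` with processing at `v`, under the edge weights `w` and the vertex
weights `q`; edges are counted as often as `π` traverses them. -/
noncomputable def cost (N : Network) (w : Fin N.nE → ℝ) (q : Fin N.nV → ℝ)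
    (π : List (Fin N.nV)) (v : Fin N.nV) : ℝ :=
  ∑ e, (mult N e π : ℝ) * (w e / N.B e) + q v / N.C v

/-- `r` is an answer of the optimal 2-walk oracle: its walk and processing vertex have minimum
cost among all 2-walks of all pairs and all their vertices of positive capacity, and its amount is
the largest that the capacities allow. -/
structure IsOracleChoice {N : Network} (w : Fin N.nE → ℝ) (q : Fin N.nV → ℝ) (r : FlowWalk N) :
    Prop where
  cap_pos : 0 < N.C r.proc
  cost_le : ∀ (i : Fin N.nD) (π : TwoWalk N i) (v : Fin N.nV), v ∈ π.1 → 0 < N.C v →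
    cost N w q r.walk.1 r.proc ≤ cost N w q π.1 v
  amount_max : IsGreatest
    {f : ℝ | f ≤ N.C r.proc ∧ ∀ e, (mult N e r.walk.1 : ℝ) * f ≤ N.B e} r.amount

/-- Some expert has reached the weight `1` after the rounds `l`. -/
def Saturated {N : Network} (η δ : ℝ) (l : List (FlowWalk N)) : Prop :=
  (∃ e, 1 ≤ edgeWeight η δ l e) ∨ ∃ v, 1 ≤ vertexWeight η δ l v

/-- `l` is the list of the rounds of a complete run of the method with learning rate `η` and
initial weights `δ`: in each round the oracle is called with the current weights, and the run ends
as soon as some weight is at least `1` (or at once, if nothing can be routed at all). -/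
structure IsMWURun {N : Network} (η δ : ℝ) (l : List (FlowWalk N)) : Prop where
  round : ∀ (t : ℕ) (ht : t < l.length), ¬ Saturated η δ (l.take t) ∧
    IsOracleChoice (edgeWeight η δ (l.take t)) (vertexWeight η δ (l.take t)) l[t]
  halted : Saturated η δ l ∨
    ∀ (i : Fin N.nD) (π : TwoWalk N i) (v : Fin N.nV), v ∈ π.1 → N.C v = 0

/-! ### Programs and their running time

A real random access machine, presented as a structured language with finitely many arrays of
natural numbers and of real numbers. Natural numbers (for indices and counters) can be added,
subtracted and compared; real numbers can be added, subtracted, multiplied, divided and compared.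
There is no rounding of reals to integers. Every operation, every memory access and every
instruction costs one step. -/

/-- The memory: the `i`-th entry of the `a`-th array of either kind. -/
structure Mem where
  nat : ℕ → ℕ → ℕ
  real : ℕ → ℕ → ℝ

inductive NExp : Type
  | const (n : ℕ)
  | get (a : ℕ) (i : NExp)
  | add (x y : NExp)
  | sub (x y : NExp)

def NExp.eval (σ : Mem) : NExp → ℕ
  | const n => n
  | get a i => σ.nat a (i.eval σ)
  | add x y => x.eval σ + y.eval σ
  | sub x y => x.eval σ - y.eval σ

def NExp.steps : NExp → ℕ
  | const _ => 1
  | get _ i => i.steps + 1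
  | add x y => x.steps + y.steps + 1
  | sub x y => x.steps + y.steps + 1

inductive RExp : Type
  | const (n : ℕ)
  | get (a : ℕ) (i : NExp)
  | add (x y : RExp)
  | sub (x y : RExp)
  | mul (x y : RExp)
  | div (x y : RExp)

noncomputable def RExp.eval (σ : Mem) : RExp → ℝ
  | const n => n
  | get a i => σ.real a (i.eval σ)
  | add x y => x.eval σ + y.eval σ
  | sub x y => x.eval σ - y.eval σ
  | mul x y => x.eval σ * y.eval σ
  | div x y => x.eval σ / y.eval σ

def RExp.steps : RExp → ℕ
  | const _ => 1
  | get _ i => i.steps + 1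
  | add x y => x.steps + y.steps + 1
  | sub x y => x.steps + y.steps + 1
  | mul x y => x.steps + y.steps + 1
  | div x y => x.steps + y.steps + 1

inductive BExp : Type
  | natLt (x y : NExp)
  | natEq (x y : NExp)
  | realLt (x y : RExp)
  | realEq (x y : RExp)
  | not (b : BExp)
  | and (b c : BExp)
  | or (b c : BExp)

def BExp.Holds (σ : Mem) : BExp → Prop
  | natLt x y => x.eval σ < y.eval σ
  | natEq x y => x.eval σ = y.eval σ
  | realLt x y => x.eval σ < y.eval σ
  | realEq x y => x.eval σ = y.eval σ
  | not b => ¬ b.Holds σ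
  | and b c => b.Holds σ ∧ c.Holds σ
  | or b c => b.Holds σ ∨ c.Holds σ

def BExp.steps : BExp → ℕ
  | natLt x y => x.steps + y.steps + 1
  | natEq x y => x.steps + y.steps + 1
  | realLt x y => x.steps + y.steps + 1
  | realEq x y => x.steps + y.steps + 1
  | not b => b.steps + 1
  | and b c => b.steps + c.steps + 1
  | or b c => b.steps + c.steps + 1

/-- Programs. `setNat a i x` and `setReal a i x` store `x` as the `i`-th entry of the `a`-th
array. -/
inductive Program : Type
  | skip
  | setNat (a : ℕ) (i x : NExp)
  | setReal (a : ℕ) (i : NExp) (x : RExp)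
  | seq (c d : Program)
  | cond (b : BExp) (c d : Program)
  | loop (b : BExp) (c : Program)

def Mem.setNat (σ : Mem) (a i x : ℕ) : Mem :=
  { σ with nat := fun a' i' => if a' = a ∧ i' = i then x else σ.nat a' i' }

noncomputable def Mem.setReal (σ : Mem) (a i : ℕ) (x : ℝ) : Mem :=
  { σ with real := fun a' i' => if a' = a ∧ i' = i then x else σ.real a' i' }

/-- `Exec c σ k τ`: started in the memory `σ`, the program `c` halts after exactly `k` steps, in
the memory `τ`. -/
inductive Exec : Program → Mem → ℕ → Mem → Prop
  | skip (σ : Mem) : Exec .skip σ 1 σ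
  | setNat (σ : Mem) (a : ℕ) (i x : NExp) :
      Exec (.setNat a i x) σ (i.steps + x.steps + 1) (σ.setNat a (i.eval σ) (x.eval σ))
  | setReal (σ : Mem) (a : ℕ) (i : NExp) (x : RExp) :
      Exec (.setReal a i x) σ (i.steps + x.steps + 1) (σ.setReal a (i.eval σ) (x.eval σ))
  | seq {c d : Program} {σ τ ρ : Mem} {k l : ℕ} (hc : Exec c σ k τ) (hd : Exec d τ l ρ) :
      Exec (.seq c d) σ (k + l) ρ
  | cond_true {b : BExp} {c d : Program} {σ τ : Mem} {k : ℕ} (hb : b.Holds σ)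
      (hc : Exec c σ k τ) : Exec (.cond b c d) σ (b.steps + k + 1) τ
  | cond_false {b : BExp} {c d : Program} {σ τ : Mem} {k : ℕ} (hb : ¬ b.Holds σ)
      (hd : Exec d σ k τ) : Exec (.cond b c d) σ (b.steps + k + 1) τ
  | loop_true {b : BExp} {c : Program} {σ τ ρ : Mem} {k l : ℕ} (hb : b.Holds σ)
      (hc : Exec c σ k τ) (hl : Exec (.loop b c) τ l ρ) :
      Exec (.loop b c) σ (b.steps + k + 1 + l) ρ
  | loop_false {b : BExp} {c : Program} {σ : Mem} (hb : ¬ b.Holds σ) :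
      Exec (.loop b c) σ (b.steps + 1) σ

/-- The initial memory. Natural arrays: `0` holds `|V|, |E|, |D|`; `1` and `2` the tails and the
heads of the edges; `3` and `4` the sources and the destinations of the pairs. Real arrays: `0`
holds `ε`; `1` the edge capacities; `2` the vertex capacities. Everything else is `0`. -/
noncomputable def input (N : Network) (ε : ℝ) : Mem where
  nat := fun a i => match a with
    | 0 => match i with
      | 0 => N.nV
      | 1 => N.nE
      | 2 => N.nD
      | _ => 0
    | 1 => if h : i < N.nE then (N.edge ⟨i, h⟩).1 else 0
    | 2 => if h : i < N.nE then (N.edge ⟨i, h⟩).2 else 0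
    | 3 => if h : i < N.nD then N.src ⟨i, h⟩ else 0
    | 4 => if h : i < N.nD then N.dst ⟨i, h⟩ else 0
    | _ => 0
  real := fun a i => match a with
    | 0 => if i = 0 then ε else 0
    | 1 => if h : i < N.nE then N.B ⟨i, h⟩ else 0
    | 2 => if h : i < N.nV then N.C ⟨i, h⟩ else 0
    | _ => 0

/-- `σ` holds the list `l` of flow-2-walks as its output: entry `0` of the natural array `5` is
the length of `l`; for the `j`-th flow-2-walk, the natural arrays `6`, `7`, `8`, `9` hold in entry
`j` its pair, its processing vertex, the number of vertices of its walk, and the place in the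
natural array `10` at which the list of these vertices begins; the real array `3` holds its
amount. -/
def Outputs {N : Network} (σ : Mem) (l : List (FlowWalk N)) : Prop :=
  σ.nat 5 0 = l.length ∧ ∀ (j : ℕ) (hj : j < l.length),
    σ.nat 6 j = l[j].pair ∧ σ.nat 7 j = l[j].proc ∧ σ.nat 8 j = l[j].walk.1.length ∧
    (∀ (k : ℕ) (hk : k < l[j].walk.1.length), σ.nat 10 (σ.nat 9 j + k) = (l[j].walk.1[k]).val) ∧
    σ.real 3 j = l[j].amount

end ProcFlow

namespace ProcFlow

/-! ### Analysis of the multiplicative weight update method -/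

/-! The run uses η = ε and δ = (1 + ε)^(-j), where X = |V| + |E| + 2 and j is the least exponent
with (1 + ε)^j ≥ X^⌈4/ε⌉. For this δ the divisor log_{1+η}((1+η)/δ) is exactly j + 1, so a machine
without logarithms and rounding obtains it by counting.

Quality. At the end every weight is at most 1 + η (`RoundsOK.weight_le`), while by Bernoulli's
inequality a total gain g forces the weight to be at least δ(1+η)^g. Hence every total gain is at
most the divisor, and the scaled flow is feasible (`sum_gain_le`, `RoundsOK.feasible`). By linear
programming duality, the minimum cost times OPT is at most the total weight (`value_mul_cost_le`),
so a round with amount f multiplies the total weight by at most exp(ηf/OPT)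
(`RoundsOK.sum_weight_le`). As some weight reaches 1, the amounts must add up to a lot. The high
power of X below 1/δ makes the loss caused by the number of experts a small fraction of ε
(`RoundsOK.value_ge`).

Rounds. Each round exhausts some capacity, so it multiplies the product of the weights by at least 1
+ η. All weights are below 1 before the last round, which leaves at most j(|E| + |A|) + 1 rounds,
where A contains all vertices that occur in 2-walks (`RoundsOK.length_le`). Here |A| ≤ min(|V|, |E|
+ |D|).

Oracle. Take two copies of the network, before and after the processing, with an edge of length
q_v/C(v) between the copies of each v of positive capacity. Every walk with a processing vertex
lifts to a path between the copies, so the distance is a lower bound for the cost (`search_min`).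
Conversely, a shortest path visits each node at most once, so its projection visits each vertex at
most twice (`search_walk`). Dijkstra's algorithm runs backwards from the destination with a
tournament tree as its queue. It touches at most 2|E| + 2 nodes, and time stamps make it unnecessary
to clear memory between searches. One search thus takes O(|E| log|V|) steps, without a term |V|
(`wp_dijkstra`, `layerGraph_cost_le`).

Time. There are O((|E| + |A|) log|V| / ε²) rounds of O(|V| + |E| + |D||E| log|V|) steps. The first
part of a round is bounded through |A| ≤ |E| + |D|, the second through |A| ≤ |V|; both give
|D||E|(|V| + |E|) log²|V| / ε² (`rounds_cost_le`). One of the two logarithms comes from j, the other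
one pays for the queue. Correctness and step counts of the program are derived together in the
calculus of `wp`. -/

theorem one_le_prod_of_one_le {ι : Type*} {s : Finset ι} {f : ι → ℝ} (h : ∀ i ∈ s, 1 ≤ f i) :
    1 ≤ ∏ i ∈ s, f i := by
  simpa using Finset.prod_le_prod_of_subset_of_one_le (Finset.empty_subset s) (by simp)
    fun i hi _ => h i hi

theorem le_prod_of_one_le {ι : Type*} {s : Finset ι} {f : ι → ℝ} (h : ∀ i ∈ s, 1 ≤ f i) {i : ι}
    (hi : i ∈ s) : f i ≤ ∏ i ∈ s, f i := by
  simpa using Finset.prod_le_prod_of_subset_of_one_le (Finset.singleton_subset_iff.2 hi)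
    (by simpa using zero_le_one.trans (h i hi)) fun i hi _ => h i hi

theorem ite_zero_nonneg {p : Prop} [Decidable p] {x : ℝ} (h : 0 ≤ x) :
    0 ≤ if p then x else 0 := by
  split_ifs
  exacts [h, le_rfl]

/-- Every entry of `l` is an oracle answer for the weights after the entries before it, and these
are not saturated. -/
def RoundsOK {N : Network} (η δ : ℝ) (l : List (FlowWalk N)) : Prop :=
  ∀ (t : ℕ) (ht : t < l.length), ¬ Saturated η δ (l.take t) ∧
    IsOracleChoice (edgeWeight η δ (l.take t)) (vertexWeight η δ (l.take t)) l[t]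

theorem roundsOK_nil {N : Network} (η δ : ℝ) : RoundsOK η δ ([] : List (FlowWalk N)) := by
  intro t ht; simp at ht

theorem roundsOK_concat {N : Network} {η δ : ℝ} {l : List (FlowWalk N)} {r : FlowWalk N} :
    RoundsOK η δ (l ++ [r]) ↔ RoundsOK η δ l ∧ ¬ Saturated η δ l ∧
      IsOracleChoice (edgeWeight η δ l) (vertexWeight η δ l) r := by
  constructor
  · intro h
    refine ⟨fun t ht => ?_, ?_⟩
    · have := h t (by simp; omega)
      rwa [List.take_append_of_le_length ht.le, List.getElem_append_left ht] at this
    · have := h l.length (by simp)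
      simpa using this
  · rintro ⟨h1, h2, h3⟩ t ht
    rcases Nat.lt_or_ge t l.length with h | h
    · rw [List.take_append_of_le_length h.le, List.getElem_append_left h]
      exact h1 t h
    · have : t = l.length := by simp at ht; omega
      subst this
      simpa using ⟨h2, h3⟩

theorem edgeWeight_concat {N : Network} (η δ : ℝ) (l : List (FlowWalk N)) (r : FlowWalk N)
    (e : Fin N.nE) :
    edgeWeight η δ (l ++ [r]) e = edgeWeight η δ l e * (1 + η * edgeGain r e) := by
  simp [edgeWeight, mul_assoc]

theorem vertexWeight_concat {N : Network} (η δ : ℝ) (l : List (FlowWalk N)) (r : FlowWalk N)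
    (v : Fin N.nV) :
    vertexWeight η δ (l ++ [r]) v = vertexWeight η δ l v * (1 + η * vertexGain r v) := by
  simp [vertexWeight, mul_assoc]

theorem not_saturated_iff {N : Network} {η δ : ℝ} {l : List (FlowWalk N)} :
    ¬ Saturated η δ l ↔ (∀ e, edgeWeight η δ l e < 1) ∧ ∀ v, vertexWeight η δ l v < 1 := by
  simp [Saturated]

/-! ### Gains of an oracle answer. -/

section Choice

variable {N : Network} {w : Fin N.nE → ℝ} {q : Fin N.nV → ℝ} {r : FlowWalk N}

theorem IsOracleChoice.amount_nonneg (h : IsOracleChoice w q r) : 0 ≤ r.amount :=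
  h.amount_max.2 ⟨N.C_nonneg _, fun e => by simpa using (N.B_pos e).le⟩

theorem IsOracleChoice.edgeGain_nonneg (h : IsOracleChoice w q r) (e : Fin N.nE) :
    0 ≤ edgeGain r e :=
  div_nonneg (mul_nonneg (Nat.cast_nonneg _) h.amount_nonneg) (N.B_pos e).le

theorem IsOracleChoice.edgeGain_le (h : IsOracleChoice w q r) (e : Fin N.nE) :
    edgeGain r e ≤ 1 :=
  (div_le_one (N.B_pos e)).2 (h.amount_max.1.2 e)

theorem IsOracleChoice.vertexGain_nonneg (h : IsOracleChoice w q r) (v : Fin N.nV) :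
    0 ≤ vertexGain r v := by
  unfold vertexGain
  split_ifs
  · exact div_nonneg h.amount_nonneg (N.C_nonneg v)
  · exact le_rfl

theorem IsOracleChoice.vertexGain_le (h : IsOracleChoice w q r) (v : Fin N.nV) :
    vertexGain r v ≤ 1 := by
  unfold vertexGain
  split_ifs with hv
  · subst hv
    exact (div_le_one h.cap_pos).2 h.amount_max.1.1
  · exact zero_le_one

/-- Some capacity is used up completely. -/
theorem IsOracleChoice.exists_tight (h : IsOracleChoice w q r) :
    vertexGain r r.proc = 1 ∨ ∃ e, edgeGain r e = 1 := by
  by_contra! hc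
  obtain ⟨hv, he⟩ := hc
  have hv' : r.amount < N.C r.proc := by
    refine lt_of_le_of_ne h.amount_max.1.1 fun heq => hv ?_
    simp [vertexGain, heq, h.cap_pos.ne']
  have he' : ∀ e, (mult N e r.walk.1 : ℝ) * r.amount < N.B e := fun e => by
    refine lt_of_le_of_ne (h.amount_max.1.2 e) fun heq => he e ?_
    simp [edgeGain, heq, (N.B_pos e).ne']
  -- If no constraint were tight, continuity would leave room for a slightly larger amount, against
  -- maximality.
  have h1 : ∀ᶠ f in nhdsWithin r.amount (Set.Ioi r.amount), f < N.C r.proc :=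
    nhdsWithin_le_nhds (eventually_lt_nhds hv')
  have h2 : ∀ᶠ f in nhdsWithin r.amount (Set.Ioi r.amount),
      ∀ e, (mult N e r.walk.1 : ℝ) * f < N.B e := by
    rw [Filter.eventually_all]
    intro e
    have : Filter.Tendsto (fun f : ℝ => (mult N e r.walk.1 : ℝ) * f) (nhds r.amount)
        (nhds ((mult N e r.walk.1 : ℝ) * r.amount)) :=
      (continuous_const.mul continuous_id).tendsto _
    exact nhdsWithin_le_nhds (this.eventually (eventually_lt_nhds (he' e)))
  obtain ⟨f, hf1, hf2, hf3⟩ := (h1.and (h2.and self_mem_nhdsWithin)).exists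
  exact absurd (h.amount_max.2 ⟨hf1.le, fun e => (hf2 e).le⟩) (not_le.2 hf3)

end Choice

/-! ### The potential argument for the number of rounds. -/

section Rounds

variable {N : Network} {η δ : ℝ} {l : List (FlowWalk N)}

theorem RoundsOK.edgeWeight_pos (hη : 0 < η) (hδ : 0 < δ) (h : RoundsOK η δ l) (e : Fin N.nE) :
    0 < edgeWeight η δ l e := by
  induction l using List.reverseRecOn with
  | nil => simpa [edgeWeight] using hδ
  | append_singleton l r ih =>
    obtain ⟨h1, -, h3⟩ := roundsOK_concat.1 h
    rw [edgeWeight_concat]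
    exact mul_pos (ih h1) (by nlinarith [h3.edgeGain_nonneg e])

theorem RoundsOK.vertexWeight_pos (hη : 0 < η) (hδ : 0 < δ) (h : RoundsOK η δ l)
    (v : Fin N.nV) : 0 < vertexWeight η δ l v := by
  induction l using List.reverseRecOn with
  | nil => simpa [vertexWeight] using hδ
  | append_singleton l r ih =>
    obtain ⟨h1, -, h3⟩ := roundsOK_concat.1 h
    rw [vertexWeight_concat]
    exact mul_pos (ih h1) (by nlinarith [h3.vertexGain_nonneg v])

/-- The product of the weights is a potential: no factor ever decreases, and the exhausted capacity
of a round contributes a factor 1 + η. Restricting the vertices to a set `A` that contains all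
processing vertices loses nothing and makes the round bound depend on |A| instead of |V|. -/
theorem RoundsOK.pow_le_prod (hη : 0 < η) (hδ : 0 < δ) (h : RoundsOK η δ l)
    (A : Finset (Fin N.nV)) (hA : ∀ r ∈ l, r.proc ∈ A) :
    δ ^ (N.nE + A.card) * (1 + η) ^ l.length ≤
      (∏ e, edgeWeight η δ l e) * ∏ v ∈ A, vertexWeight η δ l v := by
  induction l using List.reverseRecOn with
  | nil => simp [edgeWeight, vertexWeight, pow_add]
  | append_singleton l r ih =>
    obtain ⟨h1, -, h3⟩ := roundsOK_concat.1 h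
    have ih := ih h1 fun r hr => hA r (by simp [hr])
    simp only [edgeWeight_concat, vertexWeight_concat, Finset.prod_mul_distrib]
    have he1 : ∀ e, 1 ≤ 1 + η * edgeGain r e := fun e => by
      nlinarith [h3.edgeGain_nonneg e]
    have hv1 : ∀ v, 1 ≤ 1 + η * vertexGain r v := fun v => by
      nlinarith [h3.vertexGain_nonneg v]
    have hE : 1 ≤ ∏ e, (1 + η * edgeGain r e) := one_le_prod_of_one_le fun e _ => he1 e
    have hV : 1 ≤ ∏ v ∈ A, (1 + η * vertexGain r v) := one_le_prod_of_one_le fun v _ => hv1 v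
    have key : 1 + η ≤ (∏ e, (1 + η * edgeGain r e)) * ∏ v ∈ A, (1 + η * vertexGain r v) := by
      rcases h3.exists_tight with ht | ⟨e, ht⟩
      · have := le_prod_of_one_le (fun v _ => hv1 v) (hA r (by simp))
        rw [ht, mul_one] at this
        exact this.trans (le_mul_of_one_le_left (by linarith) hE)
      · have := le_prod_of_one_le (fun v _ => he1 v) (Finset.mem_univ e)
        rw [ht, mul_one] at this
        exact this.trans (le_mul_of_one_le_right (by linarith) hV)
    calc δ ^ (N.nE + A.card) * (1 + η) ^ (l ++ [r]).length
        = (δ ^ (N.nE + A.card) * (1 + η) ^ l.length) * (1 + η) := by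
          rw [List.length_append, List.length_singleton, pow_succ, mul_assoc]
      _ ≤ ((∏ e, edgeWeight η δ l e) * ∏ v ∈ A, vertexWeight η δ l v) *
          ((∏ e, (1 + η * edgeGain r e)) * ∏ v ∈ A, (1 + η * vertexGain r v)) := by
          refine mul_le_mul ih key (by linarith) ?_
          exact mul_nonneg (Finset.prod_nonneg fun e _ => (h1.edgeWeight_pos hη hδ e).le)
            (Finset.prod_nonneg fun v _ => (h1.vertexWeight_pos hη hδ v).le)
      _ = _ := by ring

/-- The number of rounds, when the initial weight is a power of `1 + η`. -/
theorem RoundsOK.length_le (hη : 0 < η) {j : ℕ} (h : RoundsOK η (1 / (1 + η) ^ j) l)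
    (A : Finset (Fin N.nV)) (hA : ∀ r ∈ l, r.proc ∈ A) :
    l.length ≤ j * (N.nE + A.card) + 1 := by
  have h0 : (0 : ℝ) < 1 + η := by linarith
  have hδ : (0 : ℝ) < 1 / (1 + η) ^ j := by positivity
  rcases List.eq_nil_or_concat l with rfl | ⟨l, r, rfl⟩
  · simp
  rw [List.concat_eq_append] at h hA ⊢
  obtain ⟨h1, h2, h3⟩ := roundsOK_concat.1 h
  -- The potential is evaluated before the last round, where all weights are still below 1; the last
  -- round is the additional 1 in the bound.
  have hp := h1.pow_le_prod hη hδ A fun r hr => hA r (by simp [hr])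
  obtain ⟨he, hv⟩ := not_saturated_iff.1 h2
  have hle : (∏ e, edgeWeight η (1 / (1 + η) ^ j) l e) *
      ∏ v ∈ A, vertexWeight η (1 / (1 + η) ^ j) l v ≤ 1 :=
    mul_le_one₀ (Finset.prod_le_one (fun e _ => (h1.edgeWeight_pos hη hδ e).le) fun e _ => (he e).le)
      (Finset.prod_nonneg fun v _ => (h1.vertexWeight_pos hη hδ v).le)
      (Finset.prod_le_one (fun v _ => (h1.vertexWeight_pos hη hδ v).le) fun v _ => (hv v).le)
  have h4 := hp.trans hle
  rw [one_div, inv_pow, ← pow_mul, inv_mul_le_iff₀ (by positivity), mul_one] at h4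
  have := (pow_le_pow_iff_right₀ (by linarith : 1 < 1 + η)).1 h4
  simp
  exact this

end Rounds

/-! ### Sums over the linear program -/

/-- The value and the loads of edges and vertices are all linear in the variables, so each of them
is an instance of this identity with suitable coefficients `g`. -/
theorem sum_solutionOf {N : Network} (l : List (FlowWalk N))
    (g : (i : Fin N.nD) → TwoWalk N i → Fin N.nV → ℝ) :
    ∑ i, ∑ π : TwoWalk N i, ∑ v, g i π v * solutionOf l i π v =
      (l.map fun r => g r.pair r.walk r.proc * r.amount).sum := by
  induction l with
  | nil => simp [solutionOf]
  | cons r l ih =>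
    have hs : ∀ i π v, solutionOf (r :: l) i π v =
        (if r.pair = i ∧ r.walk.1 = π.1 ∧ r.proc = v then r.amount else 0) +
          solutionOf l i π v := fun i π v => by simp [solutionOf]
    simp only [hs, mul_add, Finset.sum_add_distrib, ih, List.map_cons, List.sum_cons]
    congr 1
    rw [Finset.sum_eq_single r.pair, Finset.sum_eq_single r.walk, Finset.sum_eq_single r.proc]
    · simp
    · intro v _ hv; simp [hv.symm]
    · simp
    · intro π _ hπ
      refine Finset.sum_eq_zero fun v _ => ?_
      have : r.walk.1 ≠ π.1 := fun h => hπ (Subtype.ext h.symm)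
      simp [this]
    · simp
    · intro i _ hi
      exact Finset.sum_eq_zero fun π _ => Finset.sum_eq_zero fun v _ => by simp [hi.symm]
    · simp

theorem solutionOf_eq_zero {N : Network} (l : List (FlowWalk N)) (i : Fin N.nD)
    (π : TwoWalk N i) (v : Fin N.nV) (hv : v ∉ π.1) : solutionOf l i π v = 0 := by
  refine List.sum_eq_zero fun x hx => ?_
  obtain ⟨r, -, rfl⟩ := List.mem_map.1 hx
  refine if_neg ?_
  rintro ⟨-, h2, rfl⟩
  exact hv (h2 ▸ r.proc_mem)

theorem walkFlow_solutionOf {N : Network} (l : List (FlowWalk N)) (i : Fin N.nD)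
    (π : TwoWalk N i) : walkFlow (solutionOf l) i π = ∑ v, solutionOf l i π v :=
  Finset.sum_subset (Finset.subset_univ _) fun v _ hv =>
    solutionOf_eq_zero l i π v fun h => hv (List.mem_toFinset.2 h)

theorem value_solutionOf {N : Network} (l : List (FlowWalk N)) :
    value (solutionOf l) = (l.map FlowWalk.amount).sum := by
  have := sum_solutionOf l fun _ _ _ => 1
  simpa [value, walkFlow_solutionOf] using this

theorem edgeLoad_solutionOf {N : Network} (l : List (FlowWalk N)) (e : Fin N.nE) :
    ∑ i, ∑ π : TwoWalk N i, (mult N e π.1 : ℝ) * walkFlow (solutionOf l) i π =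
      (l.map fun r => (mult N e r.walk.1 : ℝ) * r.amount).sum := by
  have := sum_solutionOf l fun _ π _ => (mult N e π.1 : ℝ)
  simpa [walkFlow_solutionOf, Finset.mul_sum] using this

theorem vertexLoad_solutionOf {N : Network} (l : List (FlowWalk N)) (u : Fin N.nV) :
    ∑ i, ∑ π : TwoWalk N i, solutionOf l i π u =
      (l.map fun r => if r.proc = u then r.amount else 0).sum := by
  have := sum_solutionOf l fun _ _ v => if v = u then (1 : ℝ) else 0
  simpa [Finset.sum_ite_eq] using this

/-! ### Feasibility of the scaled run -/

/-- Bernoulli's inequality (1 + η)^g ≤ 1 + ηg for 0 ≤ g ≤ 1 turns the product into a power whose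
exponent is the total gain. -/
theorem sum_gain_le {α : Type*} {η δ : ℝ} (hη : 0 < η) (hδ : 0 < δ) (l : List α) (g : α → ℝ)
    (hg : ∀ a ∈ l, 0 ≤ g a ∧ g a ≤ 1)
    (h : δ * (l.map fun a => 1 + η * g a).prod ≤ 1 + η) :
    (l.map g).sum ≤ Real.logb (1 + η) ((1 + η) / δ) := by
  have h1 : 0 < 1 + η := by linarith
  have key : (1 + η) ^ (l.map g).sum ≤ (l.map fun a => 1 + η * g a).prod := by
    clear h
    induction l with
    | nil => simp
    | cons a l ih =>
      have ih := ih fun b hb => hg b (by simp [hb])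
      obtain ⟨h2, h3⟩ := hg a (by simp)
      simp only [List.map_cons, List.sum_cons, List.prod_cons, Real.rpow_add h1]
      have := rpow_one_add_le_one_add_mul_self (s := η) (p := g a) (by linarith) h2 h3
      exact mul_le_mul (by linarith) ih (by positivity) (by nlinarith)
  rw [Real.le_logb_iff_rpow_le (by linarith) (by positivity), le_div_iff₀ hδ]
  nlinarith

section Rounds

variable {N : Network} {η δ : ℝ} {l : List (FlowWalk N)}

theorem RoundsOK.gain_mem (h : RoundsOK η δ l) {r : FlowWalk N} (hr : r ∈ l) :
    0 ≤ r.amount ∧ 0 < N.C r.proc ∧ (∀ e, 0 ≤ edgeGain r e ∧ edgeGain r e ≤ 1) ∧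
      ∀ v, 0 ≤ vertexGain r v ∧ vertexGain r v ≤ 1 := by
  obtain ⟨t, ht, rfl⟩ := List.getElem_of_mem hr
  have := (h t ht).2
  exact ⟨this.amount_nonneg, this.cap_pos, fun e => ⟨this.edgeGain_nonneg e, this.edgeGain_le e⟩,
    fun v => ⟨this.vertexGain_nonneg v, this.vertexGain_le v⟩⟩

/-- Only the last round can push a weight beyond 1, and it multiplies by at most 1 + η. This
overshoot is the reason for the numerator 1 + η in the divisor of the amounts. -/
theorem RoundsOK.weight_le (hη : 0 < η) (hδ : 0 < δ) (hδ1 : δ < 1) (h : RoundsOK η δ l) :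
    (∀ e, edgeWeight η δ l e ≤ 1 + η) ∧ ∀ v, vertexWeight η δ l v ≤ 1 + η := by
  rcases List.eq_nil_or_concat l with rfl | ⟨l, r, rfl⟩
  · simp [edgeWeight, vertexWeight]; constructor <;> intro <;> linarith
  rw [List.concat_eq_append] at h ⊢
  obtain ⟨h1, h2, h3⟩ := roundsOK_concat.1 h
  obtain ⟨he, hv⟩ := not_saturated_iff.1 h2
  refine ⟨fun e => ?_, fun v => ?_⟩
  · rw [edgeWeight_concat]
    nlinarith [he e, h3.edgeGain_le e, h3.edgeGain_nonneg e, h1.edgeWeight_pos hη hδ e,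
      mul_nonneg hη.le (h3.edgeGain_nonneg e)]
  · rw [vertexWeight_concat]
    nlinarith [hv v, h3.vertexGain_le v, h3.vertexGain_nonneg v, h1.vertexWeight_pos hη hδ v,
      mul_nonneg hη.le (h3.vertexGain_nonneg v)]

theorem RoundsOK.feasible (hη : 0 < η) (hδ : 0 < δ) (hδ1 : δ < 1) (h : RoundsOK η δ l) :
    Feasible N (solutionOf
      (l.map (FlowWalk.scale (1 / Real.logb (1 + η) ((1 + η) / δ))))) := by
  set L := Real.logb (1 + η) ((1 + η) / δ) with hL
  have hLpos : 0 < L := Real.logb_pos (by linarith) ((one_lt_div hδ).2 (by linarith))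
  obtain ⟨hwe, hwv⟩ := h.weight_le hη hδ hδ1
  refine ⟨fun i π v => ?_, fun e => ?_, fun u => ?_⟩
  · refine List.sum_nonneg fun x hx => ?_
    obtain ⟨r', hr', rfl⟩ := List.mem_map.1 hx
    obtain ⟨r, hr, rfl⟩ := List.mem_map.1 hr'
    exact ite_zero_nonneg (mul_nonneg (by positivity) (h.gain_mem hr).1)
  · rw [edgeLoad_solutionOf, List.map_map]
    have h1 := sum_gain_le hη hδ l (fun r => edgeGain r e) (fun r hr => (h.gain_mem hr).2.2.1 e)
      (hwe e)
    calc _ = (l.map fun r => N.B e / L * edgeGain r e).sum := by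
          congr 1
          refine List.map_congr_left fun r _ => ?_
          have := (N.B_pos e).ne'
          simp only [Function.comp, FlowWalk.scale, edgeGain]
          field_simp
      _ = N.B e / L * (l.map fun r => edgeGain r e).sum := List.sum_map_mul_left ..
      _ ≤ N.B e / L * L := mul_le_mul_of_nonneg_left h1 (div_nonneg (N.B_pos e).le hLpos.le)
      _ = N.B e := div_mul_cancel₀ _ hLpos.ne'
  · rw [vertexLoad_solutionOf, List.map_map]
    have h1 := sum_gain_le hη hδ l (fun r => vertexGain r u)
      (fun r hr => (h.gain_mem hr).2.2.2 u) (hwv u)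
    calc _ = (l.map fun r => N.C u / L * vertexGain r u).sum := by
          congr 1
          refine List.map_congr_left fun r hr => ?_
          have := (h.gain_mem hr).2.1.ne'
          change (if r.proc = u then 1 / L * r.amount else 0) =
            N.C u / L * (if r.proc = u then r.amount / N.C u else 0)
          by_cases hu : r.proc = u
          · subst hu
            rw [if_pos rfl, if_pos rfl]
            field_simp
          · rw [if_neg hu, if_neg hu, mul_zero]
      _ = N.C u / L * (l.map fun r => vertexGain r u).sum := List.sum_map_mul_left ..
      _ ≤ N.C u / L * L := mul_le_mul_of_nonneg_left h1 (div_nonneg (N.C_nonneg u) hLpos.le)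
      _ = N.C u := div_mul_cancel₀ _ hLpos.ne'

/-! ### The value of the scaled run -/

/-- Weak duality. -/
theorem value_mul_cost_le {w : Fin N.nE → ℝ} {q : Fin N.nV → ℝ} (hw : ∀ e, 0 ≤ w e)
    (hq : ∀ v, 0 ≤ q v) {p : Solution N} (hp : Feasible N p) {α : ℝ}
    (hα : ∀ (i : Fin N.nD) (π : TwoWalk N i) (v : Fin N.nV), v ∈ π.1 → 0 < N.C v →
      α ≤ cost N w q π.1 v) :
    α * value p ≤ ∑ e, w e + ∑ v, q v := by
  -- A vertex without capacity processes nothing in a feasible solution, so no lower bound for its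
  -- cost is needed.
  have hz : ∀ i π v, N.C v = 0 → p i π v = 0 := fun i π v hv => by
    refine le_antisymm ?_ (hp.nonneg i π v)
    rw [← hv]
    refine le_trans ?_ (hp.vertex_cap v)
    refine le_trans ?_ (Finset.single_le_sum
      (f := fun i => ∑ π : TwoWalk N i, p i π v)
      (fun i _ => Finset.sum_nonneg fun π _ => hp.nonneg i π v) (Finset.mem_univ i))
    exact Finset.single_le_sum (f := fun π : TwoWalk N i => p i π v)
      (fun π _ => hp.nonneg i π v) (Finset.mem_univ π)
  calc α * value p = ∑ i, ∑ π : TwoWalk N i, ∑ v ∈ π.1.toFinset, α * p i π v := by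
        simp only [value, walkFlow, Finset.mul_sum]
    _ ≤ ∑ i, ∑ π : TwoWalk N i, ∑ v ∈ π.1.toFinset, cost N w q π.1 v * p i π v := by
        refine Finset.sum_le_sum fun i _ => Finset.sum_le_sum fun π _ =>
          Finset.sum_le_sum fun v hv => ?_
        rcases (N.C_nonneg v).eq_or_lt with h0 | h0
        · simp [hz i π v h0.symm]
        · exact mul_le_mul_of_nonneg_right (hα i π v (List.mem_toFinset.1 hv) h0)
            (hp.nonneg i π v)
    _ = (∑ i, ∑ π : TwoWalk N i, ∑ e, (w e / N.B e) * ((mult N e π.1 : ℝ) * walkFlow p i π)) +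
        ∑ i, ∑ π : TwoWalk N i, ∑ v ∈ π.1.toFinset, q v / N.C v * p i π v := by
        simp only [← Finset.sum_add_distrib]
        refine Finset.sum_congr rfl fun i _ => Finset.sum_congr rfl fun π _ => ?_
        simp only [cost, add_mul, Finset.sum_add_distrib, ← Finset.mul_sum, walkFlow]
        congr 1
        rw [Finset.sum_mul]
        exact Finset.sum_congr rfl fun e _ => by ring
    _ ≤ (∑ i, ∑ π : TwoWalk N i, ∑ e, (w e / N.B e) * ((mult N e π.1 : ℝ) * walkFlow p i π)) +
        ∑ i, ∑ π : TwoWalk N i, ∑ v, q v / N.C v * p i π v := by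
        gcongr with i _ π _
        · exact fun v _ _ => mul_nonneg (div_nonneg (hq v) (N.C_nonneg v)) (hp.nonneg i π v)
        · exact Finset.subset_univ _
    _ = (∑ e, (w e / N.B e) * ∑ i, ∑ π : TwoWalk N i, (mult N e π.1 : ℝ) * walkFlow p i π) +
        ∑ v, q v / N.C v * ∑ i, ∑ π : TwoWalk N i, p i π v := by
        simp only [Finset.mul_sum]
        congr 1
        · rw [Finset.sum_comm]
          exact Finset.sum_congr rfl fun i _ => Finset.sum_comm
        · rw [Finset.sum_comm]
          exact Finset.sum_congr rfl fun i _ => Finset.sum_comm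
    _ ≤ ∑ e, w e + ∑ v, q v := by
        gcongr with e _ v _
        · calc _ ≤ w e / N.B e * N.B e := mul_le_mul_of_nonneg_left (hp.edge_cap e)
                (div_nonneg (hw e) (N.B_pos e).le)
            _ = w e := div_mul_cancel₀ _ (N.B_pos e).ne'
        · rcases (N.C_nonneg v).eq_or_lt with h0 | h0
          · simpa [← h0] using hq v
          · calc _ ≤ q v / N.C v * N.C v := mul_le_mul_of_nonneg_left (hp.vertex_cap v)
                  (div_nonneg (hq v) (N.C_nonneg v))
              _ = q v := div_mul_cancel₀ _ h0.ne'

theorem opt_nonneg (N : Network) : 0 ≤ opt N := by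
  refine (isLUB_opt N).1 ⟨fun _ _ _ => 0, ⟨?_, ?_, ?_⟩, ?_⟩
  · intros; exact le_rfl
  · intro e; simpa [walkFlow] using (N.B_pos e).le
  · intro v; simpa using N.C_nonneg v
  · simp [value, walkFlow]

theorem cost_mul_opt_le {w : Fin N.nE → ℝ} {q : Fin N.nV → ℝ} (hw : ∀ e, 0 ≤ w e)
    (hq : ∀ v, 0 ≤ q v) {α : ℝ} (hα0 : 0 ≤ α)
    (hα : ∀ (i : Fin N.nD) (π : TwoWalk N i) (v : Fin N.nV), v ∈ π.1 → 0 < N.C v →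
      α ≤ cost N w q π.1 v) :
    α * opt N ≤ ∑ e, w e + ∑ v, q v := by
  rcases hα0.eq_or_lt with h0 | h0
  · rw [← h0, zero_mul]
    exact add_nonneg (Finset.sum_nonneg fun e _ => hw e) (Finset.sum_nonneg fun v _ => hq v)
  · rw [mul_comm, ← le_div_iff₀ h0]
    refine (isLUB_opt N).2 ?_
    rintro x ⟨p, hp, rfl⟩
    rw [le_div_iff₀ h0, mul_comm]
    exact value_mul_cost_le hw hq hp hα

/-- A round with amount f and cost c adds exactly ηfc to the total weight D. Since c is the minimum
cost, duality gives c ≤ D/OPT, so D grows at most by the factor 1 + ηf/OPT ≤ exp(ηf/OPT). -/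
theorem RoundsOK.sum_weight_le (hη : 0 < η) (hδ : 0 < δ) (h : RoundsOK η δ l)
    (hopt : 0 < opt N) :
    ∑ e, edgeWeight η δ l e + ∑ v, vertexWeight η δ l v ≤
      (N.nE + N.nV) * δ * Real.exp (η * (l.map FlowWalk.amount).sum / opt N) := by
  induction l using List.reverseRecOn with
  | nil => simp [edgeWeight, vertexWeight]; linarith
  | append_singleton l r ih =>
    obtain ⟨h1, -, h3⟩ := roundsOK_concat.1 h
    have ih := ih h1
    set w := edgeWeight η δ l
    set q := vertexWeight η δ l
    set c := cost N w q r.walk.1 r.proc with hc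
    have hw : ∀ e, 0 ≤ w e := fun e => (h1.edgeWeight_pos hη hδ e).le
    have hq : ∀ v, 0 ≤ q v := fun v => (h1.vertexWeight_pos hη hδ v).le
    have hc0 : 0 ≤ c := add_nonneg
      (Finset.sum_nonneg fun e _ => mul_nonneg (Nat.cast_nonneg _)
        (div_nonneg (hw e) (N.B_pos e).le)) (div_nonneg (hq _) (N.C_nonneg _))
    have hdual := cost_mul_opt_le hw hq hc0 h3.cost_le
    have hstep : ∑ e, edgeWeight η δ (l ++ [r]) e + ∑ v, vertexWeight η δ (l ++ [r]) v =
        (∑ e, w e + ∑ v, q v) + η * r.amount * c := by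
      have he : ∀ e, edgeWeight η δ (l ++ [r]) e =
          w e + η * r.amount * ((mult N e r.walk.1 : ℝ) * (w e / N.B e)) := fun e => by
        rw [edgeWeight_concat, edgeGain]; ring
      have hv : ∀ v, vertexWeight η δ (l ++ [r]) v =
          q v + if r.proc = v then η * r.amount * (q v / N.C v) else 0 := fun v => by
        rw [vertexWeight_concat, vertexGain]; split_ifs <;> ring
      rw [Finset.sum_congr rfl fun e _ => he e, Finset.sum_congr rfl fun v _ => hv v,
        Finset.sum_add_distrib, Finset.sum_add_distrib, ← Finset.mul_sum, Finset.sum_ite_eq,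
        if_pos (Finset.mem_univ _), hc, cost]
      ring
    have hf := h3.amount_nonneg
    rw [hstep]
    set D := ∑ e, w e + ∑ v, q v
    have hD : 0 ≤ D := add_nonneg (Finset.sum_nonneg fun e _ => hw e)
      (Finset.sum_nonneg fun v _ => hq v)
    have hcD : c ≤ D / opt N := (le_div_iff₀ hopt).2 hdual
    calc D + η * r.amount * c ≤ D + η * r.amount * (D / opt N) := by gcongr
      _ = D * (η * r.amount / opt N + 1) := by ring
      _ ≤ D * Real.exp (η * r.amount / opt N) := by
          gcongr; exact Real.add_one_le_exp _
      _ ≤ (N.nE + N.nV) * δ * Real.exp (η * (l.map FlowWalk.amount).sum / opt N) *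
          Real.exp (η * r.amount / opt N) := by gcongr
      _ = _ := by
          rw [mul_assoc, ← Real.exp_add]
          simp only [List.map_append, List.map_cons, List.map_nil, List.sum_append, List.sum_cons,
            List.sum_nil, add_zero, mul_add, add_div]

theorem RoundsOK.amount_sum_nonneg (h : RoundsOK η δ l) : 0 ≤ (l.map FlowWalk.amount).sum :=
  List.sum_nonneg fun x hx => by
    obtain ⟨r, hr, rfl⟩ := List.mem_map.1 hx
    exact (h.gain_mem hr).1

theorem opt_eq_zero (h : ∀ (i : Fin N.nD) (π : TwoWalk N i) (v : Fin N.nV), v ∈ π.1 → N.C v = 0) :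
    opt N = 0 := by
  refine le_antisymm ?_ (opt_nonneg N)
  -- If no walk meets a vertex of positive capacity, the cost condition of duality is vacuous, so
  -- zero weights are compatible with the bound `α = 1`.
  have := cost_mul_opt_le (N := N) (w := fun _ => 0) (q := fun _ => 0) (α := 1)
    (by simp) (by simp) (by simp) fun i π v hv hC => absurd (h i π v hv) hC.ne'
  simpa using this

/-- In the application `a` = log X, `b` = log δ, `c` = log(1 + η), `o` is the optimum, `F` the
unscaled value and `L` the divisor. A factor 1 - η/2 is lost twice, once for log X and log(1 + η)
against -log δ, once for log(1 + η) against η; and (1 - η/2)² exceeds 1 - η by η²/4. -/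
theorem scaled_value_ge {η a b c o F L : ℝ} (hη : 0 < η) (hη1 : η < 1) (hc : 0 < c) (_ha : 0 < a)
    (hca : c ≤ a) (hcη : (1 - η / 2) * η ≤ c) (ho : 0 < o) (hF : 0 ≤ F) (hab : 4 * a ≤ η * -b)
    (hL : L * c = c - b) (h : (-b - a) * o ≤ η * F) : (1 - η) * o * L ≤ F := by
  have hb : 0 < -b := by
    by_contra hb
    nlinarith
  have hr1 : (1 - η / 2) * (c - b) ≤ -b - a := by nlinarith
  have h2 : (1 - η / 2) * (c - b) * o ≤ η * F :=
    (mul_le_mul_of_nonneg_right hr1 ho.le).trans h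
  have h3 : (1 - η / 2) * ((1 - η / 2) * (c - b) * o) ≤ c * F := by
    refine (mul_le_mul_of_nonneg_left h2 (by linarith)).trans ?_
    rw [← mul_assoc]
    exact mul_le_mul_of_nonneg_right hcη hF
  have h4 : 0 ≤ η ^ 2 / 4 * ((c - b) * o) :=
    mul_nonneg (by positivity) (mul_nonneg (by linarith) ho.le)
  have h5 : c * ((1 - η) * o * L) = (1 - η) * ((c - b) * o) := by rw [← hL]; ring
  refine le_of_mul_le_mul_left ?_ hc
  rw [h5]
  calc (1 - η) * ((c - b) * o) ≤ (1 - η) * ((c - b) * o) + η ^ 2 / 4 * ((c - b) * o) := by linarith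
    _ = (1 - η / 2) * ((1 - η / 2) * (c - b) * o) := by ring
    _ ≤ c * F := h3

/-- The approximation guarantee: `X` bounds the number of experts, and `1 / δ` is at least a
large power of it. -/
theorem RoundsOK.value_ge (hη : 0 < η) (hη1 : η < 1) (hδ : 0 < δ) (hδ1 : δ < 1)
    (h : RoundsOK η δ l)
    (hh : Saturated η δ l ∨
      ∀ (i : Fin N.nD) (π : TwoWalk N i) (v : Fin N.nV), v ∈ π.1 → N.C v = 0)
    {X : ℝ} (hX : 2 ≤ X) (hXM : (N.nE + N.nV : ℝ) ≤ X) {k : ℕ} (hk : 4 ≤ k * η)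
    (hXk : X ^ k ≤ 1 / δ) :
    (1 - η) * opt N ≤ value (solutionOf
      (l.map (FlowWalk.scale (1 / Real.logb (1 + η) ((1 + η) / δ))))) := by
  have hF := h.amount_sum_nonneg
  set L := Real.logb (1 + η) ((1 + η) / δ) with hL
  have hLpos : 0 < L := Real.logb_pos (by linarith) ((one_lt_div hδ).2 (by linarith))
  have hval : value (solutionOf (l.map (FlowWalk.scale (1 / L)))) =
      1 / L * (l.map FlowWalk.amount).sum := by
    rw [value_solutionOf, List.map_map, ← List.sum_map_mul_left]
    rfl
  rw [hval]
  set F := (l.map FlowWalk.amount).sum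
  rcases (opt_nonneg N).eq_or_lt with h0 | h0
  · rw [← h0, mul_zero]; positivity
  rcases hh with hh | hh
  swap
  · exact absurd (opt_eq_zero hh) h0.ne'
  have hw := h.sum_weight_le hη hδ h0
  have hD1 : 1 ≤ ∑ e, edgeWeight η δ l e + ∑ v, vertexWeight η δ l v := by
    have hw0 : ∀ e, 0 ≤ edgeWeight η δ l e := fun e => (h.edgeWeight_pos hη hδ e).le
    have hq0 : ∀ v, 0 ≤ vertexWeight η δ l v := fun v => (h.vertexWeight_pos hη hδ v).le
    have hs1 : 0 ≤ ∑ e, edgeWeight η δ l e := Finset.sum_nonneg fun e _ => hw0 e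
    have hs2 : 0 ≤ ∑ v, vertexWeight η δ l v := Finset.sum_nonneg fun v _ => hq0 v
    rcases hh with ⟨e, he⟩ | ⟨v, hv⟩
    · have := Finset.single_le_sum (fun e _ => hw0 e) (Finset.mem_univ e)
      linarith
    · have := Finset.single_le_sum (fun e _ => hq0 e) (Finset.mem_univ v)
      linarith
  have hexp : 1 ≤ X * δ * Real.exp (η * F / opt N) :=
    (hD1.trans hw).trans (by gcongr)
  have hlX : 0 < Real.log X := Real.log_pos (by linarith)
  have hlog : 0 ≤ Real.log X + Real.log δ + η * F / opt N := by
    have := Real.log_nonneg hexp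
    rwa [Real.log_mul (by positivity) (Real.exp_pos _).ne', Real.log_mul (by positivity) hδ.ne',
      Real.log_exp] at this
  have hkl : k * Real.log X ≤ - Real.log δ := by
    have := Real.log_le_log (by positivity) hXk
    rwa [Real.log_pow, one_div, Real.log_inv] at this
  have hl1 : 0 < Real.log (1 + η) := Real.log_pos (by linarith)
  have hl2 : Real.log (1 + η) ≤ Real.log X := Real.log_le_log (by linarith) (by linarith)
  -- This follows from log(1 + η) ≥ 2η/(η + 2).
  have hl3 : η - η ^ 2 / 2 ≤ Real.log (1 + η) := by
    refine le_trans ?_ (Real.le_log_one_add_of_nonneg hη.le)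
    rw [le_div_iff₀ (by linarith)]
    nlinarith [mul_pos hη (mul_pos hη hη)]
  have hLeq : L = (Real.log (1 + η) - Real.log δ) / Real.log (1 + η) := by
    rw [hL, Real.logb, Real.log_div (by linarith) hδ.ne']
  have h1 : (- Real.log δ - Real.log X) * opt N ≤ η * F := by
    rw [← le_div_iff₀ h0]
    linarith
  have hLc : L * Real.log (1 + η) = Real.log (1 + η) - Real.log δ := by
    rw [hLeq]; field_simp
  rw [one_div, ← div_eq_inv_mul, le_div_iff₀ hLpos]
  refine scaled_value_ge hη hη1 hl1 hlX hl2 (by nlinarith) h0 hF ?_ hLc h1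
  have : 4 * Real.log X ≤ k * η * Real.log X := mul_le_mul_of_nonneg_right hk hlX.le
  nlinarith

end Rounds

/-! ### A program logic with time bounds -/

/-- The program halts, and the number of steps and the final memory satisfy `Q`. -/
def wp (c : Program) (σ : Mem) (Q : ℕ → Mem → Prop) : Prop := ∃ k τ, Exec c σ k τ ∧ Q k τ

theorem wp_mono {c : Program} {σ : Mem} {Q R : ℕ → Mem → Prop} (h : wp c σ Q)
    (hQR : ∀ k τ, Q k τ → R k τ) : wp c σ R := by
  obtain ⟨k, τ, h1, h2⟩ := h
  exact ⟨k, τ, h1, hQR k τ h2⟩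

theorem wp_skip {σ : Mem} {Q : ℕ → Mem → Prop} : wp .skip σ Q ↔ Q 1 σ :=
  ⟨fun ⟨_, _, h1, h2⟩ => by cases h1; exact h2, fun h => ⟨_, _, .skip σ, h⟩⟩

theorem wp_setNat {σ : Mem} {Q : ℕ → Mem → Prop} {a : ℕ} {i x : NExp} :
    wp (.setNat a i x) σ Q ↔ Q (i.steps + x.steps + 1) (σ.setNat a (i.eval σ) (x.eval σ)) :=
  ⟨fun ⟨_, _, h1, h2⟩ => by cases h1; exact h2, fun h => ⟨_, _, .setNat σ a i x, h⟩⟩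

theorem wp_setReal {σ : Mem} {Q : ℕ → Mem → Prop} {a : ℕ} {i : NExp} {x : RExp} :
    wp (.setReal a i x) σ Q ↔ Q (i.steps + x.steps + 1) (σ.setReal a (i.eval σ) (x.eval σ)) :=
  ⟨fun ⟨_, _, h1, h2⟩ => by cases h1; exact h2, fun h => ⟨_, _, .setReal σ a i x, h⟩⟩

theorem wp_seq {c d : Program} {σ : Mem} {Q : ℕ → Mem → Prop} :
    wp (.seq c d) σ Q ↔ wp c σ fun k τ => wp d τ fun l ρ => Q (k + l) ρ := by
  constructor
  · rintro ⟨_, _, h1, h2⟩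
    cases h1 with
    | seq hc hd => exact ⟨_, _, hc, _, _, hd, h2⟩
  · rintro ⟨_, _, h1, _, _, h2, h3⟩
    exact ⟨_, _, .seq h1 h2, h3⟩

open Classical in
theorem wp_cond {b : BExp} {c d : Program} {σ : Mem} {Q : ℕ → Mem → Prop} :
    wp (.cond b c d) σ Q ↔
      if b.Holds σ then wp c σ fun k τ => Q (b.steps + k + 1) τ
      else wp d σ fun k τ => Q (b.steps + k + 1) τ := by
  constructor
  · rintro ⟨_, _, h1, h2⟩
    cases h1 with
    | cond_true hb hc => rw [if_pos hb]; exact ⟨_, _, hc, h2⟩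
    | cond_false hb hc => rw [if_neg hb]; exact ⟨_, _, hc, h2⟩
  · intro h
    split_ifs at h with hb
    · obtain ⟨_, _, h1, h2⟩ := h
      exact ⟨_, _, .cond_true hb h1, h2⟩
    · obtain ⟨_, _, h1, h2⟩ := h
      exact ⟨_, _, .cond_false hb h1, h2⟩

/-- Whether the program contains an assignment to the natural array `a`. -/
def Program.writesNat (a : ℕ) : Program → Bool
  | skip => false
  | setNat a' _ _ => a' == a
  | setReal _ _ _ => false
  | seq c d => c.writesNat a || d.writesNat a
  | cond _ c d => c.writesNat a || d.writesNat a
  | loop _ c => c.writesNat a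

/-- Whether the program contains an assignment to the real array `a`. -/
def Program.writesReal (a : ℕ) : Program → Bool
  | skip => false
  | setNat _ _ _ => false
  | setReal a' _ _ => a' == a
  | seq c d => c.writesReal a || d.writesReal a
  | cond _ c d => c.writesReal a || d.writesReal a
  | loop _ c => c.writesReal a

/-- The two memories agree outside of the arrays to which the program assigns. -/
structure Frame (c : Program) (σ τ : Mem) : Prop where
  nat : ∀ a, c.writesNat a = false → τ.nat a = σ.nat a
  real : ∀ a, c.writesReal a = false → τ.real a = σ.real a

theorem Frame.refl (c : Program) (σ : Mem) : Frame c σ σ := ⟨fun _ _ => rfl, fun _ _ => rfl⟩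

theorem Frame.trans {c : Program} {σ τ ρ : Mem} (h : Frame c σ τ) (h' : Frame c τ ρ) :
    Frame c σ ρ :=
  ⟨fun a ha => (h'.nat a ha).trans (h.nat a ha), fun a ha => (h'.real a ha).trans (h.real a ha)⟩

theorem Exec.frame {c : Program} {σ τ : Mem} {k : ℕ} (h : Exec c σ k τ) : Frame c σ τ := by
  induction h with
  | skip => exact Frame.refl _ _
  | setNat σ a i x =>
    refine ⟨fun a' ha => ?_, fun _ _ => rfl⟩
    have : a ≠ a' := by simpa [Program.writesNat] using ha
    funext j
    simp [Mem.setNat, this.symm]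
  | setReal σ a i x =>
    refine ⟨fun _ _ => rfl, fun a' ha => ?_⟩
    have : a ≠ a' := by simpa [Program.writesReal] using ha
    funext j
    simp [Mem.setReal, this.symm]
  | seq hc hd ih1 ih2 =>
    constructor <;> intro a ha <;> simp only [Program.writesNat, Program.writesReal,
      Bool.or_eq_false_iff] at ha
    · exact (ih2.nat a ha.2).trans (ih1.nat a ha.1)
    · exact (ih2.real a ha.2).trans (ih1.real a ha.1)
  | cond_true hb hc ih =>
    constructor <;> intro a ha <;> simp only [Program.writesNat, Program.writesReal,
      Bool.or_eq_false_iff] at ha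
    · exact ih.nat a ha.1
    · exact ih.real a ha.1
  | cond_false hb hc ih =>
    constructor <;> intro a ha <;> simp only [Program.writesNat, Program.writesReal,
      Bool.or_eq_false_iff] at ha
    · exact ih.nat a ha.2
    · exact ih.real a ha.2
  | loop_true hb hc hl ih1 ih2 =>
    constructor <;> intro a ha
    · exact (ih2.nat a ha).trans (ih1.nat a ha)
    · exact (ih2.real a ha).trans (ih1.real a ha)
  | loop_false hb => exact Frame.refl _ _

/-- This lets each specification mention only what changes. Which arrays a concrete program writes
is a computable property of its syntax, so the side conditions are settled by `decide` or `rfl`. -/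
theorem wp_frame {c : Program} {σ : Mem} {Q : ℕ → Mem → Prop} (h : wp c σ Q) :
    wp c σ fun k τ => Frame c σ τ ∧ Q k τ := by
  obtain ⟨k, τ, h1, h2⟩ := h
  exact ⟨k, τ, h1, h1.frame, h2⟩

/-- The rule for loops: in `I r τ`, the number `r` bounds the number of remaining steps. -/
theorem wp_loop {b : BExp} {c : Program} {σ₀ : Mem} (I : ℕ → Mem → Prop) {Q : Mem → Prop}
    (hstep : ∀ r σ, Frame c σ₀ σ → I r σ → b.Holds σ →
      wp c σ fun k τ => Frame c σ₀ τ → ∃ r', I r' τ ∧ r' + k + b.steps + 1 ≤ r)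
    (hexit : ∀ r σ, Frame c σ₀ σ → I r σ → ¬ b.Holds σ → b.steps + 1 ≤ r ∧ Q σ)
    {r : ℕ} (h : I r σ₀) : wp (.loop b c) σ₀ fun k τ => k ≤ r ∧ Q τ := by
  suffices H : ∀ r σ, Frame c σ₀ σ → I r σ → wp (.loop b c) σ fun k τ => k ≤ r ∧ Q τ from
    H r σ₀ (Frame.refl _ _) h
  intro r
  induction r using Nat.strong_induction_on with
  | _ r ih =>
    intro σ hF hI
    by_cases hb : b.Holds σ
    · obtain ⟨k, τ, h1, h2⟩ := hstep r σ hF hI hb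
      have hF' := hF.trans h1.frame
      obtain ⟨r', h3, h4⟩ := h2 hF'
      obtain ⟨l, ρ, h5, h6, h7⟩ := ih r' (by omega) τ hF' h3
      exact ⟨_, ρ, .loop_true hb h1 h5, by omega, h7⟩
    · obtain ⟨h1, h2⟩ := hexit r σ hF hI hb
      exact ⟨_, σ, .loop_false hb, h1, h2⟩

/-- `for iv := 0, …, bound - 1 do body`. -/
def forLoop (iv : ℕ) (bound : NExp) (body : Program) : Program :=
  .seq (.setNat iv (.const 0) (.const 0))
    (.loop (.natLt (.get iv (.const 0)) bound)
      (.seq body (.setNat iv (.const 0) (.add (.get iv (.const 0)) (.const 1)))))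

theorem Mem.setNat_nat_self (σ : Mem) (a i x : ℕ) :
    (σ.setNat a i x).nat a = Function.update (σ.nat a) i x := by
  funext j; simp [Mem.setNat, Function.update_apply]

theorem Mem.setNat_nat_of_ne (σ : Mem) {a a' : ℕ} (i x : ℕ) (h : a' ≠ a) :
    (σ.setNat a i x).nat a' = σ.nat a' := by
  funext j; simp [Mem.setNat, h]

theorem Mem.setNat_real (σ : Mem) (a i x : ℕ) : (σ.setNat a i x).real = σ.real := rfl

theorem Mem.setReal_real_self (σ : Mem) (a i : ℕ) (x : ℝ) :
    (σ.setReal a i x).real a = Function.update (σ.real a) i x := by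
  funext j; simp [Mem.setReal, Function.update_apply]

theorem Mem.setReal_real_of_ne (σ : Mem) {a a' : ℕ} (i : ℕ) (x : ℝ) (h : a' ≠ a) :
    (σ.setReal a i x).real a' = σ.real a' := by
  funext j; simp [Mem.setReal, h]

theorem Mem.setReal_nat (σ : Mem) (a i : ℕ) (x : ℝ) : (σ.setReal a i x).nat = σ.nat := rfl

/-- The rule for `forLoop`. The invariant may not depend on the counter. -/
theorem wp_forLoop {iv : ℕ} {bound : NExp} {body : Program} {σ₀ : Mem} (n t : ℕ)
    (I : ℕ → Mem → Prop)
    (hiv : body.writesNat iv = false)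
    (hI : ∀ i σ x, I i σ → I i (σ.setNat iv 0 x))
    (hbound : ∀ σ, Frame (forLoop iv bound body) σ₀ σ → bound.eval σ = n)
    (hbody : ∀ i σ, i < n → Frame (forLoop iv bound body) σ₀ σ → σ.nat iv 0 = i → I i σ →
      wp body σ fun k τ => k ≤ t ∧ I (i + 1) τ)
    (h : I 0 σ₀) :
    wp (forLoop iv bound body) σ₀ fun k τ => k ≤ n * (t + bound.steps + 10) + bound.steps + 7 ∧
      I n τ := by
  have hfr : ∀ σ τ, Frame (.setNat iv (.const 0) (.const 0)) σ τ →
      Frame (forLoop iv bound body) σ τ := fun σ τ hF =>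
    ⟨fun a ha => hF.nat a (by simp [forLoop, Program.writesNat] at ha ⊢; exact ha.1),
      fun a ha => hF.real a (by simp [Program.writesReal])⟩
  have hfr' : ∀ σ τ, Frame (.seq body (.setNat iv (.const 0)
      (.add (.get iv (.const 0)) (.const 1)))) σ τ →
      Frame (forLoop iv bound body) σ τ := fun σ τ hF =>
    ⟨fun a ha => hF.nat a (by simp [forLoop, Program.writesNat] at ha ⊢; exact ⟨ha.2.1, ha.1⟩),
      fun a ha => hF.real a (by simp [forLoop, Program.writesReal] at ha ⊢; exact ha)⟩
  rw [forLoop, wp_seq, wp_setNat]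
  have h0 := hfr _ _ (Exec.setNat σ₀ iv (.const 0) (.const 0)).frame
  simp only [NExp.eval, NExp.steps] at h0 ⊢
  -- An iteration costs `t` for the body, 6 for the increment and `bound.steps + 4` for the test;
  -- the failing test costs `bound.steps + 4` once more, and the initialisation 3.
  have := wp_loop (b := .natLt (.get iv (.const 0)) bound)
    (c := .seq body (.setNat iv (.const 0) (.add (.get iv (.const 0)) (.const 1))))
    (σ₀ := σ₀.setNat iv 0 0)
    (fun r σ => ∃ i ≤ n, σ.nat iv 0 = i ∧ I i σ ∧
      r = (n - i) * (t + bound.steps + 10) + bound.steps + 4) (Q := fun τ => I n τ)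
    (r := n * (t + bound.steps + 10) + bound.steps + 4) ?_ ?_
    ⟨0, Nat.zero_le _, by simp [Mem.setNat], hI _ _ _ h, by simp⟩
  · refine wp_mono this fun k τ hk => ⟨by omega, hk.2⟩
  · rintro r σ hF ⟨i, hin, hi, hIi, rfl⟩ hb
    have hF1 := h0.trans (hfr' _ _ hF)
    have hlt : i < n := by
      simpa [BExp.Holds, NExp.eval, hbound σ hF1, hi] using hb
    rw [wp_seq]
    refine wp_mono (wp_frame (hbody i σ hlt hF1 hi hIi)) ?_
    rintro k τ ⟨hFτ, hk, hIτ⟩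
    rw [wp_setNat]
    intro _
    have hτ : τ.nat iv 0 = i := by rw [hFτ.nat iv hiv, hi]
    refine ⟨_, ⟨i + 1, hlt, ?_, ?_, rfl⟩, ?_⟩
    · simp [NExp.eval, Mem.setNat, hτ]
    · simpa [NExp.eval] using hI _ _ _ hIτ
    · have : n - i = (n - (i + 1)) + 1 := by omega
      rw [this]
      simp only [NExp.steps, BExp.steps, add_mul]
      omega
  · rintro r σ hF ⟨i, hin, hi, hIi, rfl⟩ hb
    have hF1 := h0.trans (hfr' _ _ hF)
    have : i = n := by
      simp [BExp.Holds, NExp.eval, hbound σ hF1, hi] at hb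
      omega
    subst this
    refine ⟨by simp [BExp.steps, NExp.steps]; omega, hIi⟩

attribute [simp] NExp.eval NExp.steps RExp.eval RExp.steps BExp.Holds BExp.steps wp_seq wp_setNat
  wp_setReal wp_skip wp_cond Mem.setNat_nat_self Mem.setNat_nat_of_ne Mem.setNat_real
  Mem.setReal_real_self Mem.setReal_real_of_ne Mem.setReal_nat

/-- The natural variable that is kept in entry `0` of the array `a`. -/
abbrev nv (a : ℕ) : NExp := .get a (.const 0)

/-- The real variable that is kept in entry `0` of the array `a`. -/
abbrev rv (a : ℕ) : RExp := .get a (.const 0)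

/-! ### A priority queue: tournament trees

The inner nodes are `1, …, M - 1`, the leaves `M, …, 2 * M - 1`, and the children of `p` are
`2 * p` and `2 * p + 1`. The natural array `15` holds the name of the winner in the subtree (or `0`
if the subtree is empty), the real array `7` its key. The natural array `14` is a table of
`i ↦ i / 2`. -/

/-- The entry of the inner node `p` is the better one of the entries of its children. -/
def NodeOK (T : ℕ → ℕ) (K : ℕ → ℝ) (p : ℕ) : Prop :=
  if T (p + p) = 0 ∨ (T (p + p + 1) ≠ 0 ∧ K (p + p + 1) < K (p + p)) then
    T p = T (p + p + 1) ∧ K p = K (p + p + 1)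
  else T p = T (p + p) ∧ K p = K (p + p)

def TreeOK (M : ℕ) (T : ℕ → ℕ) (K : ℕ → ℝ) : Prop := ∀ p, 1 ≤ p → p < M → NodeOK T K p

theorem NodeOK.congr {T T' : ℕ → ℕ} {K K' : ℕ → ℝ} {p : ℕ} (h : NodeOK T K p)
    (h0 : T' p = T p ∧ K' p = K p) (h1 : T' (p + p) = T (p + p) ∧ K' (p + p) = K (p + p))
    (h2 : T' (p + p + 1) = T (p + p + 1) ∧ K' (p + p + 1) = K (p + p + 1)) : NodeOK T' K' p := by
  unfold NodeOK at h ⊢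
  rw [h0.1, h0.2, h1.1, h1.2, h2.1, h2.2]
  exact h

theorem NodeOK.le_of_child {T : ℕ → ℕ} {K : ℕ → ℝ} {p j : ℕ} (h : NodeOK T K p) (hp : j / 2 = p)
    (hj : T j ≠ 0) : T p ≠ 0 ∧ K p ≤ K j := by
  have hj2 : j = p + p ∨ j = p + p + 1 := by omega
  unfold NodeOK at h
  split_ifs at h with hc
  · rcases hj2 with rfl | rfl
    · rcases hc with hc | hc
      · exact absurd hc hj
      · rw [h.1, h.2]; exact ⟨hc.1, hc.2.le⟩
    · rw [h.1, h.2]; exact ⟨hj, le_rfl⟩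
  · rw [not_or, not_and, not_lt] at hc
    rw [h.1, h.2]
    rcases hj2 with rfl | rfl
    · exact ⟨hj, le_rfl⟩
    · exact ⟨hc.1, hc.2 hj⟩

/-- On the way from a nonempty node to the root, entries stay nonempty and keys never increase. -/
theorem TreeOK.root_le {M : ℕ} {T : ℕ → ℕ} {K : ℕ → ℝ} (h : TreeOK M T K) {j : ℕ} (hj1 : 1 ≤ j)
    (hj2 : j < M + M) (hj : T j ≠ 0) : T 1 ≠ 0 ∧ K 1 ≤ K j := by
  induction j using Nat.strong_induction_on with
  | _ j ih =>
    rcases hj1.eq_or_lt with rfl | hlt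
    · exact ⟨hj, le_rfl⟩
    · have h1 := (h (j / 2) (by omega) (by omega)).le_of_child rfl hj
      have h2 := ih (j / 2) (by omega) (by omega) (by omega) h1.1
      exact ⟨h2.1, h2.2.trans h1.2⟩

/-- Each inner entry is copied from a child, so following the winners downwards ends in a leaf. `M`
need not be a power of two: the children of the inner nodes stay below `M + M` anyway. -/
theorem TreeOK.exists_leaf {M : ℕ} {T : ℕ → ℕ} {K : ℕ → ℝ} (h : TreeOK M T K) {p : ℕ}
    (hp1 : 1 ≤ p) (hp2 : p < M + M) : ∃ x < M, T p = T (M + x) ∧ K p = K (M + x) := by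
  induction hn : M + M - p using Nat.strong_induction_on generalizing p with
  | _ n ih =>
    subst hn
    rcases Nat.lt_or_ge p M with hlt | hge
    · have hok := h p hp1 hlt
      unfold NodeOK at hok
      split_ifs at hok with hc
      · obtain ⟨x, hx, h1, h2⟩ := ih (M + M - (p + p + 1)) (by omega) (by omega) (by omega) rfl
        exact ⟨x, hx, hok.1.trans h1, hok.2.trans h2⟩
      · obtain ⟨x, hx, h1, h2⟩ := ih (M + M - (p + p)) (by omega) (by omega) (by omega) rfl
        exact ⟨x, hx, hok.1.trans h1, hok.2.trans h2⟩
    · exact ⟨p - M, by omega, by rw [Nat.add_sub_cancel' hge]; exact ⟨rfl, rfl⟩⟩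

/-- The number of nodes on the way from `p` to the root. -/
def height (p : ℕ) : ℕ := if p = 0 then 0 else Nat.log 2 p + 1

theorem height_half {p : ℕ} (hp : p ≠ 0) : height p = height (p / 2) + 1 := by
  unfold height
  rw [if_neg hp]
  split_ifs with h
  · rw [Nat.log_of_lt (by omega)]
  · rw [Nat.log_of_one_lt_of_le (by norm_num) (by omega)]

theorem height_mono {p q : ℕ} (h : p ≤ q) : height p ≤ height q := by
  unfold height
  split_ifs with h1 h2
  · exact le_rfl
  · omega
  · omega
  · exact Nat.succ_le_succ (Nat.log_mono_right h)

/-- Recompute the entries from the node in the variable `20` up to the root. -/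
def climb : Program :=
  .loop (.not (.natEq (nv 20) (.const 0)))
    (.seq
      (.cond (.or (.natEq (.get 15 (.add (nv 20) (nv 20))) (.const 0))
          (.and (.not (.natEq (.get 15 (.add (.add (nv 20) (nv 20)) (.const 1))) (.const 0)))
            (.realLt (.get 7 (.add (.add (nv 20) (nv 20)) (.const 1)))
              (.get 7 (.add (nv 20) (nv 20))))))
        (.seq (.setNat 15 (nv 20) (.get 15 (.add (.add (nv 20) (nv 20)) (.const 1))))
          (.setReal 7 (nv 20) (.get 7 (.add (.add (nv 20) (nv 20)) (.const 1)))))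
        (.seq (.setNat 15 (nv 20) (.get 15 (.add (nv 20) (nv 20))))
          (.setReal 7 (nv 20) (.get 7 (.add (nv 20) (nv 20))))))
      (.setNat 20 (.const 0) (.get 14 (nv 20))))

/-- At any time only the current node can be wrong. Recomputing it can spoil only its parent, and
the loop ends when the parent is the nonexistent node 0. Halving is a table lookup, because the
machine cannot divide indices. -/
theorem wp_climb {σ : Mem} {M : ℕ} (hhalf : ∀ i < M + M, σ.nat 14 i = i / 2)
    (hp : σ.nat 20 0 < M)
    (hok : ∀ p, 1 ≤ p → p < M → p ≠ σ.nat 20 0 → NodeOK (σ.nat 15) (σ.real 7) p) :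
    wp climb σ fun k τ => k ≤ 80 * height (M + M) + 10 ∧ TreeOK M (τ.nat 15) (τ.real 7) ∧
      ∀ x, τ.nat 15 (M + x) = σ.nat 15 (M + x) ∧ τ.real 7 (M + x) = σ.real 7 (M + x) := by
  refine wp_mono (wp_loop (σ₀ := σ)
    (fun r τ => τ.nat 20 0 < M ∧
      (∀ p, 1 ≤ p → p < M → p ≠ τ.nat 20 0 → NodeOK (τ.nat 15) (τ.real 7) p) ∧
      (∀ x, τ.nat 15 (M + x) = σ.nat 15 (M + x) ∧ τ.real 7 (M + x) = σ.real 7 (M + x)) ∧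
      r = 80 * height (τ.nat 20 0) + 10)
    (Q := fun τ => TreeOK M (τ.nat 15) (τ.real 7) ∧
      ∀ x, τ.nat 15 (M + x) = σ.nat 15 (M + x) ∧ τ.real 7 (M + x) = σ.real 7 (M + x))
    ?_ ?_ ⟨hp, hok, fun x => ⟨rfl, rfl⟩, rfl⟩) fun k τ hk => ⟨hk.1.trans ?_, hk.2⟩
  · rintro r τ hF ⟨h1, h2, h3, rfl⟩ hb
    have h14 : τ.nat 14 = σ.nat 14 := hF.nat 14 (by decide)
    set p := τ.nat 20 0 with hpdef
    have hp0 : p ≠ 0 := by simpa using hb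
    have hhp : σ.nat 14 p = p / 2 := hhalf p (by omega)
    have hh := height_half hp0
    have key : ∀ T : ℕ → ℕ, ∀ K : ℕ → ℝ, (∀ j, j ≠ p → T j = τ.nat 15 j ∧ K j = τ.real 7 j) →
        NodeOK T K p →
        p / 2 < M ∧ (∀ q, 1 ≤ q → q < M → q ≠ p / 2 → NodeOK T K q) ∧
          ∀ x, T (M + x) = σ.nat 15 (M + x) ∧ K (M + x) = σ.real 7 (M + x) := by
      intro T K hTK hOK
      refine ⟨by omega, fun q hq1 hq2 hq3 => ?_, fun x => ?_⟩
      · rcases eq_or_ne q p with rfl | hqp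
        · exact hOK
        -- A node other than `p` and its parent neither is `p` nor has it as a child, so its
        -- condition does not see the change.
        · exact (h2 q hq1 hq2 hqp).congr (hTK _ hqp) (hTK _ (by omega)) (hTK _ (by omega))
      · obtain ⟨h4, h5⟩ := hTK (M + x) (by omega)
        rw [h4, h5]
        exact h3 x
    have hpp : p + p ≠ p := by omega
    have hpp' : p + p + 1 ≠ p := by omega
    simp [h14, ← hpdef, hhp]
    split_ifs with hc
    · intro _
      refine ⟨key _ _ (fun j hj => by simp [hj]) ?_, by omega⟩
      simp only [NodeOK, Function.update_of_ne hpp, Function.update_of_ne hpp', Function.update_self,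
        ne_eq]
      rw [if_pos hc]
      exact ⟨trivial, trivial⟩
    · intro _
      refine ⟨key _ _ (fun j hj => by simp [hj]) ?_, by omega⟩
      simp only [NodeOK, Function.update_of_ne hpp, Function.update_of_ne hpp', Function.update_self,
        ne_eq]
      rw [if_neg hc]
      exact ⟨trivial, trivial⟩
  · rintro r τ hF ⟨h1, h2, h3, rfl⟩ hb
    have hp0 : τ.nat 20 0 = 0 := by simpa using hb
    refine ⟨by simp, fun p hp1 hp2 => h2 p hp1 hp2 (by omega), h3⟩
  · have := height_mono (show σ.nat 20 0 ≤ M + M by omega)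
    omega

/-- Replace the entry of the leaf that is given by the variable `30` by the name in the variable
`31` and the key in the real variable `16`. -/
def putLeaf : Program :=
  .seq (.setReal 7 (.add (nv 21) (nv 30)) (rv 16))
    (.seq (.setNat 15 (.add (nv 21) (nv 30)) (nv 31))
      (.seq (.setNat 20 (.const 0) (.get 14 (.add (nv 21) (nv 30)))) climb))

/-- The new leaf can violate only the condition at its parent, where `climb` starts. The name 0
removes the leaf; whatever key is stored with it then decides no comparison. -/
theorem wp_putLeaf {σ : Mem} {M x : ℕ} (hM : σ.nat 21 0 = M)
    (hhalf : ∀ i < M + M, σ.nat 14 i = i / 2) (hx : σ.nat 30 0 = x) (hxM : x < M)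
    (hok : TreeOK M (σ.nat 15) (σ.real 7)) :
    wp putLeaf σ fun k τ => k ≤ 80 * height (M + M) + 40 ∧ TreeOK M (τ.nat 15) (τ.real 7) ∧
      ∀ y, τ.nat 15 (M + y) = (if y = x then σ.nat 31 0 else σ.nat 15 (M + y)) ∧
        τ.real 7 (M + y) = if y = x then σ.real 16 0 else σ.real 7 (M + y) := by
  simp [putLeaf, hM, hx]
  have hh : σ.nat 14 (M + x) = (M + x) / 2 := hhalf _ (by omega)
  refine wp_mono (wp_climb (M := M) ?_ ?_ ?_) ?_
  · simpa using hhalf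
  · simp [hh]; omega
  · simp only [Mem.setNat_nat_self, hh, Function.update_self]
    intro p hp1 hp2 hp3
    refine (hok p hp1 hp2).congr ?_ ?_ ?_ <;>
    · rw [Mem.setNat_nat_of_ne _ _ _ (by decide), Mem.setNat_nat_self, Mem.setNat_real,
        Mem.setNat_real, Mem.setReal_real_self, Function.update_of_ne (by omega),
        Function.update_of_ne (by omega)]
      exact ⟨rfl, rfl⟩
  · rintro k τ ⟨h1, h2, h3⟩
    refine ⟨by omega, h2, fun y => ?_⟩
    obtain ⟨h4, h5⟩ := h3 y
    rw [h4, h5]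
    by_cases hy : y = x
    · subst hy; simp
    · simp [hy]

/-! ### Adjacency lists -/

/-- The greatest `e ≤ k`, `e ≠ 0`, with `src e = x`, or `0` if there is none. -/
def lastEdge (src : ℕ → ℕ) : ℕ → ℕ → ℕ
  | 0, _ => 0
  | k + 1, x => if src (k + 1) = x then k + 1 else lastEdge src k x

/-- The number of the `e` with `1 ≤ e ≤ k` and `src e = x`. -/
def numEdges (src : ℕ → ℕ) (x : ℕ) : ℕ → ℕ
  | 0 => 0
  | k + 1 => numEdges src x k + if src (k + 1) = x then 1 else 0

theorem lastEdge_le (src : ℕ → ℕ) (k x : ℕ) : lastEdge src k x ≤ k := by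
  induction k with
  | zero => simp [lastEdge]
  | succ k ih => rw [lastEdge]; split_ifs <;> omega

theorem src_lastEdge {src : ℕ → ℕ} {k x : ℕ} (h : lastEdge src k x ≠ 0) :
    src (lastEdge src k x) = x := by
  induction k with
  | zero => simp [lastEdge] at h
  | succ k ih =>
    rw [lastEdge] at h ⊢
    split_ifs at h ⊢ with hc
    · exact hc
    · exact ih h

theorem le_lastEdge {src : ℕ → ℕ} {k x e : ℕ} (he1 : 1 ≤ e) (hek : e ≤ k) (he : src e = x) :
    e ≤ lastEdge src k x := by
  induction k with
  | zero => omega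
  | succ k ih =>
    rw [lastEdge]
    split_ifs with hc
    · exact hek
    · refine ih (Nat.le_of_lt_succ (lt_of_le_of_ne hek ?_))
      rintro rfl
      exact hc he

theorem numEdges_lastEdge (src : ℕ → ℕ) (k x : ℕ) :
    numEdges src x (lastEdge src k x) = numEdges src x k := by
  induction k with
  | zero => rfl
  | succ k ih =>
    rw [lastEdge, numEdges]
    split_ifs with hc
    · rw [numEdges, if_pos hc]
    · rw [ih, add_zero]

/-- The list that starts at the edge `g` has `numEdges src x g` entries, and passing to the next
entry lowers this number by one. It is the time budget for the traversal of the list. -/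
theorem numEdges_of_src_eq {src : ℕ → ℕ} {x g : ℕ} (h : g ≠ 0) (hg : src g = x) :
    numEdges src x g = numEdges src x (lastEdge src (g - 1) x) + 1 := by
  obtain ⟨g, rfl⟩ := Nat.exists_eq_succ_of_ne_zero h
  rw [numEdges_lastEdge, Nat.succ_eq_add_one, numEdges, if_pos hg, Nat.add_sub_cancel]

/-! ### Shortest paths -/

/-- A digraph with the edges `1, …, m` and nodes below `M`, and a set `R` that contains the root
and all nodes that are reachable from it. -/
structure SearchGraph where
  M : ℕ
  m : ℕ
  root : ℕ
  src : ℕ → ℕ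
  tgt : ℕ → ℕ
  wt : ℕ → ℝ
  R : Finset ℕ
  root_mem : root ∈ R
  R_lt : ∀ x ∈ R, x < M
  tgt_mem : ∀ g, 1 ≤ g → g ≤ m → src g ∈ R → tgt g ∈ R
  wt_pos : ∀ g, 1 ≤ g → g ≤ m → src g ∈ R → 0 < wt g

/-- The invariant of Dijkstra's algorithm: a node `x` is open if `st x = cs`, and settled if
`st x = cs + 1`. The edges `g` out of settled nodes are relaxed if `P g`. -/
structure SearchInv (G : SearchGraph) (cs : ℕ) (st : ℕ → ℕ) (d : ℕ → ℝ) (ed : ℕ → ℕ)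
    (P : ℕ → Prop) : Prop where
  st_le : ∀ x < G.M, st x ≤ cs + 1
  seen_mem : ∀ x < G.M, cs ≤ st x → x ∈ G.R
  root_seen : cs ≤ st G.root
  d_root : d G.root = 0
  d_nonneg : ∀ x < G.M, cs ≤ st x → 0 ≤ d x
  par : ∀ x < G.M, cs ≤ st x → x ≠ G.root → 1 ≤ ed x ∧ ed x ≤ G.m ∧ G.tgt (ed x) = x ∧
    G.src (ed x) < G.M ∧ st (G.src (ed x)) = cs + 1 ∧ d x = d (G.src (ed x)) + G.wt (ed x)
  mono : ∀ y < G.M, ∀ x < G.M, st y = cs + 1 → st x = cs → d y ≤ d x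
  relaxed : ∀ g, 1 ≤ g → g ≤ G.m → G.src g < G.M → st (G.src g) = cs + 1 → P g →
    cs ≤ st (G.tgt g) ∧ d (G.tgt g) ≤ d (G.src g) + G.wt g

/-! ### How settling and relaxing preserve Dijkstra's invariant. -/

section SearchInv

variable {G : SearchGraph} {cs : ℕ} {st : ℕ → ℕ} {d : ℕ → ℝ} {ed : ℕ → ℕ} {P : ℕ → Prop}

/-- Because `x` has the least distance among the open nodes, settled distances stay below open ones.
The edges out of `x` now owe a relaxation, so they are exempted in the new predicate. -/
theorem SearchInv.settle (h : SearchInv G cs st d ed P) (hP : ∀ g, P g) {x : ℕ}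
    (hxM : x < G.M) (hx : st x = cs) (hmin : ∀ y < G.M, st y = cs → d x ≤ d y) :
    SearchInv G cs (Function.update st x (cs + 1)) d ed fun g => G.src g ≠ x := by
  have hst : ∀ y, cs ≤ Function.update st x (cs + 1) y → cs ≤ st y := fun y hy => by
    rcases eq_or_ne y x with rfl | hne
    · exact hx.ge
    · rwa [Function.update_of_ne hne] at hy
  have hst' : ∀ y, cs ≤ st y → cs ≤ Function.update st x (cs + 1) y := fun y hy => by
    rcases eq_or_ne y x with rfl | hne
    · simp
    · rwa [Function.update_of_ne hne]
  have hset : ∀ y, st y = cs + 1 → Function.update st x (cs + 1) y = cs + 1 := fun y hy => by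
    rcases eq_or_ne y x with rfl | hne
    · simp
    · rwa [Function.update_of_ne hne]
  refine ⟨fun y hy => ?_, fun y hy h1 => h.seen_mem y hy (hst y h1), hst' _ h.root_seen, h.d_root,
    fun y hy h1 => h.d_nonneg y hy (hst y h1), fun y hy h1 h2 => ?_, fun y hy z hz h1 h2 => ?_,
    fun g hg1 hg2 hg3 h1 h2 => ?_⟩
  · rcases eq_or_ne y x with rfl | hne
    · simp
    · rw [Function.update_of_ne hne]; exact h.st_le y hy
  · obtain ⟨a1, a2, a3, a4, a5, a6⟩ := h.par y hy (hst y h1) h2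
    exact ⟨a1, a2, a3, a4, hset _ a5, a6⟩
  · have hzx : z ≠ x := by rintro rfl; simp at h2
    rw [Function.update_of_ne hzx] at h2
    rcases eq_or_ne y x with rfl | hne
    · exact hmin z hz h2
    · rw [Function.update_of_ne hne] at h1
      exact h.mono y hy z hz h1 h2
  · rw [Function.update_of_ne h2] at h1
    obtain ⟨a1, a2⟩ := h.relaxed g hg1 hg2 hg3 h1 (hP g)
    exact ⟨hst' _ a1, a2⟩

theorem SearchInv.weaken {Q : ℕ → Prop} (h : SearchInv G cs st d ed P)
    (hQ : ∀ g, 1 ≤ g → g ≤ G.m → G.src g < G.M → st (G.src g) = cs + 1 → Q g → P g ∨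
      cs ≤ st (G.tgt g) ∧ d (G.tgt g) ≤ d (G.src g) + G.wt g) : SearchInv G cs st d ed Q :=
  { h with
    relaxed := fun g h1 h2 h3 h4 h5 => (hQ g h1 h2 h3 h4 h5).elim (h.relaxed g h1 h2 h3 h4) id }

/-- The critical case is a settled target: its distance is at most that of the source, which is the
farthest settled node, and the edge has positive length. -/
theorem SearchInv.relax_skip (h : SearchInv G cs st d ed P) {g : ℕ} (hg1 : 1 ≤ g) (hg2 : g ≤ G.m)
    (hx : st (G.src g) = cs + 1) (hxM : G.src g < G.M)
    (hmax : ∀ y < G.M, st y = cs + 1 → d y ≤ d (G.src g))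
    (hc : ¬ (st (G.tgt g) < cs ∨ (st (G.tgt g) = cs ∧ d (G.src g) + G.wt g < d (G.tgt g)))) :
    cs ≤ st (G.tgt g) ∧ d (G.tgt g) ≤ d (G.src g) + G.wt g := by
  have hR := h.seen_mem _ hxM (by omega)
  have hz := G.R_lt _ (G.tgt_mem g hg1 hg2 hR)
  rw [not_or, not_lt, not_and, not_lt] at hc
  refine ⟨hc.1, ?_⟩
  rcases hc.1.eq_or_lt with h1 | h1
  · exact hc.2 h1.symm
  · have h2 := h.st_le _ hz
    exact (hmax _ hz (by omega)).trans (by linarith [G.wt_pos g hg1 hg2 hR])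

/-- The target is not settled, so distances and stamps of settled nodes stay as they are, and all
parents remain settled. The new distance is at least that of the source, which is the farthest
settled node, so the order between settled and open nodes is kept. -/
theorem SearchInv.relax_take (h : SearchInv G cs st d ed P) {g : ℕ} (hg1 : 1 ≤ g) (hg2 : g ≤ G.m)
    (hx : st (G.src g) = cs + 1) (hxM : G.src g < G.M)
    (hmax : ∀ y < G.M, st y = cs + 1 → d y ≤ d (G.src g))
    (hc : st (G.tgt g) < cs ∨ (st (G.tgt g) = cs ∧ d (G.src g) + G.wt g < d (G.tgt g))) :
    SearchInv G cs (Function.update st (G.tgt g) cs)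
      (Function.update d (G.tgt g) (d (G.src g) + G.wt g)) (Function.update ed (G.tgt g) g)
      fun e => P e ∨ e = g := by
  have hR := h.seen_mem _ hxM (by omega)
  have hw := G.wt_pos g hg1 hg2 hR
  have hzR := G.tgt_mem g hg1 hg2 hR
  have hz := G.R_lt _ hzR
  have hd0 := h.d_nonneg _ hxM (by omega)
  -- The root has been seen with distance 0, which a nonnegative distance plus a positive length
  -- cannot improve.
  have hroot : G.tgt g ≠ G.root := by
    intro heq
    rcases hc with hc | hc
    · have := h.root_seen; rw [heq] at hc; omega
    · rw [heq, h.d_root] at hc; linarith [hc.2]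
  have hsx : G.src g ≠ G.tgt g := by
    intro heq
    rw [← heq] at hc; omega
  set z := G.tgt g with hzdef
  set nd := d (G.src g) + G.wt g with hnd
  have hset : ∀ y, Function.update st z cs y = cs + 1 ↔ st y = cs + 1 := fun y => by
    rcases eq_or_ne y z with rfl | hne
    · simp; omega
    · rw [Function.update_of_ne hne]
  have hset' : ∀ y, st y = cs + 1 → y ≠ z := fun y hy hyz => by
    subst hyz; omega
  refine ⟨fun y hy => ?_, fun y hy h1 => ?_, ?_, ?_, fun y hy h1 => ?_, fun y hy h1 h2 => ?_,
    fun y hy x hx' h1 h2 => ?_, fun e he1 he2 he3 h1 h2 => ?_⟩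
  · rcases eq_or_ne y z with rfl | hne
    · simp
    · rw [Function.update_of_ne hne]; exact h.st_le y hy
  · rcases eq_or_ne y z with rfl | hne
    · exact hzR
    · rw [Function.update_of_ne hne] at h1; exact h.seen_mem y hy h1
  · rw [Function.update_of_ne hroot.symm]; exact h.root_seen
  · rw [Function.update_of_ne hroot.symm]; exact h.d_root
  · rcases eq_or_ne y z with rfl | hne
    · rw [Function.update_self]; linarith
    · rw [Function.update_of_ne hne] at h1 ⊢; exact h.d_nonneg y hy h1
  · rcases eq_or_ne y z with rfl | hne
    · simp only [Function.update_self, hset]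
      refine ⟨hg1, hg2, rfl, hxM, hx, ?_⟩
      rw [Function.update_of_ne hsx]
    · rw [Function.update_of_ne hne] at h1
      obtain ⟨a1, a2, a3, a4, a5, a6⟩ := h.par y hy h1 h2
      simp only [Function.update_of_ne hne, Function.update_of_ne (hset' _ a5)]
      exact ⟨a1, a2, a3, a4, a5, a6⟩
  · rw [hset] at h1
    rw [Function.update_of_ne (hset' y h1)]
    rcases eq_or_ne x z with rfl | hne
    · rw [Function.update_self]
      exact (hmax y hy h1).trans (by linarith)
    · rw [Function.update_of_ne hne] at h2 ⊢
      exact h.mono y hy x hx' h1 h2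
  · rw [hset] at h1
    rw [Function.update_of_ne (hset' _ h1)]
    rcases h2 with h2 | rfl
    · obtain ⟨a1, a2⟩ := h.relaxed e he1 he2 he3 h1 h2
      rcases eq_or_ne (G.tgt e) z with hez | hne
      · rw [hez] at a1 a2 ⊢
        simp only [Function.update_self]
        refine ⟨le_rfl, ?_⟩
        rcases hc with hc | hc
        · omega
        · linarith [hc.2]
      · rw [Function.update_of_ne hne, Function.update_of_ne hne]
        exact ⟨a1, a2⟩
    · rw [← hzdef]
      simp only [Function.update_self]
      exact ⟨le_rfl, le_rfl⟩

end SearchInv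

/-- The leaves of the queue are the open nodes, with their distances as keys. -/
def Queue (M cs : ℕ) (T : ℕ → ℕ) (K : ℕ → ℝ) (st : ℕ → ℕ) (d : ℕ → ℝ) : Prop :=
  ∀ x < M, if st x = cs then T (M + x) = x + 1 ∧ K (M + x) = d x else T (M + x) = 0

/-- The graph is stored in the memory. -/
structure Loaded (G : SearchGraph) (σ : Mem) : Prop where
  numNodes : σ.nat 21 0 = G.M
  half : ∀ i < G.M + G.M, σ.nat 14 i = i / 2
  first : ∀ x < G.M, σ.nat 11 x = lastEdge G.src G.m x
  next : ∀ g, 1 ≤ g → g ≤ G.m → σ.nat 12 g = lastEdge G.src (g - 1) (G.src g)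
  tgt : ∀ g, 1 ≤ g → g ≤ G.m → σ.nat 13 g = G.tgt g
  wt : ∀ g, 1 ≤ g → g ≤ G.m → σ.real 6 g = G.wt g

theorem Loaded.congr {G : SearchGraph} {σ τ : Mem} (h : Loaded G σ)
    (h11 : τ.nat 11 = σ.nat 11) (h12 : τ.nat 12 = σ.nat 12) (h13 : τ.nat 13 = σ.nat 13)
    (h14 : τ.nat 14 = σ.nat 14) (h21 : τ.nat 21 = σ.nat 21) (h6 : τ.real 6 = σ.real 6) :
    Loaded G τ := by
  constructor
  · rw [h21]; exact h.numNodes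
  · rw [h14]; exact h.half
  · rw [h11]; exact h.first
  · rw [h12]; exact h.next
  · rw [h13]; exact h.tgt
  · rw [h6]; exact h.wt

/-- Relax the edge in the variable `25` out of the node in the variable `24`. -/
def relax : Program :=
  .seq (.setNat 26 (.const 0) (.get 13 (nv 25)))
    (.seq (.setReal 14 (.const 0) (.add (.get 8 (nv 24)) (.get 6 (nv 25))))
      (.seq
        (.cond (.or (.natLt (.get 16 (nv 26)) (nv 22))
            (.and (.natEq (.get 16 (nv 26)) (nv 22)) (.realLt (rv 14) (.get 8 (nv 26)))))
          (.seq (.setNat 16 (nv 26) (nv 22))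
            (.seq (.setReal 8 (nv 26) (rv 14))
              (.seq (.setNat 17 (nv 26) (nv 25))
                (.seq (.setNat 30 (.const 0) (nv 26))
                  (.seq (.setNat 31 (.const 0) (.add (nv 26) (.const 1)))
                    (.seq (.setReal 16 (.const 0) (rv 14)) putLeaf))))))
          .skip)
        (.setNat 25 (.const 0) (.get 12 (nv 25)))))

/-- The state of the search in the memory. -/
structure Searching (G : SearchGraph) (cs : ℕ) (P : ℕ → Prop) (σ : Mem) : Prop where
  inv : SearchInv G cs (σ.nat 16) (σ.real 8) (σ.nat 17) P
  tree : TreeOK G.M (σ.nat 15) (σ.real 7)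
  queue : Queue G.M cs (σ.nat 15) (σ.real 7) (σ.nat 16) (σ.real 8)

/-- The last two clauses keep the set of settled nodes and their distances fixed, so that `hmax`
remains available for the next edge of the scan. -/
theorem wp_relax {G : SearchGraph} {cs : ℕ} {P : ℕ → Prop} {σ : Mem} {g x : ℕ} (hG : Loaded G σ)
    (hs : Searching G cs P σ) (hcs : σ.nat 22 0 = cs) (hg : σ.nat 25 0 = g) (hg1 : 1 ≤ g)
    (hg2 : g ≤ G.m) (hx : σ.nat 24 0 = x) (hgx : G.src g = x) (hxM : x < G.M)
    (hxs : σ.nat 16 x = cs + 1)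
    (hmax : ∀ y < G.M, σ.nat 16 y = cs + 1 → σ.real 8 y ≤ σ.real 8 x) :
    wp relax σ fun k τ => k ≤ 80 * height (G.M + G.M) + 120 ∧
      Searching G cs (fun e => P e ∨ e = g) τ ∧ τ.nat 25 0 = lastEdge G.src (g - 1) x ∧
      (∀ y, τ.nat 16 y = cs + 1 ↔ σ.nat 16 y = cs + 1) ∧
      ∀ y, σ.nat 16 y = cs + 1 → τ.real 8 y = σ.real 8 y := by
  subst hgx
  have hR := hs.inv.seen_mem _ hxM (by omega)
  have hz := G.R_lt _ (G.tgt_mem g hg1 hg2 hR)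
  have h13 := hG.tgt g hg1 hg2
  have h12 := hG.next g hg1 hg2
  have h6 := hG.wt g hg1 hg2
  simp [relax, hg, hx, hcs, h13, h6]
  split_ifs with hc
  · have hI := hs.inv.relax_take hg1 hg2 hxs hxM hmax hc
    have hset : ∀ y, Function.update (σ.nat 16) (G.tgt g) cs y = cs + 1 ↔ σ.nat 16 y = cs + 1 :=
      fun y => by
        rcases eq_or_ne y (G.tgt g) with rfl | hne
        · simp; omega
        · rw [Function.update_of_ne hne]
    have hset' : ∀ y, σ.nat 16 y = cs + 1 → y ≠ G.tgt g := fun y hy hyz => by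
      subst hyz; omega
    refine wp_mono (wp_frame (wp_putLeaf (M := G.M) (x := G.tgt g) ?_ ?_ ?_ hz ?_)) ?_
    · simp [hG.numNodes]
    · simpa using hG.half
    · simp
    · simpa using hs.tree
    · rintro k τ ⟨hF, hk, hT, hL⟩
      have f16 := hF.nat 16 (by decide)
      have f17 := hF.nat 17 (by decide)
      have f25 := hF.nat 25 (by decide)
      have f12 := hF.nat 12 (by decide)
      have f8 := hF.real 8 (by decide)
      simp at f16 f17 f25 f12 f8 hL
      refine ⟨by omega, ⟨?_, ?_, ?_⟩, ?_, ?_, ?_⟩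
      · simpa [f16, f17, f8] using hI
      · simpa using hT
      · intro y hy
        obtain ⟨h1, h2⟩ := hL y
        have hq := hs.queue y hy
        simp [f16, f8, h1, h2]
        by_cases hyz : y = G.tgt g
        · subst hyz; simp
        · simpa [hyz] using hq
      · simp [f25, f12, hg, h12]
      · intro y; simp [f16, hset]
      · intro y hy; simp [f8, hset' y hy]
  · have hI := hs.inv.relax_skip hg1 hg2 hxs hxM hmax hc
    refine ⟨⟨?_, ?_, ?_⟩, ?_⟩
    · refine SearchInv.weaken (P := P) (by simpa using hs.inv) ?_
      rintro e - - - - (he | rfl)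
      · exact Or.inl he
      · right; simpa using hI
    · simpa using hs.tree
    · simpa using hs.queue
    · exact h12

theorem Searching.weaken {G : SearchGraph} {cs : ℕ} {P Q : ℕ → Prop} {σ : Mem}
    (h : Searching G cs P σ)
    (hQ : ∀ g, 1 ≤ g → g ≤ G.m → Q g → P g) : Searching G cs Q σ :=
  ⟨h.inv.weaken fun g h1 h2 _ _ h5 => Or.inl (hQ g h1 h2 h5), h.tree, h.queue⟩

/-- Relax all edges of a list that begins with the edge in the variable `25`. -/
def scan : Program := .loop (.not (.natEq (nv 25) (.const 0))) relax

theorem wp_scan {G : SearchGraph} {cs : ℕ} {σ : Mem} {x : ℕ} (hG : Loaded G σ)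
    (hs : Searching G cs (fun g => G.src g ≠ x) σ) (hcs : σ.nat 22 0 = cs)
    (hg : σ.nat 25 0 = lastEdge G.src G.m x)
    (hx : σ.nat 24 0 = x) (hxM : x < G.M) (hxs : σ.nat 16 x = cs + 1)
    (hmax : ∀ y < G.M, σ.nat 16 y = cs + 1 → σ.real 8 y ≤ σ.real 8 x) :
    wp scan σ fun k τ => k ≤ (80 * height (G.M + G.M) + 130) * numEdges G.src x G.m + 10 ∧
      Searching G cs (fun _ => True) τ ∧ ∀ y, τ.nat 16 y = cs + 1 ↔ σ.nat 16 y = cs + 1 := by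
  -- The list is descending, so the edges of `x` that are already relaxed are those with a number
  -- above the current `g`.
  refine wp_mono (wp_loop (σ₀ := σ) (fun r τ => ∃ g, τ.nat 25 0 = g ∧ g ≤ G.m ∧
      (g ≠ 0 → G.src g = x) ∧ Searching G cs (fun e => G.src e ≠ x ∨ g < e) τ ∧
      (∀ y, τ.nat 16 y = cs + 1 ↔ σ.nat 16 y = cs + 1) ∧
      (∀ y, σ.nat 16 y = cs + 1 → τ.real 8 y = σ.real 8 y) ∧
      r = (80 * height (G.M + G.M) + 130) * numEdges G.src x g + 10)
    (Q := fun τ => Searching G cs (fun _ => True) τ ∧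
      ∀ y, τ.nat 16 y = cs + 1 ↔ σ.nat 16 y = cs + 1)
    ?_ ?_ ⟨_, hg, lastEdge_le _ _ _, src_lastEdge, ?_, fun y => Iff.rfl, fun y _ => rfl, rfl⟩)
    fun k τ hk => ⟨hk.1.trans ?_, hk.2⟩
  · rintro r τ hF ⟨g, h1, h2, h3, h4, h5, h6, rfl⟩ hb
    have hg0 : g ≠ 0 := by simpa [h1] using hb
    have hG' : Loaded G τ := hG.congr (hF.nat 11 (by decide)) (hF.nat 12 (by decide))
      (hF.nat 13 (by decide)) (hF.nat 14 (by decide)) (hF.nat 21 (by decide))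
      (hF.real 6 (by decide))
    refine wp_mono (wp_relax (x := x) hG' h4 ?_ h1 (by omega) h2 ?_ (h3 hg0) hxM ((h5 x).2 hxs) ?_) ?_
    · rw [hF.nat 22 (by decide), hcs]
    · rw [hF.nat 24 (by decide), hx]
    · intro y hy h7
      have := (h5 y).1 h7
      rw [h6 y this, h6 x hxs]
      exact hmax y hy this
    · rintro k ρ ⟨a1, a2, a3, a4, a5⟩ -
      refine ⟨_, ⟨_, a3, (lastEdge_le _ _ _).trans (by omega), src_lastEdge, ?_,
        fun y => (a4 y).trans (h5 y), fun y hy => (a5 y ((h5 y).2 hy)).trans (h6 y hy), rfl⟩, ?_⟩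
      · refine a2.weaken fun e he1 he2 h7 => ?_
        rcases h7 with h7 | h7
        · exact Or.inl (Or.inl h7)
        · by_cases hex : G.src e = x
          · rcases lt_trichotomy e g with h8 | h8 | h8
            -- No edge out of `x` lies strictly between the next entry of the list and `g`, since
            -- that entry is the greatest one below `g`.
            · have := le_lastEdge he1 (show e ≤ g - 1 by omega) hex
              omega
            · exact Or.inr h8
            · exact Or.inl (Or.inr h8)
          · exact Or.inl (Or.inl hex)
      · rw [numEdges_of_src_eq hg0 (h3 hg0), mul_add]
        simp
        omega
  · rintro r τ hF ⟨g, h1, h2, h3, h4, h5, h6, rfl⟩ hb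
    have hg0 : g = 0 := by simpa [h1] using hb
    subst hg0
    refine ⟨by simp, h4.weaken fun e he1 _ _ => Or.inr (by omega), h5⟩
  · exact hs.weaken fun e he1 he2 h => by
      rcases h with h | h
      · exact h
      · intro hex
        have := le_lastEdge he1 he2 hex
        omega
  · rw [numEdges_lastEdge]

/-- Settle the best open node and relax its edges, as long as there is one. -/
def settleAll : Program :=
  .loop (.not (.natEq (.get 15 (.const 1)) (.const 0)))
    (.seq (.setNat 24 (.const 0) (.sub (.get 15 (.const 1)) (.const 1)))
      (.seq (.setNat 16 (nv 24) (.add (nv 22) (.const 1)))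
        (.seq (.setNat 30 (.const 0) (nv 24))
          (.seq (.setNat 31 (.const 0) (.const 0))
            (.seq putLeaf
              (.seq (.setNat 25 (.const 0) (.get 11 (nv 24))) scan))))))

/-- A bound for the number of steps of the search. -/
def SearchGraph.cost (G : SearchGraph) (S : Finset ℕ) : ℕ :=
  ∑ x ∈ S, (80 * height (G.M + G.M) + 130) * (numEdges G.src x G.m + 1)

/-- The remaining time is charged to the nodes of `G.R` that are not settled. Each of them is
settled at most once and then pays for its removal from the queue and for its outgoing edges. -/
theorem wp_settleAll {G : SearchGraph} {cs : ℕ} {σ : Mem} (hG : Loaded G σ)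
    (hs : Searching G cs (fun _ => True) σ) (hcs : σ.nat 22 0 = cs) :
    wp settleAll σ fun k τ => k ≤ G.cost G.R + 10 ∧ Searching G cs (fun _ => True) τ ∧
      ∀ x < G.M, τ.nat 16 x ≠ cs := by
  have hM : 0 < G.M := (Nat.zero_le _).trans_lt (G.R_lt _ G.root_mem)
  refine wp_mono (wp_loop (σ₀ := σ) (fun r τ => Searching G cs (fun _ => True) τ ∧
      r = G.cost (G.R.filter fun x => τ.nat 16 x ≠ cs + 1) + 10)
    (Q := fun τ => Searching G cs (fun _ => True) τ ∧ ∀ x < G.M, τ.nat 16 x ≠ cs)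
    ?_ ?_ ⟨hs, rfl⟩) fun k τ hk => ⟨hk.1.trans ?_, hk.2⟩
  · rintro r τ hF ⟨h1, rfl⟩ hb
    have hT : τ.nat 15 1 ≠ 0 := by simpa using hb
    have hG' : Loaded G τ := hG.congr (hF.nat 11 (by decide)) (hF.nat 12 (by decide))
      (hF.nat 13 (by decide)) (hF.nat 14 (by decide)) (hF.nat 21 (by decide))
      (hF.real 6 (by decide))
    have hcs' : τ.nat 22 0 = cs := by rw [hF.nat 22 (by decide), hcs]
    obtain ⟨x, hx, hx1, hx2⟩ := h1.tree.exists_leaf le_rfl (by omega)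
    have hxq := h1.queue x hx
    have hxs : τ.nat 16 x = cs := by
      by_contra hne
      rw [if_neg hne] at hxq
      exact hT (hx1.trans hxq)
    rw [if_pos hxs] at hxq
    have hxT : τ.nat 15 1 - 1 = x := by rw [hx1, hxq.1, Nat.add_sub_cancel]
    have hmin : ∀ y < G.M, τ.nat 16 y = cs → τ.real 8 x ≤ τ.real 8 y := fun y hy hys => by
      have hyq := h1.queue y hy
      rw [if_pos hys] at hyq
      have := (h1.tree.root_le (j := G.M + y) (by omega) (by omega) (by omega)).2
      rwa [hx2, hxq.2, hyq.2] at this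
    have hI := h1.inv.settle (fun _ => trivial) hx hxs hmin
    simp [hxT, hcs']
    refine wp_mono (wp_frame (wp_putLeaf (M := G.M) (x := x) ?_ ?_ ?_ hx ?_)) ?_
    · simp [hG'.numNodes]
    · simpa using hG'.half
    · simp
    · simpa using h1.tree
    rintro k ρ ⟨hF', a1, a2, a3⟩
    have f11 := hF'.nat 11 (by decide)
    have f12 := hF'.nat 12 (by decide)
    have f13 := hF'.nat 13 (by decide)
    have f14 := hF'.nat 14 (by decide)
    have f16 := hF'.nat 16 (by decide)
    have f17 := hF'.nat 17 (by decide)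
    have f21 := hF'.nat 21 (by decide)
    have f22 := hF'.nat 22 (by decide)
    have f24 := hF'.nat 24 (by decide)
    have f6 := hF'.real 6 (by decide)
    have f8 := hF'.real 8 (by decide)
    simp at f11 f12 f13 f14 f16 f17 f21 f22 f24 f6 f8 a3
    have hfirst := hG'.first x hx
    refine wp_mono (wp_scan (G := G) (cs := cs) (x := x) ?_ ⟨?_, ?_, ?_⟩ ?_ ?_ ?_ hx ?_ ?_) ?_
    · exact hG'.congr (by simpa using f11) (by simpa using f12) (by simpa using f13)
        (by simpa using f14) (by simpa using f21) (by simpa using f6)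
    · simpa [f16, f17, f8] using hI
    · simpa using a2
    · intro y hy
      obtain ⟨h2, h3⟩ := a3 y
      have hq := h1.queue y hy
      simp [f16, f8, h2, h3]
      by_cases hyx : y = x
      · subst hyx; simp
      · simpa [hyx] using hq
    · simp [f22, hcs']
    · simp [f24, f11, hfirst]
    · simp [f24]
    · simp [f16]
    -- As `x` was open, all nodes settled earlier are at most as far away; hence `x` is now the
    -- farthest settled node.
    · intro y hy hys
      simp [f16, f8] at hys ⊢
      by_cases hyx : y = x
      · rw [hyx]
      · rw [Function.update_of_ne hyx] at hys
        exact h1.inv.mono y hy x hx hys hxs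
    · rintro l μ ⟨b1, b2, b3⟩ -
      refine ⟨b2, ?_⟩
      have hxR := h1.inv.seen_mem x hx hxs.ge
      have hfil : (G.R.filter fun y => ¬ μ.nat 16 y = cs + 1) =
          (G.R.filter fun y => ¬ τ.nat 16 y = cs + 1).erase x := by
        ext y
        simp only [Finset.mem_filter, Finset.mem_erase, b3]
        simp [f16]
        by_cases hyx : y = x
        · subst hyx; simp
        · simp [hyx]
      have hmem : x ∈ G.R.filter fun y => ¬ τ.nat 16 y = cs + 1 := by
        simp [hxR, hxs]
      have hsum : G.cost (G.R.filter fun y => ¬ τ.nat 16 y = cs + 1) =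
          G.cost (G.R.filter fun y => ¬ μ.nat 16 y = cs + 1) +
            (80 * height (G.M + G.M) + 130) * (numEdges G.src x G.m + 1) := by
        rw [hfil, SearchGraph.cost, SearchGraph.cost, Finset.sum_erase_add _ _ hmem]
      rw [hsum, mul_add]
      omega
  · rintro r τ hF ⟨h1, rfl⟩ hb
    have hT : τ.nat 15 1 = 0 := by simpa using hb
    refine ⟨by simp, h1, fun x hx hxs => ?_⟩
    have hxq := h1.queue x hx
    rw [if_pos hxs] at hxq
    exact (h1.tree.root_le (j := G.M + x) (by omega) (by omega) (by omega)).1 hT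
  · exact Nat.add_le_add_right (Finset.sum_le_sum_of_subset (Finset.filter_subset _ _)) _

/-- Dijkstra's algorithm with the root in the variable `23`. The time stamps of earlier searches
are below the new value of the variable `22`. -/
def dijkstra : Program :=
  .seq (.setNat 22 (.const 0) (.add (nv 22) (.const 2)))
    (.seq (.setReal 8 (nv 23) (.const 0))
      (.seq (.setNat 16 (nv 23) (nv 22))
        (.seq (.setNat 30 (.const 0) (nv 23))
          (.seq (.setNat 31 (.const 0) (.add (nv 23) (.const 1)))
            (.seq (.setReal 16 (.const 0) (.const 0))
              (.seq putLeaf settleAll))))))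

/-- The queue is empty, and all time stamps belong to earlier searches. -/
structure Idle (M : ℕ) (σ : Mem) : Prop where
  tree : TreeOK M (σ.nat 15) (σ.real 7)
  leaf : ∀ x < M, σ.nat 15 (M + x) = 0
  stamp : ∀ x < M, σ.nat 16 x < σ.nat 22 0 + 2

/-- Raising the stamp by 2 puts it above all open and settled marks of earlier searches, so every
node counts as unseen without being cleared. Clearing would cost |V| steps per search, too much for
networks with few edges. -/
theorem wp_dijkstra {G : SearchGraph} {σ : Mem} (hG : Loaded G σ) (hI : Idle G.M σ)
    (hroot : σ.nat 23 0 = G.root) :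
    wp dijkstra σ fun k τ => k ≤ G.cost G.R + 80 * height (G.M + G.M) + 100 ∧ Idle G.M τ ∧
      SearchInv G (τ.nat 22 0) (τ.nat 16) (τ.real 8) (τ.nat 17) (fun _ => True) ∧
      ∀ x < G.M, τ.nat 16 x ≠ τ.nat 22 0 := by
  have hr := G.R_lt _ G.root_mem
  simp [dijkstra, hroot]
  set cs := σ.nat 22 0 + 2 with hcs
  refine wp_mono (wp_frame (wp_putLeaf (M := G.M) (x := G.root) ?_ ?_ ?_ hr ?_)) ?_
  · simp [hG.numNodes]
  · simpa using hG.half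
  · simp
  · simpa using hI.tree
  rintro k ρ ⟨hF', a1, a2, a3⟩
  have f11 := hF'.nat 11 (by decide)
  have f12 := hF'.nat 12 (by decide)
  have f13 := hF'.nat 13 (by decide)
  have f14 := hF'.nat 14 (by decide)
  have f16 := hF'.nat 16 (by decide)
  have f17 := hF'.nat 17 (by decide)
  have f21 := hF'.nat 21 (by decide)
  have f22 := hF'.nat 22 (by decide)
  have f6 := hF'.real 6 (by decide)
  have f8 := hF'.real 8 (by decide)
  simp at f11 f12 f13 f14 f16 f17 f21 f22 f6 f8 a3
  have hst : ∀ x < G.M, cs ≤ ρ.nat 16 x → x = G.root := fun x hx hxs => by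
    by_contra hne
    rw [f16, Function.update_of_ne hne] at hxs
    have := hI.stamp x hx
    omega
  have hsr : ρ.nat 16 G.root = cs := by simp [f16]
  have hset : ∀ x < G.M, ρ.nat 16 x ≠ cs + 1 := fun x hx hxs => by
    have := hst x hx (by omega)
    subst this
    omega
  refine wp_mono (wp_frame (wp_settleAll (G := G) (cs := cs) ?_ ⟨⟨?_, ?_, ?_, ?_, ?_, ?_, ?_, ?_⟩,
    a2, ?_⟩ ?_)) ?_
  · exact hG.congr f11 f12 f13 f14 f21 f6
  · intro x hx
    by_contra hlt
    have := hst x hx (by omega)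
    subst this
    omega
  · intro x hx hxs
    rw [hst x hx hxs]; exact G.root_mem
  · exact hsr.ge
  · simp [f8]
  · intro x hx hxs
    rw [hst x hx hxs]; simp [f8]
  · intro x hx hxs hne
    exact absurd (hst x hx hxs) hne
  · intro y hy x hx hys
    exact absurd hys (hset y hy)
  · intro g _ _ h3 h4
    exact absurd h4 (hset _ h3)
  · intro x hx
    obtain ⟨h2, h3⟩ := a3 x
    by_cases hxr : x = G.root
    · subst hxr
      simp [h2, h3, hsr, f8]
    · have : ρ.nat 16 x ≠ cs := fun h => hxr (hst x hx h.ge)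
      simp [h2, hxr, this, hI.leaf x hx]
  · simp [f22]
  · rintro l τ ⟨hFτ, b1, b2, b3⟩
    have g22 : τ.nat 22 0 = cs := by rw [hFτ.nat 22 (by decide), f22]; simp
    rw [g22]
    refine ⟨by omega, ⟨b2.tree, fun x hx => ?_, fun x hx => ?_⟩, b2.inv, b3⟩
    · have := b2.queue x hx
      rwa [if_neg (b3 x hx)] at this
    · have := b2.inv.st_le x hx
      omega

/-! ### The layered graph

Node `v` stands for the vertex `v` before the processing, node `v + nV` for `v` after the
processing. The edges are reversed, as the searches begin at the destinations. -/

/-- The sources of the edges. Vertices that cannot process have no edge between the layers. -/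
noncomputable def layerSrc (N : Network) (g : ℕ) : ℕ :=
  if h : g - 1 < N.nE then (N.edge ⟨g - 1, h⟩).2
  else if h : g - 1 - N.nE < N.nE then (N.edge ⟨g - 1 - N.nE, h⟩).2 + N.nV
  else if h : g - 1 - N.nE - N.nE < N.nV then
    if 0 < N.C ⟨g - 1 - N.nE - N.nE, h⟩ then g - 1 - N.nE - N.nE + N.nV else N.nV + N.nV
  else N.nV + N.nV

/-- Edge numbers start at 1, because 0 ends an adjacency list: first the lower layer, then the upper
layer, then one edge per vertex from the upper to the lower layer. -/
def layerTgt (N : Network) (g : ℕ) : ℕ :=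
  if h : g - 1 < N.nE then (N.edge ⟨g - 1, h⟩).1
  else if h : g - 1 - N.nE < N.nE then (N.edge ⟨g - 1 - N.nE, h⟩).1 + N.nV
  else g - 1 - N.nE - N.nE

noncomputable def layerWt (N : Network) (w : Fin N.nE → ℝ) (q : Fin N.nV → ℝ) (g : ℕ) : ℝ :=
  if h : g - 1 < N.nE then w ⟨g - 1, h⟩ / N.B ⟨g - 1, h⟩
  else if h : g - 1 - N.nE < N.nE then w ⟨g - 1 - N.nE, h⟩ / N.B ⟨g - 1 - N.nE, h⟩
  else if h : g - 1 - N.nE - N.nE < N.nV then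
    q ⟨g - 1 - N.nE - N.nE, h⟩ / N.C ⟨g - 1 - N.nE - N.nE, h⟩
  else 0

section Layer

variable (N : Network) (w : Fin N.nE → ℝ) (q : Fin N.nV → ℝ)

theorem layer_lower (e : Fin N.nE) : layerSrc N (e + 1) = (N.edge e).2 ∧
    layerTgt N (e + 1) = (N.edge e).1 ∧ layerWt N w q (e + 1) = w e / N.B e := by
  simp [layerSrc, layerTgt, layerWt]

theorem layer_upper (e : Fin N.nE) : layerSrc N (N.nE + e + 1) = (N.edge e).2 + N.nV ∧
    layerTgt N (N.nE + e + 1) = (N.edge e).1 + N.nV ∧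
    layerWt N w q (N.nE + e + 1) = w e / N.B e := by
  simp [layerSrc, layerTgt, layerWt]

theorem layer_copy (v : Fin N.nV) :
    layerSrc N (N.nE + N.nE + v + 1) = (if 0 < N.C v then v + N.nV else N.nV + N.nV) ∧
    layerTgt N (N.nE + N.nE + v + 1) = v ∧
    layerWt N w q (N.nE + N.nE + v + 1) = q v / N.C v := by
  have h1 : ¬ N.nE + N.nE + (v : ℕ) < N.nE := by omega
  have h2 : N.nE + N.nE + (v : ℕ) - N.nE = N.nE + v := by omega
  simp [layerSrc, layerTgt, layerWt, h1, h2]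

variable {N} in
theorem layer_cases {g : ℕ} (h1 : 1 ≤ g) (h2 : g ≤ N.nE + N.nE + N.nV) :
    (∃ e : Fin N.nE, g = e + 1) ∨ (∃ e : Fin N.nE, g = N.nE + e + 1) ∨
      ∃ v : Fin N.nV, g = N.nE + N.nE + v + 1 := by
  by_cases h3 : g - 1 < N.nE
  · exact Or.inl ⟨⟨g - 1, h3⟩, by simp; omega⟩
  by_cases h4 : g - 1 - N.nE < N.nE
  · exact Or.inr (Or.inl ⟨⟨g - 1 - N.nE, h4⟩, by simp; omega⟩)
  · exact Or.inr (Or.inr ⟨⟨g - 1 - N.nE - N.nE, by omega⟩, by simp; omega⟩)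

/-- The nodes that may be reachable from the destination `t`. -/
def layerReach (t : Fin N.nV) : Finset ℕ :=
  {(t : ℕ), t + N.nV} ∪ (Finset.univ.image fun e => ((N.edge e).1 : ℕ)) ∪
    Finset.univ.image fun e => (N.edge e).1 + N.nV

/-- The graph for the searches with the destination `t`. -/
noncomputable def layerGraph (hw : ∀ e, 0 < w e) (hq : ∀ v, 0 < q v) (t : Fin N.nV) :
    SearchGraph where
  M := N.nV + N.nV
  m := N.nE + N.nE + N.nV
  root := t + N.nV
  src := layerSrc N
  tgt := layerTgt N
  wt := layerWt N w q
  R := layerReach N t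
  root_mem := by simp [layerReach]
  R_lt := by
    intro x hx
    simp only [layerReach, Finset.mem_union, Finset.mem_insert, Finset.mem_singleton,
      Finset.mem_image, Finset.mem_univ, true_and] at hx
    rcases hx with ((rfl | rfl) | ⟨e, rfl⟩) | ⟨e, rfl⟩ <;> omega
  tgt_mem := by
    intro g h1 h2 h3
    rcases layer_cases h1 h2 with ⟨e, rfl⟩ | ⟨e, rfl⟩ | ⟨v, rfl⟩
    · rw [(layer_lower N w q e).2.1]
      simp [layerReach]
    · rw [(layer_upper N w q e).2.1]
      simp [layerReach]
    · rw [(layer_copy N w q v).2.1]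
      rw [(layer_copy N w q v).1] at h3
      simp only [layerReach, Finset.mem_union, Finset.mem_insert, Finset.mem_singleton,
        Finset.mem_image, Finset.mem_univ, true_and] at h3 ⊢
      split_ifs at h3
      · rcases h3 with ((h3 | h3) | ⟨e, he⟩) | ⟨e, he⟩
        · omega
        · exact Or.inl (Or.inl (Or.inl (by omega)))
        · have := (N.edge e).1.isLt; omega
        · exact Or.inl (Or.inr ⟨e, by omega⟩)
      -- A vertex without capacity has the dummy source `N.nV + N.nV`, which lies outside of the
      -- reachable set, so this case cannot occur.
      · rcases h3 with ((h3 | h3) | ⟨e, he⟩) | ⟨e, he⟩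
        · omega
        · omega
        · have := (N.edge e).1.isLt; omega
        · have := (N.edge e).1.isLt; omega
  wt_pos := by
    intro g h1 h2 h3
    rcases layer_cases h1 h2 with ⟨e, rfl⟩ | ⟨e, rfl⟩ | ⟨v, rfl⟩
    · rw [(layer_lower N w q e).2.2]; exact div_pos (hw e) (N.B_pos e)
    · rw [(layer_upper N w q e).2.2]; exact div_pos (hw e) (N.B_pos e)
    · rw [(layer_copy N w q v).2.2]
      rw [(layer_copy N w q v).1] at h3
      split_ifs at h3 with hC
      · exact div_pos (hq v) hC
      · simp only [layerReach, Finset.mem_union, Finset.mem_insert, Finset.mem_singleton,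
          Finset.mem_image, Finset.mem_univ, true_and] at h3
        rcases h3 with ((h3 | h3) | ⟨e, he⟩) | ⟨e, he⟩
        · omega
        · omega
        · have := (N.edge e).1.isLt; omega
        · have := (N.edge e).1.isLt; omega

/-- Apart from the destination, a reversed search meets only tails of edges, in two layers. That |V|
does not appear here keeps the search cheap in networks with few edges. -/
theorem layerReach_card (t : Fin N.nV) : (layerReach N t).card ≤ 2 * N.nE + 2 := by
  have h1 : ({(t : ℕ), t + N.nV} : Finset ℕ).card ≤ 2 := Finset.card_le_two
  have h2 : (Finset.univ.image fun e => ((N.edge e).1 : ℕ)).card ≤ N.nE := by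
    simpa using Finset.card_image_le (s := Finset.univ) (f := fun e => ((N.edge e).1 : ℕ))
  have h3 : (Finset.univ.image fun e => (N.edge e).1 + N.nV).card ≤ N.nE := by
    simpa using Finset.card_image_le (s := Finset.univ)
      (f := fun e => ((N.edge e).1 : ℕ) + N.nV)
  have h4 := Finset.card_union_le ({(t : ℕ), t + N.nV} : Finset ℕ)
    (Finset.univ.image fun e => ((N.edge e).1 : ℕ))
  have h5 := Finset.card_union_le
    (({(t : ℕ), t + N.nV} : Finset ℕ) ∪ (Finset.univ.image fun e => ((N.edge e).1 : ℕ)))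
    (Finset.univ.image fun e => (N.edge e).1 + N.nV)
  unfold layerReach
  omega

theorem sum_numEdges_le (src : ℕ → ℕ) (S : Finset ℕ) (k : ℕ) :
    ∑ x ∈ S, numEdges src x k ≤ k := by
  induction k with
  | zero => simp [numEdges]
  | succ k ih =>
    simp only [numEdges, Finset.sum_add_distrib, Finset.sum_ite_eq]
    split_ifs <;> omega

/-- The edges between the layers have distinct sources among the genuine nodes, so each such node
gains at most one. The indicator records whether the source of that edge can already have been
counted. -/
theorem numEdges_layer_le {x : ℕ} (hx : x < N.nV + N.nV) (k : ℕ) (hk : k ≤ N.nV) :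
    numEdges (layerSrc N) x (N.nE + N.nE + k) ≤ numEdges (layerSrc N) x (N.nE + N.nE) +
      if x < k + N.nV then 1 else 0 := by
  induction k with
  | zero => simp
  | succ k ih =>
    have ih := ih (by omega)
    have := (layer_copy N (fun _ => 1) (fun _ => 1) ⟨k, hk⟩).1
    rw [← add_assoc, numEdges, this]
    simp only
    split_ifs at ih ⊢ <;> omega

theorem layerGraph_cost_le (hw : ∀ e, 0 < w e) (hq : ∀ v, 0 < q v) (t : Fin N.nV) :
    (layerGraph N w q hw hq t).cost (layerGraph N w q hw hq t).R ≤
      (80 * height (4 * N.nV) + 130) * (6 * N.nE + 4) := by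
  rw [SearchGraph.cost, ← Finset.mul_sum]
  have hM : (layerGraph N w q hw hq t).M + (layerGraph N w q hw hq t).M = 4 * N.nV := by
    simp only [layerGraph]; omega
  rw [hM]
  refine Nat.mul_le_mul_left _ ?_
  have h1 := layerReach_card N t
  have h2 := sum_numEdges_le (layerSrc N) (layerReach N t) (N.nE + N.nE)
  -- The edges within the layers contribute at most 2|E| in total; each of the at most 2|E| + 2
  -- nodes adds 1 for its edge between the layers and 1 for being settled.
  calc ∑ x ∈ layerReach N t, (numEdges (layerSrc N) x (N.nE + N.nE + N.nV) + 1)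
      ≤ ∑ x ∈ layerReach N t, (numEdges (layerSrc N) x (N.nE + N.nE) + 2) := by
        refine Finset.sum_le_sum fun x hx => ?_
        have := numEdges_layer_le N ((layerGraph N w q hw hq t).R_lt x hx) N.nV le_rfl
        split_ifs at this <;> omega
    _ = ∑ x ∈ layerReach N t, numEdges (layerSrc N) x (N.nE + N.nE) +
        (layerReach N t).card * 2 := by
        rw [Finset.sum_add_distrib, Finset.sum_const, smul_eq_mul]
    _ ≤ _ := by omega

end Layer

/-! ### Walks and searches -/

/-- The cost of the edges of a walk. -/
noncomputable def edgeCost (N : Network) (w : Fin N.nE → ℝ) (π : List (Fin N.nV)) : ℝ :=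
  ∑ e, (mult N e π : ℝ) * (w e / N.B e)

theorem mult_cons_cons {N : Network} (e : Fin N.nE) (a b : Fin N.nV) (l : List (Fin N.nV)) :
    mult N e (a :: b :: l) = mult N e (b :: l) + if N.edge e = (a, b) then 1 else 0 := by
  simp only [mult, List.tail_cons, List.zip_cons_cons, List.count_cons, beq_iff_eq]
  congr 1
  simp only [eq_comm]

theorem mult_singleton {N : Network} (e : Fin N.nE) (a : Fin N.nV) : mult N e [a] = 0 := by
  simp [mult]

theorem edgeCost_singleton {N : Network} (w : Fin N.nE → ℝ) (a : Fin N.nV) :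
    edgeCost N w [a] = 0 := by
  simp [edgeCost, mult_singleton]

theorem edgeCost_cons_cons {N : Network} (w : Fin N.nE → ℝ) {e : Fin N.nE} {a b : Fin N.nV}
    (he : N.edge e = (a, b)) (l : List (Fin N.nV)) :
    edgeCost N w (a :: b :: l) = edgeCost N w (b :: l) + w e / N.B e := by
  have : ∀ e', (N.edge e' = (a, b)) ↔ e = e' := fun e' => by
    rw [← he]; exact ⟨fun h => (N.edge_injective h).symm, fun h => h ▸ rfl⟩
  simp [edgeCost, mult_cons_cons, this, add_mul, Finset.sum_add_distrib]

/-- The parent edges `ed` lead from the vertex at the head of the list along the list to `t`, in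
the layer after the processing. -/
def UpPath (N : Network) (ed : ℕ → ℕ) (t : Fin N.nV) : List (Fin N.nV) → Prop
  | [] => False
  | [a] => a = t
  | a :: b :: l => a ≠ t ∧ (∃ e, N.edge e = (a, b) ∧ ed (a + N.nV) = N.nE + e + 1) ∧
      UpPath N ed t (b :: l)

/-- The parent edges `ed` lead from the vertex at the head of the list along the list to `t`,
and change the layers at `v`. -/
def LowPath (N : Network) (ed : ℕ → ℕ) (t v : Fin N.nV) : List (Fin N.nV) → Prop
  | [] => False
  | [a] => a = v ∧ ed a = N.nE + N.nE + a + 1 ∧ UpPath N ed t [a]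
  | a :: b :: l => (a = v ∧ ed a = N.nE + N.nE + a + 1 ∧ UpPath N ed t (a :: b :: l)) ∨
      ((∃ e, N.edge e = (a, b) ∧ ed a = e + 1) ∧ LowPath N ed t v (b :: l))

/-! ### Optimality of the distances, and the walks described by the parent edges. -/

section Certificate

variable {N : Network} {w : Fin N.nE → ℝ} {q : Fin N.nV → ℝ} {hw : ∀ e, 0 < w e}
  {hq : ∀ v, 0 < q v} {t : Fin N.nV} {cs : ℕ} {st : ℕ → ℕ} {d : ℕ → ℝ} {ed : ℕ → ℕ}

/-- All seen nodes are settled. -/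
theorem settled_of_seen {G : SearchGraph} {P : ℕ → Prop} (h : SearchInv G cs st d ed P)
    (ho : ∀ x < G.M, st x ≠ cs) {x : ℕ} (hx : x < G.M) (hs : cs ≤ st x) : st x = cs + 1 := by
  have := h.st_le x hx
  have := ho x hx
  omega

/-- The relaxation inequalities add up along an arbitrary walk to the destination; neither
simplicity nor a bound on visits is needed for this direction. -/
theorem upper_le (h : SearchInv (layerGraph N w q hw hq t) cs st d ed fun _ => True)
    (ho : ∀ x < N.nV + N.nV, st x ≠ cs) (l : List (Fin N.nV)) (a : Fin N.nV)
    (hc : (a :: l).IsChain fun u v => ∃ e, N.edge e = (u, v))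
    (hl : (a :: l).getLast? = some t) :
    cs ≤ st (a + N.nV) ∧ d (a + N.nV) ≤ edgeCost N w (a :: l) := by
  induction l generalizing a with
  | nil =>
    obtain rfl : a = t := by simpa using hl
    exact ⟨h.root_seen, by rw [edgeCost_singleton]; exact h.d_root.le⟩
  | cons b l ih =>
    obtain ⟨⟨e, he⟩, hc'⟩ := List.isChain_cons_cons.1 hc
    obtain ⟨h1, h2⟩ := ih b hc' (by simpa using hl)
    obtain ⟨g1, g2, g3⟩ := layer_upper N w q e
    have hb : (b : ℕ) + N.nV < N.nV + N.nV := by omega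
    have := h.relaxed (N.nE + e + 1) (by omega) (by simp only [layerGraph]; omega)
      (by simp only [layerGraph, g1, he]; exact hb)
      (by simp only [layerGraph, g1, he]; exact settled_of_seen h ho hb h1) trivial
    simp only [layerGraph, g1, g2, g3, he] at this
    rw [edgeCost_cons_cons w he]
    exact ⟨this.1, by linarith [this.2]⟩

theorem copy_le (h : SearchInv (layerGraph N w q hw hq t) cs st d ed fun _ => True)
    (ho : ∀ x < N.nV + N.nV, st x ≠ cs) {v : Fin N.nV} (hv : 0 < N.C v)
    (hs : cs ≤ st (v + N.nV)) : cs ≤ st v ∧ d v ≤ d (v + N.nV) + q v / N.C v := by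
  obtain ⟨g1, g2, g3⟩ := layer_copy N w q v
  rw [if_pos hv] at g1
  have hb : (v : ℕ) + N.nV < N.nV + N.nV := by omega
  have := h.relaxed (N.nE + N.nE + v + 1) (by omega) (by simp only [layerGraph]; omega)
    (by simp only [layerGraph, g1]; exact hb)
    (by simp only [layerGraph, g1]; exact settled_of_seen h ho hb hs) trivial
  simpa only [layerGraph, g1, g2, g3] using this

/-- The walk is lifted to the two layers by changing them at the first visit of `v`. -/
theorem lower_le (h : SearchInv (layerGraph N w q hw hq t) cs st d ed fun _ => True)
    (ho : ∀ x < N.nV + N.nV, st x ≠ cs) {v : Fin N.nV} (hv : 0 < N.C v)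
    (l : List (Fin N.nV)) (a : Fin N.nV)
    (hc : (a :: l).IsChain fun u v => ∃ e, N.edge e = (u, v))
    (hl : (a :: l).getLast? = some t) (hvl : v ∈ a :: l) :
    cs ≤ st a ∧ d a ≤ edgeCost N w (a :: l) + q v / N.C v := by
  induction l generalizing a with
  | nil =>
    obtain rfl : v = a := by simpa using hvl
    obtain ⟨h1, h2⟩ := upper_le h ho [] v hc hl
    obtain ⟨h3, h4⟩ := copy_le h ho hv h1
    exact ⟨h3, by linarith⟩
  | cons b l ih =>
    by_cases hva : v = a
    · subst hva
      obtain ⟨h1, h2⟩ := upper_le h ho _ v hc hl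
      obtain ⟨h3, h4⟩ := copy_le h ho hv h1
      exact ⟨h3, by linarith⟩
    obtain ⟨⟨e, he⟩, hc'⟩ := List.isChain_cons_cons.1 hc
    obtain ⟨h1, h2⟩ := ih b hc' (by simpa using hl) (by simpa [hva] using hvl)
    obtain ⟨g1, g2, g3⟩ := layer_lower N w q e
    have hb : (b : ℕ) < N.nV + N.nV := by omega
    have := h.relaxed (e + 1) (by omega) (by simp only [layerGraph]; omega)
      (by simp only [layerGraph, g1, he]; exact hb)
      (by simp only [layerGraph, g1, he]; exact settled_of_seen h ho hb h1) trivial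
    simp only [layerGraph, g1, g2, g3, he] at this
    rw [edgeCost_cons_cons w he]
    exact ⟨this.1, by linarith [this.2]⟩

/-- Induction along the parent edges. -/
theorem SearchInv.induction {G : SearchGraph} {P : ℕ → Prop} (h : SearchInv G cs st d ed P)
    {motive : ℕ → Prop} (hroot : motive G.root)
    (hstep : ∀ g, 1 ≤ g → g ≤ G.m → G.src g < G.M → cs ≤ st (G.src g) → cs ≤ st (G.tgt g) →
      G.tgt g ≠ G.root → ed (G.tgt g) = g →
      d (G.tgt g) = d (G.src g) + G.wt g → d (G.src g) < d (G.tgt g) →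
      motive (G.src g) → motive (G.tgt g))
    {x : ℕ} (hx : x < G.M) (hs : cs ≤ st x) : motive x := by
  induction hn : (G.R.filter fun y => d y < d x).card using Nat.strong_induction_on
    generalizing x with
  | _ n ih =>
    subst hn
    rcases eq_or_ne x G.root with rfl | hne
    · exact hroot
    obtain ⟨a1, a2, a3, a4, a5, a6⟩ := h.par x hx hs hne
    have hR := h.seen_mem _ a4 (by omega)
    have hlt : d (G.src (ed x)) < d x := by linarith [G.wt_pos _ a1 a2 hR]
    have hm : motive (G.src (ed x)) := by
      refine ih _ ?_ a4 (by omega) rfl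
      -- Edge lengths are positive, so the parent has a smaller distance, and fewer reachable nodes
      -- lie strictly below it.
      refine Finset.card_lt_card (Finset.ssubset_iff_of_subset ?_ |>.2 ?_)
      · intro y
        simp only [Finset.mem_filter]
        exact fun hy => ⟨hy.1, hy.2.trans hlt⟩
      · exact ⟨_, Finset.mem_filter.2 ⟨hR, hlt⟩, by simp⟩
    have := hstep (ed x) a1 a2 a4 (by omega) (by rwa [a3]) (by rwa [a3]) (by rw [a3])
      (by rwa [a3]) (by rwa [a3]) hm
    rwa [a3] at this

/-- The parent edges describe a walk from the node `x` to `t` of the cost `d x`. -/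
def HasPath (N : Network) (w : Fin N.nE → ℝ) (q : Fin N.nV → ℝ) (t : Fin N.nV) (d : ℕ → ℝ)
    (ed : ℕ → ℕ) (x : ℕ) : Prop :=
  (∀ a : Fin N.nV, x = a + N.nV → ∃ l, (a :: l).IsChain (fun u v => ∃ e, N.edge e = (u, v)) ∧
    (a :: l).getLast? = some t ∧ (a :: l).Nodup ∧ (∀ u ∈ a :: l, d (u + N.nV) ≤ d x) ∧
    edgeCost N w (a :: l) = d x ∧ UpPath N ed t (a :: l)) ∧
  ∀ a : Fin N.nV, x = a → ∃ l v, (a :: l).IsChain (fun u v => ∃ e, N.edge e = (u, v)) ∧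
    (a :: l).getLast? = some t ∧ v ∈ a :: l ∧ 0 < N.C v ∧
    (∃ l₁ l₂, a :: l = l₁ ++ l₂ ∧ l₁.Nodup ∧ l₂.Nodup ∧ ∀ u ∈ l₁, d u ≤ d x) ∧
    edgeCost N w (a :: l) + q v / N.C v = d x ∧ LowPath N ed t v (a :: l)

/-- Distances strictly increase with every parent edge added in front, so the new vertex differs
from the previous ones in the same layer. In the second clause, `l₁` is the part before the change
of layers and `l₂` begins at the processing vertex; each of them is free of repetitions. -/
theorem hasPath (h : SearchInv (layerGraph N w q hw hq t) cs st d ed fun _ => True)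
    {x : ℕ} (hx : x < N.nV + N.nV) (hs : cs ≤ st x) : HasPath N w q t d ed x := by
  refine h.induction (motive := HasPath N w q t d ed) ⟨?_, ?_⟩ ?_ hx hs
  · intro a ha
    have : a = t := Fin.ext (by simp only [layerGraph] at ha; omega)
    subst this
    refine ⟨[], by simp, by simp, by simp, by simp [layerGraph], ?_, by simp [UpPath]⟩
    rw [edgeCost_singleton]
    exact h.d_root.symm
  · intro a ha
    simp only [layerGraph] at ha
    omega
  · rintro g hg1 hg2 hsM hs1 hs2 hroot hed hdeq hdlt ⟨ih1, ih2⟩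
    rcases layer_cases (N := N) hg1 hg2 with ⟨e, rfl⟩ | ⟨e, rfl⟩ | ⟨v, rfl⟩
    · obtain ⟨g1, g2, g3⟩ := layer_lower N w q e
      simp only [layerGraph, g1, g2, g3] at *
      refine ⟨fun a ha => by omega, fun a ha => ?_⟩
      have ha : (N.edge e).1 = a := Fin.ext ha
      obtain ⟨l, v, c1, c2, c3, c4, ⟨l₁, l₂, c5, c6, c7, c8⟩, c9, c10⟩ := ih2 (N.edge e).2 rfl
      have he : N.edge e = (a, (N.edge e).2) := by rw [← ha]
      subst ha
      refine ⟨(N.edge e).2 :: l, v, List.isChain_cons_cons.2 ⟨⟨e, he⟩, c1⟩, by simpa using c2,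
        List.mem_cons_of_mem _ c3, c4, ⟨(N.edge e).1 :: l₁, l₂, by rw [c5]; rfl, ?_, c7, ?_⟩, ?_, ?_⟩
      · refine List.nodup_cons.2 ⟨fun hmem => ?_, c6⟩
        linarith [c8 _ hmem]
      · intro u hu
        rcases List.mem_cons.1 hu with rfl | hu
        · exact le_rfl
        · linarith [c8 u hu]
      · rw [edgeCost_cons_cons w he, hdeq]; linarith
      · exact Or.inr ⟨⟨e, he, hed⟩, c10⟩
    · obtain ⟨g1, g2, g3⟩ := layer_upper N w q e
      simp only [layerGraph, g1, g2, g3] at *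
      refine ⟨fun a ha => ?_, fun a ha => by omega⟩
      have ha : (N.edge e).1 = a := Fin.ext (by omega)
      obtain ⟨l, c1, c2, c3, c4, c5, c6⟩ := ih1 (N.edge e).2 rfl
      have he : N.edge e = (a, (N.edge e).2) := by rw [← ha]
      subst ha
      refine ⟨(N.edge e).2 :: l, List.isChain_cons_cons.2 ⟨⟨e, he⟩, c1⟩, by simpa using c2,
        List.nodup_cons.2 ⟨fun hmem => ?_, c3⟩, ?_, ?_, ?_⟩
      · linarith [c4 _ hmem]
      · intro u hu
        rcases List.mem_cons.1 hu with rfl | hu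
        · exact le_rfl
        · linarith [c4 u hu]
      · rw [edgeCost_cons_cons w he, hdeq]; linarith
      · refine ⟨fun h => hroot (by rw [h]), ⟨e, he, hed⟩, c6⟩
    · obtain ⟨g1, g2, g3⟩ := layer_copy N w q v
      simp only [layerGraph, g1, g2, g3] at *
      split_ifs at * with hC
      · refine ⟨fun a ha => by omega, fun a ha => ?_⟩
        have ha : v = a := Fin.ext ha
        subst ha
        obtain ⟨l, c1, c2, c3, c4, c5, c6⟩ := ih1 v rfl
        refine ⟨l, v, c1, c2, by simp, hC, ⟨[], v :: l, rfl, by simp, c3, by simp⟩, ?_, ?_⟩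
        · rw [c5, hdeq]
        · cases l with
          | nil => exact ⟨rfl, hed, c6⟩
          | cons b l => exact Or.inl ⟨rfl, hed, c6⟩
      · omega

/-- The search for the `i`-th pair finds the minimum cost. -/
theorem search_min {i : Fin N.nD}
    (h : SearchInv (layerGraph N w q hw hq (N.dst i)) cs st d ed fun _ => True)
    (ho : ∀ x < N.nV + N.nV, st x ≠ cs) (π : TwoWalk N i) (v : Fin N.nV) (hv : v ∈ π.1)
    (hC : 0 < N.C v) : cs ≤ st (N.src i) ∧ d (N.src i) ≤ cost N w q π.1 v := by
  obtain ⟨π, h1, h2, h3, h4⟩ := π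
  cases π with
  | nil => simp at h1
  | cons a l =>
    obtain rfl : a = N.src i := by simpa using h1
    exact lower_le h ho hC l _ h3 h2 hv

/-- Two repetition-free parts contain each vertex at most twice. This is where the shortest path
becomes a 2-walk. -/
theorem search_walk {i : Fin N.nD}
    (h : SearchInv (layerGraph N w q hw hq (N.dst i)) cs st d ed fun _ => True)
    (hs : cs ≤ st (N.src i)) : ∃ (π : TwoWalk N i) (v : Fin N.nV), v ∈ π.1 ∧ 0 < N.C v ∧
      cost N w q π.1 v = d (N.src i) ∧ LowPath N ed (N.dst i) v π.1 := by
  obtain ⟨l, v, c1, c2, c3, c4, ⟨l₁, l₂, c5, c6, c7, -⟩, c9, c10⟩ :=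
    (hasPath h (x := N.src i) (by omega) hs).2 (N.src i) rfl
  refine ⟨⟨N.src i :: l, rfl, c2, c1, fun u => ?_⟩, v, c3, c4, c9, c10⟩
  rw [c5, List.count_append]
  have := List.nodup_iff_count_le_one.1 c6 u
  have := List.nodup_iff_count_le_one.1 c7 u
  omega

end Certificate

/-! ### The input and the preprocessing -/

/-- The memory holds the instance. -/
structure HasInput (N : Network) (ε : ℝ) (σ : Mem) : Prop where
  nV : σ.nat 0 0 = N.nV
  nE : σ.nat 0 1 = N.nE
  nD : σ.nat 0 2 = N.nD
  tail : ∀ e : Fin N.nE, σ.nat 1 e = (N.edge e).1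
  head : ∀ e : Fin N.nE, σ.nat 2 e = (N.edge e).2
  src : ∀ i : Fin N.nD, σ.nat 3 i = N.src i
  dst : ∀ i : Fin N.nD, σ.nat 4 i = N.dst i
  eps : σ.real 0 0 = ε
  B : ∀ e : Fin N.nE, σ.real 1 e = N.B e
  C : ∀ v : Fin N.nV, σ.real 2 v = N.C v

theorem hasInput_input (N : Network) (ε : ℝ) : HasInput N ε (input N ε) := by
  constructor <;> simp [input]

/-- The program does not assign to the arrays of the input. -/
def Program.keepsInput (c : Program) : Bool :=
  !(c.writesNat 0 || c.writesNat 1 || c.writesNat 2 || c.writesNat 3 || c.writesNat 4 ||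
    c.writesReal 0 || c.writesReal 1 || c.writesReal 2)

theorem HasInput.frame {N : Network} {ε : ℝ} {c : Program} {σ τ : Mem} (h : HasInput N ε σ)
    (hF : Frame c σ τ) (hc : c.keepsInput = true) : HasInput N ε τ := by
  simp only [Program.keepsInput, Bool.not_eq_true', Bool.or_eq_false_iff] at hc
  obtain ⟨⟨⟨⟨⟨⟨⟨c0, c1⟩, c2⟩, c3⟩, c4⟩, r0⟩, r1⟩, r2⟩ := hc
  constructor
  · rw [hF.nat 0 c0]; exact h.nV
  · rw [hF.nat 0 c0]; exact h.nE
  · rw [hF.nat 0 c0]; exact h.nD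
  · rw [hF.nat 1 c1]; exact h.tail
  · rw [hF.nat 2 c2]; exact h.head
  · rw [hF.nat 3 c3]; exact h.src
  · rw [hF.nat 4 c4]; exact h.dst
  · rw [hF.real 0 r0]; exact h.eps
  · rw [hF.real 1 r1]; exact h.B
  · rw [hF.real 2 r2]; exact h.C

/-- The number of vertices. -/
abbrev numV : NExp := .get 0 (.const 0)

/-- The number of edges. -/
abbrev numE : NExp := .get 0 (.const 1)

/-- The number of pairs. -/
abbrev numD : NExp := .get 0 (.const 2)

/-- A real number that exceeds the number of experts. -/
def countExperts : Program :=
  .seq (.setReal 10 (.const 0) (.const 2))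
    (.seq (forLoop 27 numV (.setReal 10 (.const 0) (.add (rv 10) (.const 1))))
      (forLoop 27 numE (.setReal 10 (.const 0) (.add (rv 10) (.const 1)))))

/-- Natural numbers cannot be converted into reals on this machine, so the real count is accumulated
in loops. The initial value 2 ensures that logarithms of the result are positive. -/
theorem wp_countExperts {N : Network} {ε : ℝ} {σ : Mem} (h : HasInput N ε σ) :
    wp countExperts σ fun k τ => k ≤ 30 * (N.nV + N.nE) + 30 ∧
      τ.real 10 0 = 2 + N.nV + N.nE := by
  simp only [countExperts, wp_seq, wp_setReal]
  have h0 := h.frame (Exec.setReal σ 10 (.const 0) (.const 2)).frame (by decide)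
  refine wp_mono (wp_frame (wp_forLoop N.nV 6 (fun i τ => τ.real 10 0 = 2 + i) (by decide)
    (fun i σ x h => by simpa using h) (fun τ hF => (h0.frame hF (by decide)).nV)
    (fun i τ hi hF hiv hI => ?_) (by simp))) ?_
  · simp [hI]; ring
  rintro k τ ⟨hF, hk, hX⟩
  have h1 := h0.frame hF (by decide)
  refine wp_mono (wp_forLoop N.nE 6 (fun i τ => τ.real 10 0 = 2 + N.nV + i) (by decide)
    (fun i σ x h => by simpa using h) (fun τ hF => (h1.frame hF (by decide)).nE)
    (fun i τ hi hF hiv hI => ?_) (by simp [hX])) ?_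
  · simp [hI]; ring
  rintro l ρ ⟨hl, hX'⟩
  simp at hk hl ⊢
  exact ⟨by omega, hX'⟩

/-- A power of the number of experts with an exponent of at least `4 / ε`. -/
def computePower : Program :=
  .seq (.setReal 11 (.const 0) (.const 1))
    (.seq (.setReal 12 (.const 0) (.const 0))
      (.loop (.realLt (.mul (rv 12) (rv 0)) (.const 4))
        (.seq (.setReal 12 (.const 0) (.add (rv 12) (.const 1)))
          (.setReal 11 (.const 0) (.mul (rv 11) (rv 10))))))

theorem wp_computePower {σ : Mem} {ε : ℝ} (hε : 0 < ε) (h0 : σ.real 0 0 = ε) :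
    wp computePower σ fun k τ => k ≤ 30 * ⌈4 / ε⌉₊ + 30 ∧
      τ.real 11 0 = σ.real 10 0 ^ ⌈4 / ε⌉₊ := by
  simp only [computePower, wp_seq, wp_setReal]
  refine wp_mono (wp_loop (fun r τ => ∃ k ≤ ⌈4 / ε⌉₊, τ.real 12 0 = k ∧
    τ.real 11 0 = σ.real 10 0 ^ k ∧ r = 30 * (⌈4 / ε⌉₊ - k) + 10)
    (Q := fun τ => τ.real 11 0 = σ.real 10 0 ^ ⌈4 / ε⌉₊) ?_ ?_
    ⟨0, Nat.zero_le _, by simp, by simp, rfl⟩) ?_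
  · rintro r τ hF ⟨k, hk, h1, h2, rfl⟩ hb
    have f0 : τ.real 0 = σ.real 0 := by rw [hF.real 0 (by decide)]; simp
    have f10 : τ.real 10 = σ.real 10 := by rw [hF.real 10 (by decide)]; simp
    simp [h1, f0, h0] at hb
    have hk' : k < ⌈4 / ε⌉₊ := by
      rw [Nat.lt_ceil, lt_div_iff₀ hε]; exact hb
    simp [h1, h2, f10]
    intro _
    exact ⟨k + 1, ⟨hk', by simp, by rw [pow_succ]⟩, by omega⟩
  · rintro r τ hF ⟨k, hk, h1, h2, rfl⟩ hb
    have f0 : τ.real 0 = σ.real 0 := by rw [hF.real 0 (by decide)]; simp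
    simp [h1, f0, h0] at hb
    -- The loop stops at the first integer k with kε ≥ 4, which is the ceiling; it is found without
    -- rounding.
    have : k = ⌈4 / ε⌉₊ := le_antisymm hk (Nat.ceil_le.2 ((div_le_iff₀ hε).2 hb))
    subst this
    exact ⟨by simp, h2⟩
  · rintro k τ ⟨h1, h2⟩
    simp at h1 ⊢
    exact ⟨by omega, h2⟩

/-- The least power of `1 + ε` that exceeds the power of the number of experts, and the
initial weight. -/
def computeDelta : Program :=
  .seq (.setReal 13 (.const 0) (.const 1))
    (.seq (.setReal 17 (.const 0) (.const 1))
      (.seq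
        (.loop (.realLt (rv 13) (rv 11))
          (.seq (.setReal 13 (.const 0) (.mul (rv 13) (.add (.const 1) (rv 0))))
            (.setReal 17 (.const 0) (.add (rv 17) (.const 1)))))
        (.setReal 18 (.const 0) (.div (.const 1) (rv 13)))))

/-- The counter starts at 1 instead of 0, so it ends at j + 1, which is the divisor of the amounts.
-/
theorem wp_computeDelta {σ : Mem} {ε : ℝ} (h0 : σ.real 0 0 = ε) {j : ℕ}
    (hj : σ.real 11 0 ≤ (1 + ε) ^ j) (hj' : ∀ i < j, (1 + ε) ^ i < σ.real 11 0) :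
    wp computeDelta σ fun k τ => k ≤ 30 * j + 40 ∧
      τ.real 18 0 = 1 / (1 + ε) ^ j ∧ τ.real 17 0 = j + 1 := by
  simp only [computeDelta, wp_seq, wp_setReal]
  refine wp_mono (wp_loop (fun r τ => ∃ k ≤ j, τ.real 17 0 = k + 1 ∧
    τ.real 13 0 = (1 + ε) ^ k ∧ r = 30 * (j - k) + 10)
    (Q := fun τ => τ.real 13 0 = (1 + ε) ^ j ∧ τ.real 17 0 = j + 1) ?_ ?_
    ⟨0, Nat.zero_le _, by simp, by simp, rfl⟩) ?_
  · rintro r τ hF ⟨k, hk, h1, h2, rfl⟩ hb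
    have f0 : τ.real 0 = σ.real 0 := by rw [hF.real 0 (by decide)]; simp
    have f11 : τ.real 11 = σ.real 11 := by rw [hF.real 11 (by decide)]; simp
    simp [h2, f11] at hb
    have hk' : k < j := by
      refine lt_of_le_of_ne hk ?_
      rintro rfl
      exact absurd hb (not_lt.2 hj)
    simp [h1, h2, f0, h0]
    intro _
    exact ⟨k + 1, ⟨hk', by simp, by rw [pow_succ]⟩, by omega⟩
  · rintro r τ hF ⟨k, hk, h1, h2, rfl⟩ hb
    have f11 : τ.real 11 = σ.real 11 := by rw [hF.real 11 (by decide)]; simp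
    simp [h2, f11] at hb
    have : k = j := by
      by_contra hne
      exact absurd (hj' k (by omega)) (not_lt.2 hb)
    subst this
    exact ⟨by simp, h2, h1⟩
  · rintro k τ ⟨h1, h2, h3⟩
    simp [h2, h3] at h1 ⊢
    omega

/-- The table of `i ↦ i / 2`. -/
def fillHalf : Program :=
  forLoop 27 (.add (.add numV numV) (.add numV numV))
    (.setNat 14 (.add (nv 27) (.const 2)) (.add (.get 14 (nv 27)) (.const 1)))

/-- The table is filled by (i + 2)/2 = i/2 + 1. Its entries 0 and 1 are correct because the memory
is initially zero, so the invariant is two entries ahead of the counter. -/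
theorem wp_fillHalf {N : Network} {ε : ℝ} {σ : Mem} (h : HasInput N ε σ)
    (hz : ∀ i, σ.nat 14 i = 0) :
    wp fillHalf σ fun k τ => k ≤ 160 * N.nV + 30 ∧
      ∀ i < N.nV + N.nV + (N.nV + N.nV), τ.nat 14 i = i / 2 := by
  refine wp_mono (wp_forLoop (N.nV + N.nV + (N.nV + N.nV)) 12
    (fun i τ => ∀ j < i + 2, τ.nat 14 j = j / 2) (by decide)
    (fun i σ x h => by simpa using h) (fun τ hF => ?_)
    (fun i τ hi hF hiv hI => ?_) (fun j hj => by rw [hz]; omega)) ?_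
  · have := (h.frame hF (by decide)).nV
    simp [this]
  · simp [hiv]
    intro j hj
    rcases eq_or_ne j (i + 2) with rfl | hne
    · rw [Function.update_self, hI i (by omega)]; omega
    · rw [Function.update_of_ne hne]; exact hI j (by omega)
  · rintro k τ ⟨h1, h2⟩
    simp at h1
    exact ⟨by omega, fun i hi => h2 i (by omega)⟩

/-- Write down the edges of the layered graph. -/
def fillLayers : Program :=
  .seq (forLoop 27 numE
    (.seq (.setNat 18 (.add (nv 27) (.const 1)) (.get 2 (nv 27)))
      (.seq (.setNat 13 (.add (nv 27) (.const 1)) (.get 1 (nv 27)))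
        (.seq (.setNat 18 (.add (.add numE (nv 27)) (.const 1)) (.add (.get 2 (nv 27)) numV))
          (.setNat 13 (.add (.add numE (nv 27)) (.const 1)) (.add (.get 1 (nv 27)) numV))))))
    (forLoop 27 numV
      (.seq (.setNat 13 (.add (.add (.add numE numE) (nv 27)) (.const 1)) (nv 27))
        (.cond (.realLt (.const 0) (.get 2 (nv 27)))
          (.setNat 18 (.add (.add (.add numE numE) (nv 27)) (.const 1)) (.add (nv 27) numV))
          (.setNat 18 (.add (.add (.add numE numE) (nv 27)) (.const 1)) (.add numV numV)))))

theorem wp_fillLayers {N : Network} {ε : ℝ} {σ : Mem} (h : HasInput N ε σ) :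
    wp fillLayers σ fun k τ => k ≤ 80 * (N.nV + N.nE) + 30 ∧
      ∀ g, 1 ≤ g → g ≤ N.nE + N.nE + N.nV → τ.nat 18 g = layerSrc N g ∧
        τ.nat 13 g = layerTgt N g := by
  have hl := fun e => layer_lower N (fun _ => 1) (fun _ => 1) e
  have hu := fun e => layer_upper N (fun _ => 1) (fun _ => 1) e
  have hc := fun v => layer_copy N (fun _ => 1) (fun _ => 1) v
  simp only [fillLayers, wp_seq]
  refine wp_mono (wp_frame (wp_forLoop N.nE 50 (fun i τ => ∀ e : Fin N.nE, (e : ℕ) < i →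
    (τ.nat 18 (e + 1) = layerSrc N (e + 1) ∧ τ.nat 13 (e + 1) = layerTgt N (e + 1)) ∧
    τ.nat 18 (N.nE + e + 1) = layerSrc N (N.nE + e + 1) ∧
      τ.nat 13 (N.nE + e + 1) = layerTgt N (N.nE + e + 1)) (by decide)
    (fun i σ x h => by simpa using h) (fun τ hF => (h.frame hF (by decide)).nE)
    (fun i τ hi hF hiv hI => ?_) (fun e he => by omega))) ?_
  · have hin := h.frame hF (by decide)
    have h1 := hin.tail ⟨i, hi⟩
    have h2 := hin.head ⟨i, hi⟩
    simp at h1 h2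
    simp [hiv, hin.nE, hin.nV, h1, h2]
    intro e he
    obtain ⟨a1, a2, -⟩ := hl e
    obtain ⟨b1, b2, -⟩ := hu e
    rw [a1, a2, b1, b2]
    by_cases hei : (e : ℕ) = i
    · subst hei
      simp [Function.update_apply]
      omega
    · have := hI e (by omega)
      rw [a1, a2, b1, b2] at this
      simp [hei, show (e : ℕ) ≠ N.nE + i by omega,
        show N.nE + (e : ℕ) ≠ i by omega, this]
  rintro k τ ⟨hF, hk, hI⟩
  have hin := h.frame hF (by decide)
  refine wp_mono (wp_frame (wp_forLoop N.nV 50 (fun i τ => (∀ e : Fin N.nE,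
    (τ.nat 18 (e + 1) = layerSrc N (e + 1) ∧ τ.nat 13 (e + 1) = layerTgt N (e + 1)) ∧
    τ.nat 18 (N.nE + e + 1) = layerSrc N (N.nE + e + 1) ∧
      τ.nat 13 (N.nE + e + 1) = layerTgt N (N.nE + e + 1)) ∧
    ∀ v : Fin N.nV, (v : ℕ) < i →
      τ.nat 18 (N.nE + N.nE + v + 1) = layerSrc N (N.nE + N.nE + v + 1) ∧
      τ.nat 13 (N.nE + N.nE + v + 1) = layerTgt N (N.nE + N.nE + v + 1)) (by decide)
    (fun i σ x h => by simpa using h) (fun τ hF => (hin.frame hF (by decide)).nV)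
    (fun i τ hi hF hiv hI => ?_) ⟨fun e => hI e e.2, fun e he => by omega⟩)) ?_
  · have hin := hin.frame hF (by decide)
    have h1 := hin.C ⟨i, hi⟩
    simp at h1
    have key : ∀ c : ℕ, (c = if 0 < N.C ⟨i, hi⟩ then i + N.nV else N.nV + N.nV) →
      (∀ e : Fin N.nE,
        (Function.update (τ.nat 18) (N.nE + N.nE + i + 1) c (e + 1) = layerSrc N (e + 1) ∧
          Function.update (τ.nat 13) (N.nE + N.nE + i + 1) i (e + 1) = layerTgt N (e + 1)) ∧
        Function.update (τ.nat 18) (N.nE + N.nE + i + 1) c (N.nE + e + 1) =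
          layerSrc N (N.nE + e + 1) ∧
        Function.update (τ.nat 13) (N.nE + N.nE + i + 1) i (N.nE + e + 1) =
          layerTgt N (N.nE + e + 1)) ∧
      ∀ v : Fin N.nV, (v : ℕ) ≤ i →
        Function.update (τ.nat 18) (N.nE + N.nE + i + 1) c (N.nE + N.nE + v + 1) =
          layerSrc N (N.nE + N.nE + v + 1) ∧
        Function.update (τ.nat 13) (N.nE + N.nE + i + 1) i (N.nE + N.nE + v + 1) =
          layerTgt N (N.nE + N.nE + v + 1) := by
      intro c hc'
      refine ⟨fun e => ?_, fun v hv => ?_⟩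
      · rw [Function.update_of_ne (by omega), Function.update_of_ne (by omega),
          Function.update_of_ne (by omega), Function.update_of_ne (by omega)]
        exact hI.1 e
      · by_cases hvi : (v : ℕ) = i
        · subst hvi
          rw [Function.update_self, Function.update_self, (hc v).1, (hc v).2.1]
          exact ⟨hc', rfl⟩
        · rw [Function.update_of_ne (by omega), Function.update_of_ne (by omega)]
          exact hI.2 v (by omega)
    simp [hiv, hin.nE, hin.nV, h1]
    split_ifs with hC
    · exact key _ (by rw [if_pos hC])
    · exact key _ (by rw [if_neg hC])
  rintro l ρ ⟨hFρ, hl, hI⟩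
  simp at hk hl
  refine ⟨by omega, fun g hg1 hg2 => ?_⟩
  rcases layer_cases hg1 hg2 with ⟨e, rfl⟩ | ⟨e, rfl⟩ | ⟨v, rfl⟩
  · exact (hI.1 e).1
  · exact (hI.1 e).2
  · exact hI.2 v v.2

/-- Build the lists of the edges that leave the nodes. -/
def linkEdges : Program :=
  forLoop 27 (.add (.add numE numE) numV)
    (.seq (.setNat 12 (.add (nv 27) (.const 1)) (.get 11 (.get 18 (.add (nv 27) (.const 1)))))
      (.setNat 11 (.get 18 (.add (nv 27) (.const 1))) (.add (nv 27) (.const 1))))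

/-- Edges are inserted at the front in increasing order, so the head of a list is the greatest edge
so far, and its successor is the previous head. Zero memory means that all lists are initially
empty. -/
theorem wp_linkEdges {N : Network} {ε : ℝ} {σ : Mem} {src : ℕ → ℕ} (h : HasInput N ε σ)
    (hz : ∀ i, σ.nat 11 i = 0)
    (hsrc : ∀ g, 1 ≤ g → g ≤ N.nE + N.nE + N.nV → σ.nat 18 g = src g) :
    wp linkEdges σ fun k τ => k ≤ 100 * (N.nV + N.nE) + 30 ∧
      (∀ x, τ.nat 11 x = lastEdge src (N.nE + N.nE + N.nV) x) ∧
      ∀ g, 1 ≤ g → g ≤ N.nE + N.nE + N.nV → τ.nat 12 g = lastEdge src (g - 1) (src g) := by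
  refine wp_mono (wp_forLoop (N.nE + N.nE + N.nV) 25
    (fun i τ => (∀ x, τ.nat 11 x = lastEdge src i x) ∧
      ∀ g, 1 ≤ g → g ≤ i → τ.nat 12 g = lastEdge src (g - 1) (src g)) (by decide)
    (fun i σ x h => by simpa using h) (fun τ hF => ?_)
    (fun i τ hi hF hiv hI => ?_) ⟨fun x => by rw [hz]; rfl, fun g h1 h2 => by omega⟩) ?_
  · have := h.frame hF (by decide)
    simp [this.nV, this.nE]
  · have f18 : τ.nat 18 (i + 1) = src (i + 1) := by
      rw [hF.nat 18 (by decide), hsrc _ (by omega) (by omega)]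
    simp [hiv, f18]
    refine ⟨fun x => ?_, fun g hg1 hg2 => ?_⟩
    · rw [lastEdge]
      split_ifs with hx
      · subst hx; simp
      · rw [Function.update_of_ne (Ne.symm hx)]; exact hI.1 x
    · rcases eq_or_ne g (i + 1) with rfl | hne
      · rw [Function.update_self, hI.1]; rfl
      · rw [Function.update_of_ne hne]; exact hI.2 g hg1 (by omega)
  · rintro k τ ⟨h1, h2⟩
    simp at h1
    exact ⟨by omega, h2⟩

/-- All weights become the initial weight. -/
def initWeights : Program :=
  .seq (forLoop 27 numE (.setReal 4 (nv 27) (rv 18)))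
    (forLoop 27 numV (.setReal 5 (nv 27) (rv 18)))

theorem wp_initWeights {N : Network} {ε : ℝ} {σ : Mem} (h : HasInput N ε σ) :
    wp initWeights σ fun k τ => k ≤ 30 * (N.nV + N.nE) + 30 ∧
      (∀ e < N.nE, τ.real 4 e = σ.real 18 0) ∧ ∀ v < N.nV, τ.real 5 v = σ.real 18 0 := by
  simp only [initWeights, wp_seq]
  refine wp_mono (wp_frame (wp_forLoop N.nE 6 (fun i τ => ∀ e < i, τ.real 4 e = σ.real 18 0)
    (by decide) (fun i σ x h => by simpa using h) (fun τ hF => (h.frame hF (by decide)).nE)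
    (fun i τ hi hF hiv hI => ?_) (by simp))) ?_
  · have f18 : τ.real 18 = σ.real 18 := hF.real 18 (by decide)
    simp [hiv, f18]
    intro e he
    rcases eq_or_ne e i with rfl | hne
    · simp
    · rw [Function.update_of_ne hne]; exact hI e (by omega)
  rintro k τ ⟨hF, hk, hI⟩
  have f18 : τ.real 18 = σ.real 18 := hF.real 18 (by decide)
  have h1 := h.frame hF (by decide)
  refine wp_mono (wp_frame (wp_forLoop N.nV 6 (fun i τ => ∀ e < i, τ.real 5 e = σ.real 18 0)
    (by decide) (fun i σ x h => by simpa using h) (fun τ hF => (h1.frame hF (by decide)).nV)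
    (fun i μ hi hF hiv hI => ?_) (by simp))) ?_
  · have f18' : μ.real 18 = σ.real 18 := by rw [hF.real 18 (by decide), f18]
    simp [hiv, f18']
    intro e he
    rcases eq_or_ne e i with rfl | hne
    · simp
    · rw [Function.update_of_ne hne]; exact hI e (by omega)
  rintro l ρ ⟨hFρ, hl, hI'⟩
  simp at hk hl
  refine ⟨by omega, fun e he => ?_, hI'⟩
  rw [hFρ.real 4 (by decide)]
  exact hI e he

/-! ### The oracle -/

/-- The memory after the preprocessing. The real variable `17` holds the divisor of the
amounts. -/
structure Ready (N : Network) (ε : ℝ) (j : ℕ) (σ : Mem) : Prop where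
  input : HasInput N ε σ
  numNodes : σ.nat 21 0 = N.nV + N.nV
  half : ∀ i < N.nV + N.nV + (N.nV + N.nV), σ.nat 14 i = i / 2
  src : ∀ g, 1 ≤ g → g ≤ N.nE + N.nE + N.nV → σ.nat 18 g = layerSrc N g
  tgt : ∀ g, 1 ≤ g → g ≤ N.nE + N.nE + N.nV → σ.nat 13 g = layerTgt N g
  first : ∀ x, σ.nat 11 x = lastEdge (layerSrc N) (N.nE + N.nE + N.nV) x
  next : ∀ g, 1 ≤ g → g ≤ N.nE + N.nE + N.nV →
    σ.nat 12 g = lastEdge (layerSrc N) (g - 1) (layerSrc N g)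
  divisor : σ.real 17 0 = j + 1

/-- The program does not assign to the arrays that the preprocessing has filled. -/
def Program.keepsReady (c : Program) : Bool :=
  c.keepsInput && !(c.writesNat 21 || c.writesNat 14 || c.writesNat 18 || c.writesNat 13 ||
    c.writesNat 11 || c.writesNat 12 || c.writesReal 17)

theorem Ready.frame {N : Network} {ε : ℝ} {j : ℕ} {c : Program} {σ τ : Mem} (h : Ready N ε j σ)
    (hF : Frame c σ τ) (hc : c.keepsReady = true) : Ready N ε j τ := by
  simp only [Program.keepsReady, Bool.and_eq_true, Bool.not_eq_true', Bool.or_eq_false_iff] at hc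
  obtain ⟨h0, ⟨⟨⟨⟨⟨h21, h14⟩, h18⟩, h13⟩, h11⟩, h12⟩, r17⟩ := hc
  constructor
  · exact h.input.frame hF h0
  · rw [hF.nat 21 h21]; exact h.numNodes
  · rw [hF.nat 14 h14]; exact h.half
  · rw [hF.nat 18 h18]; exact h.src
  · rw [hF.nat 13 h13]; exact h.tgt
  · rw [hF.nat 11 h11]; exact h.first
  · rw [hF.nat 12 h12]; exact h.next
  · rw [hF.real 17 r17]; exact h.divisor

theorem Idle.frame {M : ℕ} {c : Program} {σ τ : Mem} (h : Idle M σ) (hF : Frame c σ τ)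
    (h15 : c.writesNat 15 = false) (h16 : c.writesNat 16 = false) (h22 : c.writesNat 22 = false)
    (h7 : c.writesReal 7 = false) : Idle M τ := by
  constructor
  · rw [hF.nat 15 h15, hF.real 7 h7]; exact h.tree
  · rw [hF.nat 15 h15]; exact h.leaf
  · rw [hF.nat 16 h16, hF.nat 22 h22]; exact h.stamp

/-- Compute the lengths of the edges of the layered graph. -/
def setLengths : Program :=
  .seq (forLoop 27 numE
    (.seq (.setReal 6 (.add (nv 27) (.const 1)) (.div (.get 4 (nv 27)) (.get 1 (nv 27))))
      (.setReal 6 (.add (.add numE (nv 27)) (.const 1)) (.div (.get 4 (nv 27)) (.get 1 (nv 27))))))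
    (forLoop 27 numV (.setReal 6 (.add (.add (.add numE numE) (nv 27)) (.const 1))
      (.div (.get 5 (nv 27)) (.get 2 (nv 27)))))

/-- For a vertex without capacity the machine and `layerWt` both divide by zero with the same
result; that edge starts at the dummy node and is never relaxed. -/
theorem wp_setLengths {N : Network} {ε : ℝ} {σ : Mem} {w : Fin N.nE → ℝ} {q : Fin N.nV → ℝ}
    (h : HasInput N ε σ) (hw : ∀ e : Fin N.nE, σ.real 4 e = w e)
    (hq : ∀ v : Fin N.nV, σ.real 5 v = q v) :
    wp setLengths σ fun k τ => k ≤ 80 * (N.nV + N.nE) + 30 ∧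
      ∀ g, 1 ≤ g → g ≤ N.nE + N.nE + N.nV → τ.real 6 g = layerWt N w q g := by
  have hl := fun e => (layer_lower N w q e).2.2
  have hu := fun e => (layer_upper N w q e).2.2
  have hc := fun v => (layer_copy N w q v).2.2
  simp only [setLengths, wp_seq]
  refine wp_mono (wp_frame (wp_forLoop N.nE 40 (fun i τ => ∀ e : Fin N.nE, (e : ℕ) < i →
    τ.real 6 (e + 1) = w e / N.B e ∧ τ.real 6 (N.nE + e + 1) = w e / N.B e) (by decide)
    (fun i σ x h => by simpa using h) (fun τ hF => (h.frame hF (by decide)).nE)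
    (fun i τ hi hF hiv hI => ?_) (fun e he => by omega))) ?_
  · have hin := h.frame hF (by decide)
    have h1 := hin.B ⟨i, hi⟩
    have h2 := hw ⟨i, hi⟩
    have f4 : τ.real 4 = σ.real 4 := hF.real 4 (by decide)
    simp at h1 h2
    simp [hiv, hin.nE, h1, f4, h2]
    intro e he
    by_cases hei : (e : ℕ) = i
    · subst hei
      by_cases h0 : (e : ℕ) + 1 = N.nE + e + 1
      · rw [← h0]; simp
      · rw [Function.update_of_ne h0]; simp
    · have := hI e (by omega)
      rw [Function.update_of_ne (by omega), Function.update_of_ne (by omega),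
        Function.update_of_ne (by omega), Function.update_of_ne (by omega)]
      exact this
  rintro k τ ⟨hF, hk, hI⟩
  have hin := h.frame hF (by decide)
  have f5 : τ.real 5 = σ.real 5 := hF.real 5 (by decide)
  refine wp_mono (wp_frame (wp_forLoop N.nV 40 (fun i τ => (∀ e : Fin N.nE,
    τ.real 6 (e + 1) = w e / N.B e ∧ τ.real 6 (N.nE + e + 1) = w e / N.B e) ∧
    ∀ v : Fin N.nV, (v : ℕ) < i → τ.real 6 (N.nE + N.nE + v + 1) = q v / N.C v) (by decide)
    (fun i σ x h => by simpa using h) (fun τ hF => (hin.frame hF (by decide)).nV)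
    (fun i ρ hi hF hiv hI => ?_) ⟨fun e => hI e e.2, fun e he => by omega⟩)) ?_
  · have hin := hin.frame hF (by decide)
    have h1 := hin.C ⟨i, hi⟩
    have h2 := hq ⟨i, hi⟩
    have f5' : ρ.real 5 = σ.real 5 := by rw [hF.real 5 (by decide), f5]
    simp at h1 h2
    simp [hiv, hin.nE, h1, f5', h2]
    refine ⟨fun e => ?_, fun v hv => ?_⟩
    · rw [Function.update_of_ne (by omega), Function.update_of_ne (by omega)]
      exact hI.1 e
    · by_cases hvi : (v : ℕ) = i
      · subst hvi
        rw [Function.update_self]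
      · rw [Function.update_of_ne (by omega)]
        exact hI.2 v (by omega)
  rintro l ρ ⟨hFρ, hl', hI⟩
  simp at hk hl'
  refine ⟨by omega, fun g hg1 hg2 => ?_⟩
  rcases layer_cases hg1 hg2 with ⟨e, rfl⟩ | ⟨e, rfl⟩ | ⟨v, rfl⟩
  · rw [hl, (hI.1 e).1]
  · rw [hu, (hI.1 e).2]
  · rw [hc, hI.2 v v.2]

theorem Ready.loaded {N : Network} {ε : ℝ} {j : ℕ} {σ : Mem} {w : Fin N.nE → ℝ}
    {q : Fin N.nV → ℝ} (h : Ready N ε j σ)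
    (h6 : ∀ g, 1 ≤ g → g ≤ N.nE + N.nE + N.nV → σ.real 6 g = layerWt N w q g)
    (hw : ∀ e, 0 < w e) (hq : ∀ v, 0 < q v) (t : Fin N.nV) :
    Loaded (layerGraph N w q hw hq t) σ :=
  ⟨h.numNodes, h.half, fun x _ => h.first x, h.next, h.tgt, h6⟩

/-- The search for the pair `i`. -/
def searchPair (i : NExp) : Program :=
  .seq (.setNat 23 (.const 0) (.add (.get 4 i) numV)) dijkstra

theorem wp_searchPair {N : Network} {ε : ℝ} {j : ℕ} {σ : Mem} {w : Fin N.nE → ℝ}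
    {q : Fin N.nV → ℝ} (h : Ready N ε j σ)
    (h6 : ∀ g, 1 ≤ g → g ≤ N.nE + N.nE + N.nV → σ.real 6 g = layerWt N w q g)
    (hw : ∀ e, 0 < w e) (hq : ∀ v, 0 < q v) (hI : Idle (N.nV + N.nV) σ)
    {ie : NExp} {i : Fin N.nD} (hi : ie.eval σ = i) :
    wp (searchPair ie) σ fun k τ =>
      k ≤ (80 * height (4 * N.nV) + 130) * (6 * N.nE + 5) + ie.steps + 110 ∧
      Idle (N.nV + N.nV) τ ∧
      SearchInv (layerGraph N w q hw hq (N.dst i)) (τ.nat 22 0) (τ.nat 16) (τ.real 8) (τ.nat 17)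
        (fun _ => True) ∧
      (∀ x < N.nV + N.nV, τ.nat 16 x ≠ τ.nat 22 0) ∧ τ.nat 23 0 = N.dst i + N.nV := by
  have hd := h.input.dst i
  simp [searchPair, hi, hd, h.input.nV]
  have hF0 := (Exec.setNat σ 23 (.const 0) (.const (N.dst i + N.nV))).frame
  have hr := h.frame hF0 rfl
  refine wp_mono (wp_frame (wp_dijkstra (G := layerGraph N w q hw hq (N.dst i))
    (hr.loaded (by simpa using h6) hw hq _)
    (hI.frame hF0 rfl rfl rfl rfl) ?_)) ?_
  · simp [layerGraph]
  · rintro k τ ⟨hF, a1, a2, a3, a4⟩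
    have := layerGraph_cost_le N w q hw hq (N.dst i)
    have hM : (layerGraph N w q hw hq (N.dst i)).M + (layerGraph N w q hw hq (N.dst i)).M =
      4 * N.nV := by simp only [layerGraph]; omega
    rw [hM] at a1
    refine ⟨?_, a2, a3, a4, ?_⟩
    · have e1 : (80 * height (4 * N.nV) + 130) * (6 * N.nE + 5) =
        (80 * height (4 * N.nV) + 130) * (6 * N.nE + 4) + (80 * height (4 * N.nV) + 130) := by ring
      omega
    · rw [hF.nat 23 (by decide)]; simp

/-- Find a pair with a walk of minimum cost. The variable `32` holds the number of the pair plus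
`1`, or `0` if no pair has a walk with a vertex that can process. -/
def findPair : Program :=
  .seq (.setNat 32 (.const 0) (.const 0))
    (forLoop 29 numD
      (.seq (searchPair (nv 29))
        (.cond (.and (.natLt (nv 22) (.get 16 (.get 3 (nv 29))))
            (.or (.natEq (nv 32) (.const 0)) (.realLt (.get 8 (.get 3 (nv 29))) (rv 15))))
          (.seq (.setNat 32 (.const 0) (.add (nv 29) (.const 1)))
            (.setReal 15 (.const 0) (.get 8 (.get 3 (nv 29)))))
          .skip)))

/-- The outcome of `findPair`, restricted to the first `n` pairs: `b` is the number of the pair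
plus `1`, and `m` is the minimum cost. -/
def BestPair (N : Network) (w : Fin N.nE → ℝ) (q : Fin N.nV → ℝ) (n b : ℕ) (m : ℝ) : Prop :=
  (b = 0 ∧ ∀ i : Fin N.nD, (i : ℕ) < n → ∀ (π : TwoWalk N i) (v : Fin N.nV), v ∈ π.1 →
      ¬ 0 < N.C v) ∨
    ∃ i : Fin N.nD, b = i + 1 ∧
      (∃ (π : TwoWalk N i) (v : Fin N.nV), v ∈ π.1 ∧ 0 < N.C v ∧ cost N w q π.1 v = m) ∧
      ∀ i' : Fin N.nD, (i' : ℕ) < n → ∀ (π : TwoWalk N i') (v : Fin N.nV), v ∈ π.1 → 0 < N.C v →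
        m ≤ cost N w q π.1 v

theorem BestPair.replace {N : Network} {w : Fin N.nE → ℝ} {q : Fin N.nV → ℝ} {b : ℕ} {m m' : ℝ}
    {i : Fin N.nD} (h : BestPair N w q i b m) (hlt : b = 0 ∨ m' < m)
    (hex : ∃ (π : TwoWalk N i) (v : Fin N.nV), v ∈ π.1 ∧ 0 < N.C v ∧ cost N w q π.1 v = m')
    (hle : ∀ (π : TwoWalk N i) (v : Fin N.nV), v ∈ π.1 → 0 < N.C v → m' ≤ cost N w q π.1 v) :
    BestPair N w q (i + 1) (i + 1) m' := by
  refine Or.inr ⟨i, rfl, hex, fun i' hi' π v hv hC => ?_⟩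
  rcases Nat.lt_succ_iff_lt_or_eq.1 hi' with h1 | h1
  · rcases h with ⟨h2, h3⟩ | ⟨i₀, h2, h3, h4⟩
    · exact absurd hC (h3 i' h1 π v hv)
    · exact (hlt.resolve_left (by omega)).le.trans (h4 i' h1 π v hv hC)
  · obtain rfl : i' = i := Fin.ext h1
    exact hle π v hv hC

theorem BestPair.keep {N : Network} {w : Fin N.nE → ℝ} {q : Fin N.nV → ℝ} {b : ℕ} {m : ℝ}
    {i : Fin N.nD} (h : BestPair N w q i b m)
    (hle : ∀ (π : TwoWalk N i) (v : Fin N.nV), v ∈ π.1 → 0 < N.C v →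
      b ≠ 0 ∧ m ≤ cost N w q π.1 v) :
    BestPair N w q (i + 1) b m := by
  rcases h with ⟨h2, h3⟩ | ⟨i₀, h2, h3, h4⟩
  · refine Or.inl ⟨h2, fun i' hi' π v hv hC => ?_⟩
    rcases Nat.lt_succ_iff_lt_or_eq.1 hi' with h1 | h1
    · exact h3 i' h1 π v hv hC
    · obtain rfl : i' = i := Fin.ext h1
      exact (hle π v hv hC).1 h2
  · refine Or.inr ⟨i₀, h2, h3, fun i' hi' π v hv hC => ?_⟩
    rcases Nat.lt_succ_iff_lt_or_eq.1 hi' with h1 | h1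
    · exact h4 i' h1 π v hv hC
    · obtain rfl : i' = i := Fin.ext h1
      exact (hle π v hv hC).2

/-- A bound for the number of steps of one search. -/
def searchCost (N : Network) : ℕ := (80 * height (4 * N.nV) + 130) * (6 * N.nE + 5) + 120

theorem wp_findPair {N : Network} {ε : ℝ} {j : ℕ} {σ : Mem} {w : Fin N.nE → ℝ}
    {q : Fin N.nV → ℝ} (h : Ready N ε j σ)
    (h6 : ∀ g, 1 ≤ g → g ≤ N.nE + N.nE + N.nV → σ.real 6 g = layerWt N w q g)
    (hw : ∀ e, 0 < w e) (hq : ∀ v, 0 < q v) (hI : Idle (N.nV + N.nV) σ) :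
    wp findPair σ fun k τ => k ≤ N.nD * (searchCost N + 60) + 20 ∧ Idle (N.nV + N.nV) τ ∧
      BestPair N w q N.nD (τ.nat 32 0) (τ.real 15 0) := by
  simp only [findPair, wp_seq, wp_setNat]
  have hF0 := (Exec.setNat σ 32 (.const 0) (.const 0)).frame
  have hr := h.frame hF0 (by decide)
  have hI0 := hI.frame hF0 (by decide) (by decide) (by decide) (by decide)
  refine wp_mono (wp_forLoop N.nD (searchCost N + 48) (fun i τ => Idle (N.nV + N.nV) τ ∧
    BestPair N w q i (τ.nat 32 0) (τ.real 15 0)) (by decide)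
    (fun i σ x h => ⟨⟨by simpa using h.1.tree, by simpa using h.1.leaf, by simpa using h.1.stamp⟩,
      by simpa using h.2⟩)
    (fun τ hF => (hr.input.frame hF (by decide)).nD)
    (fun i τ hi hF hiv hI => ?_) ⟨hI0, Or.inl ⟨by simp, fun i hi => by omega⟩⟩) ?_
  · have hrτ := hr.frame hF (by decide)
    have h6' : ∀ g, 1 ≤ g → g ≤ N.nE + N.nE + N.nV → τ.real 6 g = layerWt N w q g := by
      rw [hF.real 6 (by decide)]; exact h6
    rw [wp_seq]
    refine wp_mono (wp_frame (wp_searchPair hrτ h6' hw hq hI.1 (i := ⟨i, hi⟩) ?_)) ?_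
    · simp [hiv]
    rintro k ρ ⟨hFρ, a1, a2, a3, a4, -⟩
    have f29 : ρ.nat 29 0 = i := by rw [hFρ.nat 29 (by decide), hiv]
    have f3 : ρ.nat 3 i = N.src ⟨i, hi⟩ :=
      (hrτ.input.frame hFρ (by decide)).src ⟨i, hi⟩
    have f32 : ρ.nat 32 0 = τ.nat 32 0 := by rw [hFρ.nat 32 (by decide)]
    have f15 : ρ.real 15 0 = τ.real 15 0 := by rw [hFρ.real 15 (by decide)]
    have hmin := search_min a3 a4
    have hwalk := search_walk a3
    have hx : (N.src ⟨i, hi⟩ : ℕ) < N.nV + N.nV := by omega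
    -- No node is open after the search, so the strict test of the stamp recognises exactly the
    -- sources that have been reached.
    have hne := a4 _ hx
    simp [f29, f3, f32, f15]
    simp at a1
    split_ifs with hc
    · refine ⟨by simp [searchCost]; omega, ⟨by simpa using a2.tree, by simpa using a2.leaf,
        by simpa using a2.stamp⟩, ?_⟩
      obtain ⟨π, v, b1, b2, b3, -⟩ := hwalk hc.1.le
      exact BestPair.replace (i := ⟨i, hi⟩) hI.2 hc.2 ⟨π, v, b1, b2, b3⟩
        fun π v hv hC => (hmin π v hv hC).2
    · refine ⟨by simp [searchCost]; omega, a2, ?_⟩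
      refine BestPair.keep (i := ⟨i, hi⟩) hI.2 fun π v hv hC => ?_
      obtain ⟨b1, b2⟩ := hmin π v hv hC
      rw [not_and, not_or, not_lt] at hc
      obtain ⟨c1, c2⟩ := hc (by omega)
      exact ⟨c1, c2.trans b2⟩
  · rintro k τ ⟨h1, h2⟩
    have : searchCost N + 48 + numD.steps + 10 = searchCost N + 60 := by simp
    rw [this] at h1
    simp at h1 ⊢
    exact ⟨by omega, h2⟩

/-! ### Writing down the walk -/

/-- The part `pre` of the walk `π` has been written to the array `verts` from the entry `pos₀` on,
the part `rest` is still to be written, and `mu` counts the edges of `pre` (with the edge to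
`rest`). -/
structure Traced (N : Network) (π : List (Fin N.nV)) (pos₀ : ℕ) (old : ℕ → ℕ)
    (pre rest : List (Fin N.nV)) (verts : ℕ → ℕ) (pos : ℕ) (mu : ℕ → ℝ) : Prop where
  eq : π = pre ++ rest
  written : ∀ (k : ℕ) (hk : k < pre.length), verts (pos₀ + k) = pre[k]
  keep : ∀ p < pos₀, verts p = old p
  pos_eq : pos = pos₀ + pre.length
  count : ∀ e : Fin N.nE, mu e + mult N e rest = mult N e π

/-- The condition `hmu` is stated abstractly to serve two cases: a vertex followed by an edge, which
is counted, and the last vertex, where the counters stay the same. -/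
theorem Traced.write {N : Network} {π : List (Fin N.nV)} {pos₀ : ℕ} {old : ℕ → ℕ}
    {pre rest : List (Fin N.nV)} {a : Fin N.nV} {verts : ℕ → ℕ} {pos : ℕ} {mu mu' : ℕ → ℝ}
    (h : Traced N π pos₀ old pre (a :: rest) verts pos mu)
    (hmu : ∀ e : Fin N.nE, mu' e + mult N e rest = mu e + mult N e (a :: rest)) :
    Traced N π pos₀ old (pre ++ [a]) rest (Function.update verts pos a) (pos + 1) mu' := by
  have hpos := h.pos_eq
  refine ⟨by simpa using h.eq, fun k hk => ?_, fun p hp => ?_, by simp [hpos]; omega,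
    fun e => (hmu e).trans (h.count e)⟩
  · rcases Nat.lt_or_ge k pre.length with hlt | hge
    · rw [Function.update_of_ne (by omega), List.getElem_append_left hlt]
      exact h.written k hlt
    · have hk' : k = pre.length := by simp at hk; omega
      subst hk'
      simp [hpos]
  · rw [Function.update_of_ne (by omega)]
    exact h.keep p hp

theorem Traced.step {N : Network} {π : List (Fin N.nV)} {pos₀ : ℕ} {old : ℕ → ℕ}
    {pre rest : List (Fin N.nV)} {a b : Fin N.nV} {verts : ℕ → ℕ} {pos : ℕ} {mu : ℕ → ℝ}
    (h : Traced N π pos₀ old pre (a :: b :: rest) verts pos mu) {e : Fin N.nE}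
    (he : N.edge e = (a, b)) :
    Traced N π pos₀ old (pre ++ [a]) (b :: rest) (Function.update verts pos a) (pos + 1)
      (Function.update mu e (mu e + 1)) := by
  refine h.write fun e' => ?_
  rw [mult_cons_cons]
  by_cases hee : e' = e
  · subst hee
    rw [Function.update_self, if_pos he]
    push_cast
    ring
  · have h1 : (e' : ℕ) ≠ e := fun h => hee (Fin.ext h)
    have h2 : N.edge e' ≠ (a, b) := fun h => hee (N.edge_injective (h.trans he.symm))
    rw [Function.update_of_ne h1, if_neg h2, add_zero]

/-- Follow the parent edges from the node in the variable `35`, while `b` holds; the edges are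
counted with the offset `off`. -/
def follow (b : BExp) (off sh : NExp) : Program :=
  .loop b
    (.seq (.setNat 10 (nv 34) (.sub (nv 35) sh))
      (.seq (.setReal 9 (.sub (.get 17 (nv 35)) off)
          (.add (.get 9 (.sub (.get 17 (nv 35)) off)) (.const 1)))
        (.seq (.setNat 35 (.const 0) (.get 18 (.get 17 (nv 35))))
          (.setNat 34 (.const 0) (.add (nv 34) (.const 1))))))

/-- Along the lower layer the parent edges have numbers at most 2|E|; a greater number belongs to an
edge between the layers and marks the processing vertex. -/
def followLower : Program :=
  follow (.natLt (.get 17 (nv 35)) (.add (.add numE numE) (.const 1))) (.const 1) (.const 0)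

theorem wp_followLower {N : Network} {ε : ℝ} {j : ℕ} {σ : Mem} (h : Ready N ε j σ)
    {t v : Fin N.nV} {π : List (Fin N.nV)} {pos₀ : ℕ} {old : ℕ → ℕ} {a : Fin N.nV}
    {l : List (Fin N.nV)} (hπ : π = a :: l) (hp : LowPath N (σ.nat 17) t v π)
    (hcur : σ.nat 35 0 = a)
    (ht : Traced N π pos₀ old [] π (σ.nat 10) (σ.nat 34 0) (σ.real 9)) :
    wp followLower σ fun k τ => k ≤ 50 * π.length + 20 ∧ τ.nat 35 0 = v ∧
      ∃ pre l, UpPath N (σ.nat 17) t (v :: l) ∧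
        Traced N π pos₀ old pre (v :: l) (τ.nat 10) (τ.nat 34 0) (τ.real 9) := by
  refine wp_mono (wp_loop (fun r τ => ∃ (pre : List (Fin N.nV)) (a : Fin N.nV) (l : List (Fin N.nV)), τ.nat 35 0 = (a : ℕ) ∧
      LowPath N (σ.nat 17) t v (a :: l) ∧
      Traced N π pos₀ old pre (a :: l) (τ.nat 10) (τ.nat 34 0) (τ.real 9) ∧
      r = 50 * (a :: l).length + 20)
    (Q := fun τ => τ.nat 35 0 = v ∧ ∃ pre l, UpPath N (σ.nat 17) t (v :: l) ∧
      Traced N π pos₀ old pre (v :: l) (τ.nat 10) (τ.nat 34 0) (τ.real 9)) ?_ ?_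
    ⟨[], a, l, hcur, hπ ▸ hp, hπ ▸ ht, rfl⟩) fun k τ hk => ⟨by rw [hπ]; exact hk.1, hk.2⟩
  · rintro r τ hF ⟨pre, a, l, h1, h2, h3, rfl⟩ hb
    have hr := h.frame hF (by decide)
    have f17 : τ.nat 17 = σ.nat 17 := hF.nat 17 (by decide)
    simp [h1, f17, hr.input.nE] at hb
    cases l with
    | nil =>
      obtain ⟨rfl, h4, -⟩ := h2
      omega
    | cons b l =>
      rcases h2 with ⟨-, h4, -⟩ | ⟨⟨e, he, h4⟩, h5⟩
      · omega
      · have h18 : τ.nat 18 (e + 1) = b := by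
          rw [hr.src _ (by omega) (by omega), (layer_lower N (fun _ => 1) (fun _ => 1) e).1, he]
        simp [h1, f17, h4, h18]
        intro _
        refine ⟨pre ++ [a], b, l, ⟨rfl, h5, by simpa using h3.step he⟩, by omega⟩
  · rintro r τ hF ⟨pre, a, l, h1, h2, h3, rfl⟩ hb
    have hr := h.frame hF (by decide)
    have f17 : τ.nat 17 = σ.nat 17 := hF.nat 17 (by decide)
    simp [h1, f17, hr.input.nE] at hb
    have key : a = v ∧ UpPath N (σ.nat 17) t (a :: l) := by
      cases l with
      | nil => exact ⟨h2.1, h2.2.2⟩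
      | cons b l =>
        rcases h2 with ⟨h4, -, h5⟩ | ⟨⟨e, he, h4⟩, h5⟩
        · exact ⟨h4, h5⟩
        · omega
    obtain ⟨rfl, h4⟩ := key
    exact ⟨by simp, h1, pre, l, h4, h3⟩

/-- The root of the search is the destination in the upper layer. It has no parent edge, so the loop
must test for the node itself. -/
def followUpper : Program :=
  follow (.not (.natEq (nv 35) (nv 23))) (.add numE (.const 1)) numV

theorem wp_followUpper {N : Network} {ε : ℝ} {j : ℕ} {σ : Mem} (h : Ready N ε j σ)
    {t v : Fin N.nV} {π : List (Fin N.nV)} {pos₀ : ℕ} {old : ℕ → ℕ}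
    {pre l : List (Fin N.nV)} (hp : UpPath N (σ.nat 17) t (v :: l))
    (hcur : σ.nat 35 0 = v + N.nV) (hroot : σ.nat 23 0 = t + N.nV)
    (ht : Traced N π pos₀ old pre (v :: l) (σ.nat 10) (σ.nat 34 0) (σ.real 9)) :
    wp followUpper σ fun k τ => k ≤ 50 * π.length + 20 ∧ τ.nat 35 0 = t + N.nV ∧
      ∃ pre, Traced N π pos₀ old pre [t] (τ.nat 10) (τ.nat 34 0) (τ.real 9) := by
  refine wp_mono (wp_loop (fun r τ => ∃ (pre : List (Fin N.nV)) (a : Fin N.nV) (l : List (Fin N.nV)), τ.nat 35 0 = (a : ℕ) + N.nV ∧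
      UpPath N (σ.nat 17) t (a :: l) ∧
      Traced N π pos₀ old pre (a :: l) (τ.nat 10) (τ.nat 34 0) (τ.real 9) ∧
      r = 50 * (a :: l).length + 20)
    (Q := fun τ => τ.nat 35 0 = t + N.nV ∧ ∃ pre,
      Traced N π pos₀ old pre [t] (τ.nat 10) (τ.nat 34 0) (τ.real 9)) ?_ ?_
    ⟨pre, v, l, hcur, hp, ht, rfl⟩) fun k τ hk => ⟨hk.1.trans ?_, hk.2⟩
  · rintro r τ hF ⟨pre, a, l, h1, h2, h3, rfl⟩ hb
    have hr := h.frame hF (by decide)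
    have f17 : τ.nat 17 = σ.nat 17 := hF.nat 17 (by decide)
    have f23 : τ.nat 23 = σ.nat 23 := hF.nat 23 (by decide)
    simp [h1, f23, hroot] at hb
    cases l with
    | nil => exact absurd (congrArg Fin.val h2) hb
    | cons b l =>
      obtain ⟨-, ⟨e, he, h4⟩, h5⟩ := h2
      have h18 : τ.nat 18 (N.nE + e + 1) = b + N.nV := by
        rw [hr.src _ (by omega) (by omega), (layer_upper N (fun _ => 1) (fun _ => 1) e).1, he]
      have hoff : N.nE + (e : ℕ) + 1 - (N.nE + 1) = e := by omega
      simp [h1, f17, h4, h18, hr.input.nE, hr.input.nV]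
      intro _
      refine ⟨pre ++ [a], b, l, ⟨rfl, h5, by simpa [hoff] using h3.step he⟩, by omega⟩
  · rintro r τ hF ⟨pre, a, l, h1, h2, h3, rfl⟩ hb
    have f23 : τ.nat 23 = σ.nat 23 := hF.nat 23 (by decide)
    simp [h1, f23, hroot] at hb
    cases l with
    | nil =>
      obtain rfl : a = t := Fin.ext hb
      exact ⟨by simp, h1, pre, h3⟩
    | cons b l => exact absurd (Fin.ext hb) h2.1
  · rw [ht.eq, List.length_append]
    simp

/-- Write down the walk for the pair in the variable `32` (minus `1`), after its search. -/
def traceWalk : Program :=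
  .seq (forLoop 27 numE (.setReal 9 (nv 27) (.const 0)))
    (.seq (.setNat 6 (nv 5) (.sub (nv 32) (.const 1)))
      (.seq (.setNat 9 (nv 5) (nv 34))
        (.seq (.setNat 35 (.const 0) (.get 3 (.sub (nv 32) (.const 1))))
          (.seq followLower
            (.seq (.setNat 7 (nv 5) (nv 35))
              (.seq (.setNat 35 (.const 0) (.add (nv 35) numV))
                (.seq followUpper
                  (.seq (.setNat 10 (nv 34) (.sub (nv 35) numV))
                    (.seq (.setNat 34 (.const 0) (.add (nv 34) (.const 1)))
                      (.setNat 8 (nv 5) (.sub (nv 34) (.get 9 (nv 5)))))))))))))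

theorem twoWalk_length_le {N : Network} {s t : Fin N.nV} {π : List (Fin N.nV)}
    (h : IsTwoWalk N s t π) : π.length ≤ 2 * N.nV := by
  have h1 : ∑ v : Fin N.nV, π.count v = π.length := by
    simpa using Multiset.sum_count_eq_card (s := Finset.univ)
      (m := (π : Multiset (Fin N.nV))) (by simp)
  have h2 : ∑ v : Fin N.nV, π.count v ≤ ∑ _v : Fin N.nV, 2 :=
    Finset.sum_le_sum fun v _ => h.2.2.2 v
  simp only [Finset.sum_const, Finset.card_univ, Fintype.card_fin, smul_eq_mul] at h2
  omega

theorem wp_traceWalk {N : Network} {ε : ℝ} {j : ℕ} {σ : Mem} (h : Ready N ε j σ)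
    {i : Fin N.nD} {π : TwoWalk N i} {v : Fin N.nV} {n : ℕ} (hn : σ.nat 5 0 = n)
    (h32 : σ.nat 32 0 = i + 1) (hroot : σ.nat 23 0 = N.dst i + N.nV)
    (hp : LowPath N (σ.nat 17) (N.dst i) v π.1) :
    wp traceWalk σ fun k τ => k ≤ 20 * N.nE + 200 * N.nV + 200 ∧
      τ.nat 6 = Function.update (σ.nat 6) n i ∧ τ.nat 7 = Function.update (σ.nat 7) n v ∧
      τ.nat 8 = Function.update (σ.nat 8) n π.1.length ∧
      τ.nat 9 = Function.update (σ.nat 9) n (σ.nat 34 0) ∧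
      (∀ (k : ℕ) (hk : k < π.1.length), τ.nat 10 (σ.nat 34 0 + k) = (π.1[k]).val) ∧
      (∀ p < σ.nat 34 0, τ.nat 10 p = σ.nat 10 p) ∧
      τ.nat 34 0 = σ.nat 34 0 + π.1.length ∧
      ∀ e : Fin N.nE, τ.real 9 e = mult N e π.1 := by
  have hlen := twoWalk_length_le π.2
  have hhead := π.2.1
  obtain ⟨π, hπ⟩ := π
  simp only at hlen hhead hp ⊢
  obtain ⟨l, hl⟩ : ∃ l, π = N.src i :: l := by
    cases π with
    | nil => simp at hhead
    | cons a l => exact ⟨l, by simpa using hhead⟩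
  rw [traceWalk, wp_seq]
  refine wp_mono (wp_frame (wp_forLoop N.nE 6 (fun i τ => ∀ e < i, τ.real 9 e = 0) (by decide)
    (fun i σ x h => by simpa using h) (fun τ hF => (h.input.frame hF (by decide)).nE)
    (fun i τ hi hF hiv hI => ?_) (by simp))) ?_
  · simp [hiv]
    intro e he
    rcases eq_or_ne e i with rfl | hne
    · simp
    · rw [Function.update_of_ne hne]; exact hI e (by omega)
  rintro k₁ τ ⟨hF, hk₁, hmu⟩
  have hr := h.frame hF (by decide)
  have f5 : τ.nat 5 0 = n := by rw [hF.nat 5 (by decide), hn]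
  have f6 := hF.nat 6 (by decide)
  have f7 := hF.nat 7 (by decide)
  have f8 := hF.nat 8 (by decide)
  have f9 := hF.nat 9 (by decide)
  have f10 := hF.nat 10 (by decide)
  have f17 := hF.nat 17 (by decide)
  have f23 := hF.nat 23 (by decide)
  have f32 := hF.nat 32 (by decide)
  have f34 := hF.nat 34 (by decide)
  have hs := hr.input.src i
  simp [f5, f32, h32, hs]
  refine wp_mono (wp_frame (wp_followLower (N := N) (ε := ε) (j := j) (t := N.dst i) (v := v) (π := π)
    (pos₀ := σ.nat 34 0) (old := σ.nat 10) ?_ hl ?_ ?_ ?_)) ?_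
  · have := ((hr.frame (Exec.setNat τ 6 (.const n) (.const i)).frame rfl).frame
      (Exec.setNat _ 9 (.const n) (nv 34)).frame rfl).frame
      (Exec.setNat _ 35 (.const 0) (.const (N.src i))).frame rfl
    simpa using this
  · simpa [f17] using hp
  · simp
  · refine ⟨rfl, by simp, by simp [f10], by simp [f34], fun e => ?_⟩
    simp [hmu e e.2]
  rintro k₂ ρ ⟨hFρ, hk₂, hcur, pre, l', hup, htr⟩
  have g5 := hFρ.nat 5 (by decide)
  have g6 := hFρ.nat 6 (by decide)
  have g7 := hFρ.nat 7 (by decide)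
  have g8 := hFρ.nat 8 (by decide)
  have g9 := hFρ.nat 9 (by decide)
  have g17 := hFρ.nat 17 (by decide)
  have g23 := hFρ.nat 23 (by decide)
  simp at g5 g6 g7 g8 g9 g17 g23 hup
  have hrρ : Ready N ε j ρ := by
    have := ((hr.frame (Exec.setNat τ 6 (.const n) (.const i)).frame rfl).frame
      (Exec.setNat _ 9 (.const n) (nv 34)).frame rfl).frame
      (Exec.setNat _ 35 (.const 0) (.const (N.src i))).frame rfl
    simp at this
    exact this.frame hFρ (by decide)
  simp [hcur, g5, f5, hrρ.input.nV]
  refine wp_mono (wp_frame (wp_followUpper (N := N) (ε := ε) (j := j) (t := N.dst i) (v := v) (π := π)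
    (pos₀ := σ.nat 34 0) (old := σ.nat 10) (pre := pre) (l := l') ?_ ?_ ?_ ?_ ?_)) ?_
  · have := (hrρ.frame (Exec.setNat ρ 7 (.const n) (.const v)).frame rfl).frame
      (Exec.setNat _ 35 (.const 0) (.const (v + N.nV))).frame rfl
    simpa using this
  · simpa [g17] using hup
  · simp
  · simp [g23, f23, hroot]
  · simpa using htr
  rintro k₃ μ ⟨hFμ, hk₃, hcur', pre', htr'⟩
  have e5 := hFμ.nat 5 (by decide)
  have e6 := hFμ.nat 6 (by decide)
  have e7 := hFμ.nat 7 (by decide)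
  have e8 := hFμ.nat 8 (by decide)
  have e9 := hFμ.nat 9 (by decide)
  simp [g5, g6, f6, g7, f7, g8, f8, g9, f9, f34] at e5 e6 e7 e8 e9
  have hrμ : Ready N ε j μ := by
    have := (hrρ.frame (Exec.setNat ρ 7 (.const n) (.const v)).frame rfl).frame
      (Exec.setNat _ 35 (.const 0) (.const (v + N.nV))).frame rfl
    simp at this
    exact this.frame hFμ (by decide)
  -- The destination is written after the loops; no edge of the walk leaves it, so the counters are
  -- final.
  have hfin := htr'.write (mu' := μ.real 9) (fun e => by rw [mult_singleton]; simp [mult])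
  have hpre : π = pre' ++ [N.dst i] := by simpa using hfin.eq
  have hwr := hfin.written
  have hpos := hfin.pos_eq
  rw [← hpre] at hpos
  simp only [← hpre] at hwr
  simp [e5, f5, e6, e7, e8, e9, hcur', hrμ.input.nV, hpos]
  simp at hk₁
  refine ⟨by omega, hwr, hfin.keep, fun e => ?_⟩
  simpa [mult] using hfin.count e

/-! ### The amount of a round -/

/-- The largest amount for the walk that is counted in the real array `9` and the processing vertex
of the current round. -/
def computeAmount : Program :=
  .seq (.setReal 19 (.const 0) (.get 2 (.get 7 (nv 5))))
    (.seq
      (forLoop 27 numE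
        (.cond (.and (.realLt (.const 0) (.get 9 (nv 27)))
            (.realLt (.div (.get 1 (nv 27)) (.get 9 (nv 27))) (rv 19)))
          (.setReal 19 (.const 0) (.div (.get 1 (nv 27)) (.get 9 (nv 27))))
          .skip))
      (.setReal 3 (nv 5) (rv 19)))

/-- The amount is the minimum of C(v) and of the quotients of B(e) by the multiplicity of e on the
walk. The invariant carries a witness that the current value is attained by one of these
constraints, which yields maximality at the end. -/
theorem wp_computeAmount {N : Network} {ε : ℝ} {σ : Mem} (h : HasInput N ε σ) {n : ℕ}
    (hn : σ.nat 5 0 = n) {v : Fin N.nV} (hv : σ.nat 7 n = v) {m : Fin N.nE → ℕ}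
    (hm : ∀ e : Fin N.nE, σ.real 9 e = m e) :
    wp computeAmount σ fun k τ => k ≤ 50 * N.nE + 40 ∧ ∃ f,
      IsGreatest {f : ℝ | f ≤ N.C v ∧ ∀ e, (m e : ℝ) * f ≤ N.B e} f ∧ τ.real 19 0 = f ∧
      τ.real 3 = Function.update (σ.real 3) n f := by
  have hC := h.C v
  simp only [computeAmount, wp_seq, wp_setReal]
  have hF0 := (Exec.setReal σ 19 (.const 0) (.get 2 (.get 7 (nv 5)))).frame
  have h0 := h.frame hF0 rfl
  refine wp_mono (wp_frame (wp_forLoop N.nE 30 (fun i τ => ∃ f, τ.real 19 0 = f ∧ f ≤ N.C v ∧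
    (∀ e : Fin N.nE, (e : ℕ) < i → (m e : ℝ) * f ≤ N.B e) ∧
    (f = N.C v ∨ ∃ e, 0 < m e ∧ (m e : ℝ) * f = N.B e)) (by decide)
    (fun i σ x h => by simpa using h) (fun τ hF => (h0.frame hF (by decide)).nE)
    (fun i τ hi hF hiv hI => ?_)
    ⟨N.C v, by simp [hn, hv, hC], le_rfl, fun e he => by omega, Or.inl rfl⟩)) ?_
  · have hB := (h0.frame hF (by decide)).B ⟨i, hi⟩
    have hmi := hm ⟨i, hi⟩
    have f9 : τ.real 9 = σ.real 9 := by rw [hF.real 9 (by decide), hF0.real 9 rfl]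
    obtain ⟨f, h1, h2, h3, h4⟩ := hI
    simp at hB hmi
    simp [hiv, f9, hB, hmi, h1]
    split_ifs with hc
    · obtain ⟨c1, c2⟩ := hc
      have c1' : (0 : ℝ) < m ⟨i, hi⟩ := by exact_mod_cast c1
      refine ⟨c2.le.trans h2, fun e he => ?_, Or.inr ⟨⟨i, hi⟩, c1, by field_simp⟩⟩
      by_cases hei : (e : ℕ) = i
      · obtain rfl : e = ⟨i, hi⟩ := Fin.ext hei
        exact (by field_simp : (m ⟨i, hi⟩ : ℝ) * (N.B ⟨i, hi⟩ / m ⟨i, hi⟩) = N.B ⟨i, hi⟩).le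
      · exact (mul_le_mul_of_nonneg_left c2.le (Nat.cast_nonneg _)).trans (h3 e (by omega))
    · refine ⟨h2, fun e he => ?_, h4⟩
      by_cases hei : (e : ℕ) = i
      · obtain rfl : e = ⟨i, hi⟩ := Fin.ext hei
        rcases Nat.eq_zero_or_pos (m ⟨i, hi⟩) with h0 | h0
        · simpa [h0] using (N.B_pos ⟨i, hi⟩).le
        · have c1' : (0 : ℝ) < m ⟨i, hi⟩ := by exact_mod_cast h0
          rw [not_and, not_lt] at hc
          have := (le_div_iff₀ c1').1 (hc h0)
          linarith
      · exact h3 e (by omega)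
  rintro k τ ⟨hF, hk, f, h1, h2, h3, h4⟩
  have f5 : τ.nat 5 0 = n := by rw [hF.nat 5 (by decide), hF0.nat 5 rfl, hn]
  have f3 : τ.real 3 = σ.real 3 := by rw [hF.real 3 (by decide), hF0.real 3 rfl]
  simp at hk
  simp [f5, f3, h1]
  refine ⟨by omega, ⟨h2, fun e => h3 e e.2⟩, fun x hx => ?_⟩
  rcases h4 with rfl | ⟨e, h5, h6⟩
  · exact hx.1
  · have c1' : (0 : ℝ) < m e := by exact_mod_cast h5
    exact le_of_mul_le_mul_left (h6 ▸ hx.2 e) c1'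

/-! ### The main loop -/

/-- Update the weights after a round, and clear the flag `33` if some weight is at least `1`. -/
def updateWeights : Program :=
  .seq
    (forLoop 27 numE
      (.seq
        (.setReal 4 (nv 27) (.mul (.get 4 (nv 27)) (.add (.const 1)
          (.mul (rv 0) (.div (.mul (.get 9 (nv 27)) (rv 19)) (.get 1 (nv 27)))))))
        (.cond (.realLt (.get 4 (nv 27)) (.const 1)) .skip
          (.setNat 33 (.const 0) (.const 0)))))
    (.seq
      (.setReal 5 (.get 7 (nv 5)) (.mul (.get 5 (.get 7 (nv 5))) (.add (.const 1)
        (.mul (rv 0) (.div (rv 19) (.get 2 (.get 7 (nv 5))))))))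
      (.seq
        (.cond (.realLt (.get 5 (.get 7 (nv 5))) (.const 1)) .skip
          (.setNat 33 (.const 0) (.const 0)))
        (.setNat 5 (.const 0) (.add (nv 5) (.const 1)))))

/-- Among the vertices only the processing vertex changes its weight, and by `hq1` all others remain
below 1; testing that single vertex is enough. -/
theorem wp_updateWeights {N : Network} {ε : ℝ} {σ : Mem} (h : HasInput N ε σ) {n : ℕ}
    (hn : σ.nat 5 0 = n) {v : Fin N.nV} (hv : σ.nat 7 n = v) {m : Fin N.nE → ℕ} {f : ℝ}
    (hm : ∀ e : Fin N.nE, σ.real 9 e = m e) (hf : σ.real 19 0 = f) (h33 : σ.nat 33 0 = 1)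
    {w w' : Fin N.nE → ℝ} {q q' : Fin N.nV → ℝ} (hw : ∀ e : Fin N.nE, σ.real 4 e = w e)
    (hq : ∀ u : Fin N.nV, σ.real 5 u = q u) (hq1 : ∀ u, q u < 1)
    (hw' : ∀ e, w' e = w e * (1 + ε * (m e * f / N.B e)))
    (hq' : ∀ u, q' u = q u * (1 + ε * if v = u then f / N.C u else 0)) :
    wp updateWeights σ fun k τ => k ≤ 60 * N.nE + 100 ∧
      (∀ e : Fin N.nE, τ.real 4 e = w' e) ∧ (∀ u : Fin N.nV, τ.real 5 u = q' u) ∧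
      τ.nat 5 0 = n + 1 ∧
      ((τ.nat 33 0 = 1 ∧ (∀ e, w' e < 1) ∧ ∀ u, q' u < 1) ∨
        (τ.nat 33 0 = 0 ∧ ((∃ e, 1 ≤ w' e) ∨ ∃ u, 1 ≤ q' u))) := by
  rw [updateWeights, wp_seq]
  refine wp_mono (wp_frame (wp_forLoop N.nE 40 (fun i τ =>
    (∀ e : Fin N.nE, (e : ℕ) < i → τ.real 4 e = w' e) ∧
    (∀ e : Fin N.nE, i ≤ (e : ℕ) → τ.real 4 e = w e) ∧
    ((τ.nat 33 0 = 1 ∧ ∀ e : Fin N.nE, (e : ℕ) < i → w' e < 1) ∨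
      (τ.nat 33 0 = 0 ∧ ∃ e, 1 ≤ w' e))) (by decide)
    (fun i σ x h => by simpa using h) (fun τ hF => (h.frame hF (by decide)).nE)
    (fun i τ hi hF hiv hI => ?_)
    ⟨fun e he => by omega, fun e _ => hw e, Or.inl ⟨h33, fun e he => by omega⟩⟩)) ?_
  · have hin := h.frame hF (by decide)
    have hB := hin.B ⟨i, hi⟩
    have hmi := hm ⟨i, hi⟩
    have f9 : τ.real 9 = σ.real 9 := by rw [hF.real 9 (by decide)]
    have f19 : τ.real 19 = σ.real 19 := by rw [hF.real 19 (by decide)]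
    obtain ⟨h1, h2, h3⟩ := hI
    have h4 := h2 ⟨i, hi⟩ le_rfl
    have hwi := hw' ⟨i, hi⟩
    simp at hB hmi h4
    simp [hiv, f9, f19, hB, hmi, hf, h4, hin.eps, ← hwi]
    have key : (∀ e : Fin N.nE, (e : ℕ) ≤ i → Function.update (τ.real 4) i (w' ⟨i, hi⟩) e = w' e) ∧
        (∀ e : Fin N.nE, i + 1 ≤ (e : ℕ) →
          Function.update (τ.real 4) i (w' ⟨i, hi⟩) e = w e) := by
      refine ⟨fun e he => ?_, fun e he => ?_⟩
      · by_cases hei : (e : ℕ) = i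
        · obtain rfl : e = ⟨i, hi⟩ := Fin.ext hei
          simp
        · rw [Function.update_of_ne hei]; exact h1 e (by omega)
      · rw [Function.update_of_ne (by omega)]; exact h2 e (by omega)
    split_ifs with hc
    · refine ⟨key.1, key.2, ?_⟩
      rcases h3 with ⟨h5, h6⟩ | h5
      · refine Or.inl ⟨h5, fun e he => ?_⟩
        by_cases hei : (e : ℕ) = i
        · obtain rfl : e = ⟨i, hi⟩ := Fin.ext hei
          exact hc
        · exact h6 e (by omega)
      · exact Or.inr h5
    · exact ⟨key.1, key.2, ⟨i, hi⟩, not_lt.1 hc⟩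
  rintro k τ ⟨hF, hk, hI1, -, hI2⟩
  have hin := h.frame hF (by decide)
  have f5 : τ.nat 5 0 = n := by rw [hF.nat 5 (by decide), hn]
  have f7 : τ.nat 7 n = v := by rw [hF.nat 7 (by decide), hv]
  have f19 : τ.real 19 = σ.real 19 := by rw [hF.real 19 (by decide)]
  have g5 : τ.real 5 = σ.real 5 := by rw [hF.real 5 (by decide)]
  have hqv := hq' v
  rw [if_pos rfl] at hqv
  simp at hk
  simp [f5, f7, f19, g5, hf, hq, hin.C, hin.eps, ← hqv]
  have key : ∀ u : Fin N.nV, Function.update (σ.real 5) v (q' v) u = q' u := fun u => by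
    by_cases huv : (u : ℕ) = v
    · obtain rfl : u = v := Fin.ext huv
      simp
    · rw [Function.update_of_ne huv, hq, hq', if_neg fun h => huv (by rw [h])]
      simp
  have hq1' : ∀ u, u ≠ v → q' u < 1 := fun u huv => by
    rw [hq', if_neg huv.symm]
    simpa using hq1 u
  split_ifs with hc
  · refine ⟨by omega, fun e => hI1 e e.2, key, ?_⟩
    rcases hI2 with ⟨h1, h2⟩ | ⟨h1, h2⟩
    · refine Or.inl ⟨h1, fun e => h2 e e.2, fun u => ?_⟩
      by_cases huv : u = v
      · rw [huv]; exact hc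
      · exact hq1' u huv
    · exact Or.inr ⟨h1, Or.inl h2⟩
  · exact ⟨by omega, fun e => hI1 e e.2, key, Or.inr ⟨v, not_lt.1 hc⟩⟩

/-- One round. The flag `33` is cleared if it is the last one. -/
def round : Program :=
  .seq setLengths
    (.seq findPair
      (.cond (.natEq (nv 32) (.const 0)) (.setNat 33 (.const 0) (.const 0))
        (.seq (searchPair (.sub (nv 32) (.const 1)))
          (.seq traceWalk (.seq computeAmount updateWeights)))))

/-- The memory after the rounds `l`. -/
structure RunState (N : Network) (ε δ : ℝ) (l : List (FlowWalk N)) (σ : Mem) : Prop where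
  rounds : RoundsOK ε δ l
  w : ∀ e : Fin N.nE, σ.real 4 e = edgeWeight ε δ l e
  q : ∀ v : Fin N.nV, σ.real 5 v = vertexWeight ε δ l v
  out : Outputs σ l
  room : ∀ j < l.length, σ.nat 9 j + σ.nat 8 j ≤ σ.nat 34 0
  idle : Idle (N.nV + N.nV) σ

theorem Outputs.congr {N : Network} {σ τ : Mem} {l : List (FlowWalk N)} (h : Outputs σ l)
    (h5 : τ.nat 5 = σ.nat 5) (h6 : τ.nat 6 = σ.nat 6) (h7 : τ.nat 7 = σ.nat 7)
    (h8 : τ.nat 8 = σ.nat 8) (h9 : τ.nat 9 = σ.nat 9) (h10 : τ.nat 10 = σ.nat 10)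
    (r3 : τ.real 3 = σ.real 3) : Outputs τ l := by
  unfold Outputs at h ⊢
  rw [h5, h6, h7, h8, h9, h10, r3]
  exact h

/-- All earlier walks are stored below the place where the new one begins, so `h10'` protects them.
-/
theorem Outputs.concat {N : Network} {σ τ : Mem} {l : List (FlowWalk N)} (h : Outputs σ l)
    (hroom : ∀ j < l.length, σ.nat 9 j + σ.nat 8 j ≤ σ.nat 34 0) (r : FlowWalk N)
    (h5 : τ.nat 5 0 = l.length + 1)
    (h6 : τ.nat 6 = Function.update (σ.nat 6) l.length r.pair)
    (h7 : τ.nat 7 = Function.update (σ.nat 7) l.length r.proc)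
    (h8 : τ.nat 8 = Function.update (σ.nat 8) l.length r.walk.1.length)
    (h9 : τ.nat 9 = Function.update (σ.nat 9) l.length (σ.nat 34 0))
    (h10 : ∀ (k : ℕ) (hk : k < r.walk.1.length), τ.nat 10 (σ.nat 34 0 + k) = (r.walk.1[k]).val)
    (h10' : ∀ p < σ.nat 34 0, τ.nat 10 p = σ.nat 10 p)
    (r3 : τ.real 3 = Function.update (σ.real 3) l.length r.amount) :
    Outputs τ (l ++ [r]) := by
  refine ⟨by rw [h5]; simp, fun j hj => ?_⟩
  rw [h6, h7, h8, h9, r3]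
  rcases Nat.lt_or_ge j l.length with hlt | hge
  · obtain ⟨a1, a2, a3, a4, a5⟩ := h.2 j hlt
    have hne : j ≠ l.length := hlt.ne
    rw [Function.update_of_ne hne, Function.update_of_ne hne, Function.update_of_ne hne,
      Function.update_of_ne hne, Function.update_of_ne hne, List.getElem_append_left hlt]
    refine ⟨a1, a2, a3, fun k hk => ?_, a5⟩
    rw [h10' _ (by have := hroom j hlt; omega)]
    exact a4 k hk
  · have hj' : j = l.length := by simp at hj; omega
    subst hj'
    have hr : (l ++ [r])[l.length] = r := by simp
    rw [hr]
    simp only [Function.update_self]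
    exact ⟨trivial, trivial, trivial, h10, trivial⟩

/-- A bound for the number of steps of one round. -/
def roundCost (N : Network) : ℕ :=
  300 * (N.nV + N.nE) + N.nD * (searchCost N + 60) + searchCost N + 500

theorem wp_round {N : Network} {ε δ : ℝ} {j : ℕ} {σ : Mem} {l : List (FlowWalk N)}
    (h : Ready N ε j σ) (hl : RunState N ε δ l σ) (hε : 0 < ε) (hδ : 0 < δ)
    (h33 : σ.nat 33 0 = 1) (hsat : ¬ Saturated ε δ l) :
    wp round σ fun k τ => k ≤ roundCost N ∧
      ((τ.nat 33 0 = 0 ∧ RunState N ε δ l τ ∧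
        ∀ (i : Fin N.nD) (π : TwoWalk N i) (v : Fin N.nV), v ∈ π.1 → N.C v = 0) ∨
      ∃ r, RunState N ε δ (l ++ [r]) τ ∧ ((τ.nat 33 0 = 1 ∧ ¬ Saturated ε δ (l ++ [r])) ∨
        (τ.nat 33 0 = 0 ∧ Saturated ε δ (l ++ [r])))) := by
  have hw := fun e => hl.rounds.edgeWeight_pos hε hδ e
  have hq := fun v => hl.rounds.vertexWeight_pos hε hδ v
  rw [round, wp_seq]
  refine wp_mono (wp_frame (wp_setLengths h.input hl.w hl.q)) ?_
  rintro k₁ σ₁ ⟨F₁, hk₁, h6⟩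
  have R₁ := h.frame F₁ (by decide)
  have I₁ := hl.idle.frame F₁ (by decide) (by decide) (by decide) (by decide)
  rw [wp_seq]
  refine wp_mono (wp_frame (wp_findPair R₁ h6 hw hq I₁)) ?_
  rintro k₂ σ₂ ⟨F₂, hk₂, I₂, hbest⟩
  have R₂ := R₁.frame F₂ (by decide)
  rw [wp_cond]
  split_ifs with hc
  · have h32 : σ₂.nat 32 0 = 0 := by simpa using hc
    rw [wp_setNat]
    have F₃ := (Exec.setNat σ₂ 33 (.const 0) (.const 0)).frame
    refine ⟨by simp [roundCost]; omega, Or.inl ⟨by simp, ⟨hl.rounds, ?_, ?_, ?_, ?_, ?_⟩, ?_⟩⟩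
    · rw [F₃.real 4 rfl, F₂.real 4 (by decide), F₁.real 4 (by decide)]; exact hl.w
    · rw [F₃.real 5 rfl, F₂.real 5 (by decide), F₁.real 5 (by decide)]; exact hl.q
    · refine hl.out.congr ?_ ?_ ?_ ?_ ?_ ?_ ?_
      · rw [F₃.nat 5 rfl, F₂.nat 5 (by decide), F₁.nat 5 (by decide)]
      · rw [F₃.nat 6 rfl, F₂.nat 6 (by decide), F₁.nat 6 (by decide)]
      · rw [F₃.nat 7 rfl, F₂.nat 7 (by decide), F₁.nat 7 (by decide)]
      · rw [F₃.nat 8 rfl, F₂.nat 8 (by decide), F₁.nat 8 (by decide)]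
      · rw [F₃.nat 9 rfl, F₂.nat 9 (by decide), F₁.nat 9 (by decide)]
      · rw [F₃.nat 10 rfl, F₂.nat 10 (by decide), F₁.nat 10 (by decide)]
      · rw [F₃.real 3 rfl, F₂.real 3 (by decide), F₁.real 3 (by decide)]
    · rw [F₃.nat 8 rfl, F₂.nat 8 (by decide), F₁.nat 8 (by decide), F₃.nat 9 rfl,
        F₂.nat 9 (by decide), F₁.nat 9 (by decide), F₃.nat 34 rfl, F₂.nat 34 (by decide),
        F₁.nat 34 (by decide)]
      exact hl.room
    · exact I₂.frame F₃ rfl rfl rfl rfl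
    · intro i π v hv
      rcases hbest with ⟨-, h2⟩ | ⟨i, h2, -⟩
      · exact le_antisymm (not_lt.1 (h2 i i.2 π v hv)) (N.C_nonneg v)
      · omega
  · have h32 : σ₂.nat 32 0 ≠ 0 := by simpa using hc
    obtain ⟨i, hi, ⟨π₀, v₀, p1, p2, p3⟩, hmin⟩ := hbest.resolve_left fun h => h32 h.1
    have h6₂ : ∀ g, 1 ≤ g → g ≤ N.nE + N.nE + N.nV →
        σ₂.real 6 g = layerWt N (edgeWeight ε δ l) (vertexWeight ε δ l) g := by
      rw [F₂.real 6 (by decide)]; exact h6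
    rw [wp_seq]
    -- The search for the best pair is repeated, because the searches for later pairs may have
    -- overwritten its parent edges.
    refine wp_mono (wp_frame (wp_searchPair R₂ h6₂ hw hq I₂ (i := i) (by simp [hi]))) ?_
    rintro k₃ σ₃ ⟨F₃, hk₃, I₃, inv, hopen, h23⟩
    have R₃ := R₂.frame F₃ (by decide)
    obtain ⟨q1, q2⟩ := search_min inv hopen π₀ v₀ p1 p2
    obtain ⟨π, v, c1, c2, c3, c4⟩ := search_walk inv q1
    have hn : σ₃.nat 5 0 = l.length := by
      rw [F₃.nat 5 (by decide), F₂.nat 5 (by decide), F₁.nat 5 (by decide)]; exact hl.out.1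
    rw [wp_seq]
    refine wp_mono (wp_frame (wp_traceWalk R₃ (i := i) (π := π) (v := v) hn ?_ h23 c4)) ?_
    · rw [F₃.nat 32 (by decide), hi]
    rintro k₄ σ₄ ⟨F₄, hk₄, t6, t7, t8, t9, t10, t10', t34, tmu⟩
    have R₄ := R₃.frame F₄ (by decide)
    have hn₄ : σ₄.nat 5 0 = l.length := by rw [F₄.nat 5 (by decide), hn]
    have hv₄ : σ₄.nat 7 l.length = v := by rw [t7]; simp
    rw [wp_seq]
    refine wp_mono (wp_frame (wp_computeAmount R₄.input hn₄ hv₄ tmu)) ?_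
    rintro k₅ σ₅ ⟨F₅, hk₅, f, hf, h19, h3⟩
    have R₅ := R₄.frame F₅ (by decide)
    set r : FlowWalk N := ⟨i, π, v, c1, f⟩ with hr
    -- The traced walk costs the distance of the repeated search, which is at most the cost of the
    -- walk behind the recorded minimum, and this minimum is at most every other cost.
    have hchoice : IsOracleChoice (edgeWeight ε δ l) (vertexWeight ε δ l) r :=
      ⟨c2, fun i' π' v' hv' hC' => (c3.le.trans (q2.trans p3.le)).trans
        (hmin i' i'.2 π' v' hv' hC'), hf⟩
    obtain ⟨hs1, hs2⟩ := not_saturated_iff.1 hsat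
    refine wp_mono (wp_frame (wp_updateWeights R₅.input (n := l.length) (v := v) (f := f)
      (m := fun e => mult N e π.1) (w := edgeWeight ε δ l) (q := vertexWeight ε δ l)
      (w' := edgeWeight ε δ (l ++ [r])) (q' := vertexWeight ε δ (l ++ [r]))
      ?_ ?_ ?_ h19 ?_ ?_ ?_ hs2 (fun e => edgeWeight_concat ε δ l r e)
      (fun u => vertexWeight_concat ε δ l r u))) ?_
    · rw [F₅.nat 5 (by decide), hn₄]
    · rw [F₅.nat 7 (by decide), hv₄]
    · rw [F₅.real 9 (by decide)]; exact tmu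
    · rw [F₅.nat 33 (by decide), F₄.nat 33 (by decide), F₃.nat 33 (by decide),
        F₂.nat 33 (by decide), F₁.nat 33 (by decide), h33]
    · rw [F₅.real 4 (by decide), F₄.real 4 (by decide), F₃.real 4 (by decide),
        F₂.real 4 (by decide), F₁.real 4 (by decide)]
      exact hl.w
    · rw [F₅.real 5 (by decide), F₄.real 5 (by decide), F₃.real 5 (by decide),
        F₂.real 5 (by decide), F₁.real 5 (by decide)]
      exact hl.q
    rintro k₆ σ₆ ⟨F₆, hk₆, u4, u5, un, uflag⟩
    have b6 : σ₃.nat 6 = σ.nat 6 := by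
      rw [F₃.nat 6 (by decide), F₂.nat 6 (by decide), F₁.nat 6 (by decide)]
    have b7 : σ₃.nat 7 = σ.nat 7 := by
      rw [F₃.nat 7 (by decide), F₂.nat 7 (by decide), F₁.nat 7 (by decide)]
    have b8 : σ₃.nat 8 = σ.nat 8 := by
      rw [F₃.nat 8 (by decide), F₂.nat 8 (by decide), F₁.nat 8 (by decide)]
    have b9 : σ₃.nat 9 = σ.nat 9 := by
      rw [F₃.nat 9 (by decide), F₂.nat 9 (by decide), F₁.nat 9 (by decide)]
    have b10 : σ₃.nat 10 = σ.nat 10 := by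
      rw [F₃.nat 10 (by decide), F₂.nat 10 (by decide), F₁.nat 10 (by decide)]
    have b34 : σ₃.nat 34 = σ.nat 34 := by
      rw [F₃.nat 34 (by decide), F₂.nat 34 (by decide), F₁.nat 34 (by decide)]
    have b3 : σ₄.real 3 = σ.real 3 := by
      rw [F₄.real 3 (by decide), F₃.real 3 (by decide), F₂.real 3 (by decide),
        F₁.real 3 (by decide)]
    have e6 : σ₆.nat 6 = σ₄.nat 6 := by rw [F₆.nat 6 (by decide), F₅.nat 6 (by decide)]
    have e7 : σ₆.nat 7 = σ₄.nat 7 := by rw [F₆.nat 7 (by decide), F₅.nat 7 (by decide)]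
    have e8 : σ₆.nat 8 = σ₄.nat 8 := by rw [F₆.nat 8 (by decide), F₅.nat 8 (by decide)]
    have e9 : σ₆.nat 9 = σ₄.nat 9 := by rw [F₆.nat 9 (by decide), F₅.nat 9 (by decide)]
    have e10 : σ₆.nat 10 = σ₄.nat 10 := by rw [F₆.nat 10 (by decide), F₅.nat 10 (by decide)]
    have e34 : σ₆.nat 34 = σ₄.nat 34 := by rw [F₆.nat 34 (by decide), F₅.nat 34 (by decide)]
    have e3 : σ₆.real 3 = σ₅.real 3 := by rw [F₆.real 3 (by decide)]
    rw [b6] at t6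
    rw [b7] at t7
    rw [b8] at t8
    rw [b9, b34] at t9
    rw [b34] at t10 t10' t34
    rw [b10] at t10'
    rw [b3] at h3
    refine ⟨?_, Or.inr ⟨r, ⟨roundsOK_concat.2 ⟨hl.rounds, hsat, hchoice⟩, u4, u5,
      hl.out.concat hl.room r un (e6.trans t6) (e7.trans t7) (e8.trans t8) (e9.trans t9)
        (by rw [e10]; exact t10) (by rw [e10]; exact t10') (e3.trans h3), ?_, ?_⟩, ?_⟩⟩
    · simp at hk₃
      simp [roundCost, searchCost] at hk₂ ⊢
      omega
    · intro j hj
      rw [e9, e8, e34, t9, t8, t34]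
      rcases eq_or_ne j l.length with rfl | hne
      · simp
      · rw [Function.update_of_ne hne, Function.update_of_ne hne]
        have := hl.room j (by simp at hj; omega)
        omega
    · exact ((I₃.frame F₄ (by decide) (by decide) (by decide) (by decide)).frame F₅ (by decide)
        (by decide) (by decide) (by decide)).frame F₆ (by decide) (by decide) (by decide)
        (by decide)
    · rcases uflag with ⟨h1, h2, h3⟩ | ⟨h1, h2⟩
      · exact Or.inl ⟨h1, not_saturated_iff.2 ⟨h2, h3⟩⟩
      · exact Or.inr ⟨h1, h2⟩

/-- Repeat the rounds until the flag `33` is cleared. -/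
def runRounds : Program := .loop (.natEq (nv 33) (.const 1)) round

/-- Termination rests on the mathematical bound `T` for the number of rounds: the budget pays for `T
+ 1 - l.length` further rounds, and each completed round uses up one of them. -/
theorem wp_runRounds {N : Network} {ε δ : ℝ} {j : ℕ} {σ : Mem} (h : Ready N ε j σ)
    (hl : RunState N ε δ [] σ) (hε : 0 < ε) (hδ : 0 < δ) (h33 : σ.nat 33 0 = 1)
    (hsat : ¬ Saturated ε δ ([] : List (FlowWalk N))) {T : ℕ}
    (hT : ∀ l : List (FlowWalk N), RoundsOK ε δ l → l.length ≤ T) :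
    wp runRounds σ fun k τ => k ≤ (roundCost N + 10) * (T + 1) + 10 ∧ Ready N ε j τ ∧
      ∃ l, RunState N ε δ l τ ∧ IsMWURun ε δ l := by
  refine wp_mono (wp_frame (wp_loop (fun r τ => ∃ l, RunState N ε δ l τ ∧
      ((τ.nat 33 0 = 1 ∧ ¬ Saturated ε δ l ∧
          r = (roundCost N + 10) * (T + 1 - l.length) + 10) ∨
        (τ.nat 33 0 = 0 ∧ (Saturated ε δ l ∨
          ∀ (i : Fin N.nD) (π : TwoWalk N i) (v : Fin N.nV), v ∈ π.1 → N.C v = 0) ∧ r = 10)))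
    (Q := fun τ => ∃ l, RunState N ε δ l τ ∧ IsMWURun ε δ l) ?_ ?_
    ⟨[], hl, Or.inl ⟨h33, hsat, rfl⟩⟩)) fun k τ hk => ⟨by simpa using hk.2.1,
      h.frame hk.1 (by decide), hk.2.2⟩
  · rintro r τ hF ⟨l, h1, h2⟩ hb
    have hb : τ.nat 33 0 = 1 := by simpa using hb
    rcases h2 with ⟨-, h3, rfl⟩ | ⟨h3, -⟩
    swap
    · omega
    refine wp_mono (wp_round (h.frame hF (by decide)) h1 hε hδ hb h3) ?_
    rintro k ρ ⟨hk, hρ⟩ -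
    have hlen := hT l h1.rounds
    have hsub : T + 1 - l.length = T + 1 - (l.length + 1) + 1 := by omega
    rw [hsub, mul_add]
    simp
    rcases hρ with ⟨a1, a2, a3⟩ | ⟨r, a1, ⟨a2, a3⟩ | ⟨a2, a3⟩⟩
    · exact ⟨10, ⟨l, a2, Or.inr ⟨a1, Or.inr a3, rfl⟩⟩, by omega⟩
    · exact ⟨_, ⟨_, a1, Or.inl ⟨a2, a3, rfl⟩⟩, by simp; omega⟩
    · exact ⟨10, ⟨_, a1, Or.inr ⟨a2, Or.inl a3, rfl⟩⟩, by omega⟩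
  · rintro r τ hF ⟨l, h1, h2⟩ hb
    have hb : τ.nat 33 0 ≠ 1 := by simpa using hb
    rcases h2 with ⟨h3, -⟩ | ⟨-, h3, rfl⟩
    · exact absurd h3 hb
    · exact ⟨by simp, l, h1, h1.rounds, h3⟩

/-- Divide all amounts by the real variable `17`. -/
def scaleAmounts : Program :=
  forLoop 27 (nv 5) (.setReal 3 (nv 27) (.mul (.div (.const 1) (rv 17)) (.get 3 (nv 27))))

theorem wp_scaleAmounts {σ : Mem} {n : ℕ} (hn : σ.nat 5 0 = n) :
    wp scaleAmounts σ fun k τ => k ≤ 30 * n + 20 ∧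
      ∀ i < n, τ.real 3 i = 1 / σ.real 17 0 * σ.real 3 i := by
  refine wp_mono (wp_forLoop n 18 (fun i τ => (∀ e < i, τ.real 3 e = 1 / σ.real 17 0 * σ.real 3 e) ∧
    ∀ e, i ≤ e → τ.real 3 e = σ.real 3 e)
    (by decide) (fun i σ x h => by simpa using h) (fun τ hF => ?_)
    (fun i τ hi hF hiv hI => ?_) (by simp)) ?_
  · have f5 : τ.nat 5 0 = n := by rw [hF.nat 5 (by decide), hn]
    simp [f5]
  · have f17 : τ.real 17 = σ.real 17 := hF.real 17 (by decide)
    simp [hiv, f17]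
    refine ⟨fun e he => ?_, fun e he => ?_⟩
    · rcases eq_or_ne e i with rfl | hne
      · rw [Function.update_self, hI.2 e le_rfl]
      · rw [Function.update_of_ne hne, hI.1 e (by omega), one_div]
    · rw [Function.update_of_ne (by omega)]; exact hI.2 e (by omega)
  · rintro k τ ⟨h1, h2⟩
    simp at h1
    exact ⟨by omega, h2.1⟩

def preprocess : Program :=
  .seq countExperts
    (.seq computePower
      (.seq computeDelta
        (.seq (.setNat 21 (.const 0) (.add numV numV))
          (.seq fillHalf
            (.seq fillLayers
              (.seq linkEdges
                (.seq initWeights (.setNat 33 (.const 0) (.const 1)))))))))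

theorem wp_preprocess (N : Network) {ε : ℝ} (hε : 0 < ε) {j : ℕ}
    (hj : (2 + N.nV + N.nE : ℝ) ^ ⌈4 / ε⌉₊ ≤ (1 + ε) ^ j)
    (hj' : ∀ i < j, (1 + ε) ^ i < (2 + N.nV + N.nE : ℝ) ^ ⌈4 / ε⌉₊) :
    wp preprocess (input N ε) fun k τ =>
      k ≤ 400 * (N.nV + N.nE) + 30 * ⌈4 / ε⌉₊ + 30 * j + 300 ∧ Ready N ε j τ ∧
      RunState N ε (1 / (1 + ε) ^ j) [] τ ∧ τ.nat 33 0 = 1 := by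
  have h := hasInput_input N ε
  rw [preprocess, wp_seq]
  refine wp_mono (wp_frame (wp_countExperts h)) ?_
  rintro k₁ σ₁ ⟨F₁, hk₁, h10⟩
  have h₁ := h.frame F₁ (by decide)
  rw [wp_seq]
  refine wp_mono (wp_frame (wp_computePower hε h₁.eps)) ?_
  rintro k₂ σ₂ ⟨F₂, hk₂, h11⟩
  have h₂ := h₁.frame F₂ (by decide)
  rw [h10] at h11
  rw [wp_seq]
  refine wp_mono (wp_frame (wp_computeDelta h₂.eps (j := j) (by rw [h11]; exact hj)
    (by rw [h11]; exact hj'))) ?_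
  rintro k₃ σ₃ ⟨F₃, hk₃, h18, h17⟩
  have h₃ := h₂.frame F₃ (by decide)
  rw [wp_seq, wp_setNat]
  have F₄ := (Exec.setNat σ₃ 21 (.const 0) (.add numV numV)).frame
  have h₄ := h₃.frame F₄ (by decide)
  have h21 : (σ₃.setNat 21 (NExp.eval σ₃ (.const 0)) (NExp.eval σ₃ (.add numV numV))).nat 21 0 =
      N.nV + N.nV := by simp [h₃.nV]
  set σ₄ := σ₃.setNat 21 (NExp.eval σ₃ (.const 0)) (NExp.eval σ₃ (.add numV numV))
  rw [wp_seq]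
  refine wp_mono (wp_frame (wp_fillHalf h₄ ?_)) ?_
  · intro i
    rw [F₄.nat 14 rfl, F₃.nat 14 (by decide), F₂.nat 14 (by decide), F₁.nat 14 (by decide)]
    rfl
  rintro k₅ σ₅ ⟨F₅, hk₅, hhalf⟩
  have h₅ := h₄.frame F₅ (by decide)
  rw [wp_seq]
  refine wp_mono (wp_frame (wp_fillLayers h₅)) ?_
  rintro k₆ σ₆ ⟨F₆, hk₆, hlay⟩
  have h₆ := h₅.frame F₆ (by decide)
  rw [wp_seq]
  refine wp_mono (wp_frame (wp_linkEdges (src := layerSrc N) h₆ ?_ fun g h1 h2 => (hlay g h1 h2).1)) ?_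
  · intro i
    rw [F₆.nat 11 (by decide), F₅.nat 11 (by decide), F₄.nat 11 rfl, F₃.nat 11 (by decide),
      F₂.nat 11 (by decide), F₁.nat 11 (by decide)]
    rfl
  rintro k₇ σ₇ ⟨F₇, hk₇, hfirst, hnext⟩
  have h₇ := h₆.frame F₇ (by decide)
  rw [wp_seq]
  refine wp_mono (wp_frame (wp_initWeights h₇)) ?_
  rintro k₈ σ₈ ⟨F₈, hk₈, hw, hq⟩
  have h₈ := h₇.frame F₈ (by decide)
  rw [wp_setNat]
  have F₉ := (Exec.setNat σ₈ 33 (.const 0) (.const 1)).frame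
  have h₉ := h₈.frame F₉ (by decide)
  have hδ : σ₇.real 18 0 = 1 / (1 + ε) ^ j := by
    rw [F₇.real 18 (by decide), F₆.real 18 (by decide), F₅.real 18 (by decide), F₄.real 18 rfl, h18]
  rw [hδ] at hw hq
  -- The preprocessing does not touch the output counter, the queue, the stamps and the write
  -- position. Their initial zeros are an empty output, an empty queue and stamps below the one of
  -- the first search.
  have hz : ∀ a, (a = 5 ∨ a = 15 ∨ a = 16 ∨ a = 22 ∨ a = 34) → ∀ i,
      (σ₈.setNat 33 (NExp.eval σ₈ (.const 0)) (NExp.eval σ₈ (.const 1))).nat a i = 0 := by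
    intro a ha i
    rcases ha with rfl | rfl | rfl | rfl | rfl <;>
    · rw [F₉.nat _ rfl, F₈.nat _ (by decide), F₇.nat _ (by decide), F₆.nat _ (by decide),
        F₅.nat _ (by decide), F₄.nat _ rfl, F₃.nat _ (by decide), F₂.nat _ (by decide),
        F₁.nat _ (by decide)]
      rfl
  have hz7 : ∀ i,
      (σ₈.setNat 33 (NExp.eval σ₈ (.const 0)) (NExp.eval σ₈ (.const 1))).real 7 i = 0 := by
    intro i
    rw [F₉.real _ rfl, F₈.real _ (by decide), F₇.real _ (by decide), F₆.real _ (by decide),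
      F₅.real _ (by decide), F₄.real _ rfl, F₃.real _ (by decide), F₂.real _ (by decide),
      F₁.real _ (by decide)]
    rfl
  refine ⟨by simp; omega, ⟨h₉, ?_, ?_, ?_, ?_, ?_, ?_, ?_⟩, ⟨roundsOK_nil _ _, ?_, ?_, ?_, ?_, ?_, ?_, ?_⟩,
    by simp⟩
  · rw [F₉.nat 21 rfl, F₈.nat 21 (by decide), F₇.nat 21 (by decide), F₆.nat 21 (by decide),
      F₅.nat 21 (by decide), h21]
  · rw [F₉.nat 14 rfl, F₈.nat 14 (by decide), F₇.nat 14 (by decide), F₆.nat 14 (by decide)]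
    exact hhalf
  · rw [F₉.nat 18 rfl, F₈.nat 18 (by decide), F₇.nat 18 (by decide)]
    exact fun g h1 h2 => (hlay g h1 h2).1
  · rw [F₉.nat 13 rfl, F₈.nat 13 (by decide), F₇.nat 13 (by decide)]
    exact fun g h1 h2 => (hlay g h1 h2).2
  · rw [F₉.nat 11 rfl, F₈.nat 11 (by decide)]
    exact hfirst
  · rw [F₉.nat 12 rfl, F₈.nat 12 (by decide)]
    exact hnext
  · rw [F₉.real 17 rfl, F₈.real 17 (by decide), F₇.real 17 (by decide), F₆.real 17 (by decide),
      F₅.real 17 (by decide), F₄.real 17 rfl, h17]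
  · intro e
    rw [F₉.real 4 rfl, hw e e.2]
    simp [edgeWeight]
  · intro v
    rw [F₉.real 5 rfl, hq v v.2]
    simp [vertexWeight]
  · exact ⟨hz 5 (by simp) 0, fun j hj => by simp at hj⟩
  · intro j hj
    simp at hj
  · intro p hp1 hp2
    simp only [NodeOK, hz 15 (by simp), hz7]
    simp
  · exact fun x _ => hz 15 (by simp) _
  · intro x _
    rw [hz 16 (by simp), hz 22 (by simp)]
    omega

/-- The program of the theorem. -/
def mainProgram : Program := .seq preprocess (.seq runRounds scaleAmounts)

/-! ### The number of rounds and steps -/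

/-- The vertices that occur in 2-walks. -/
def activeVertices (N : Network) : Finset (Fin N.nV) :=
  (Finset.univ.image fun e => (N.edge e).2) ∪ Finset.univ.image N.src

theorem mem_of_isChain {N : Network} {a v : Fin N.nV} {l : List (Fin N.nV)}
    (h : (a :: l).IsChain fun u v => ∃ e, N.edge e = (u, v)) (hv : v ∈ a :: l) :
    v = a ∨ ∃ e, (N.edge e).2 = v := by
  induction l generalizing a with
  | nil => exact Or.inl (by simpa using hv)
  | cons b l ih =>
    obtain ⟨⟨e, he⟩, hc⟩ := List.isChain_cons_cons.1 h
    rcases List.mem_cons.1 hv with rfl | hv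
    · exact Or.inl rfl
    · rcases ih hc hv with rfl | h
      · exact Or.inr ⟨e, by rw [he]⟩
      · exact Or.inr h

theorem FlowWalk.proc_mem_active {N : Network} (r : FlowWalk N) :
    r.proc ∈ activeVertices N := by
  obtain ⟨i, ⟨π, h1, -, h3, -⟩, v, hv, f⟩ := r
  simp only [activeVertices, Finset.mem_union, Finset.mem_image, Finset.mem_univ, true_and]
  cases π with
  | nil => simp at h1
  | cons a l =>
    obtain rfl : a = N.src i := by simpa using h1
    rcases mem_of_isChain h3 hv with h | h
    · exact Or.inr ⟨i, h.symm⟩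
    · exact Or.inl h

/-- Both bounds are needed: the second one controls the linear overhead of the rounds, the first one
the cost of the searches. -/
theorem activeVertices_card (N : Network) :
    (activeVertices N).card ≤ N.nV ∧ (activeVertices N).card ≤ N.nE + N.nD := by
  refine ⟨by simpa using Finset.card_le_univ (activeVertices N),
    (Finset.card_union_le _ _).trans (Nat.add_le_add ?_ ?_)⟩
  · simpa using Finset.card_image_le (s := Finset.univ) (f := fun e => (N.edge e).2)
  · simpa using Finset.card_image_le (s := Finset.univ) (f := N.src)

theorem Network.nE_le (N : Network) : N.nE ≤ N.nV * N.nV := by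
  simpa using Fintype.card_le_of_injective N.edge N.edge_injective

theorem wp_mainProgram (N : Network) {ε : ℝ} (hε : 0 < ε) {j : ℕ} (hj0 : j ≠ 0)
    (hj : (2 + N.nV + N.nE : ℝ) ^ ⌈4 / ε⌉₊ ≤ (1 + ε) ^ j)
    (hj' : ∀ i < j, (1 + ε) ^ i < (2 + N.nV + N.nE : ℝ) ^ ⌈4 / ε⌉₊) :
    wp mainProgram (input N ε) fun k τ =>
      k ≤ 400 * (N.nV + N.nE) + 30 * ⌈4 / ε⌉₊ + 30 * j + 400 +
        (roundCost N + 40) * (j * (N.nE + (activeVertices N).card) + 2) ∧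
      ∃ l : List (FlowWalk N), IsMWURun ε (1 / (1 + ε) ^ j) l ∧
        Outputs τ (l.map (FlowWalk.scale (1 / ((j : ℝ) + 1)))) := by
  have hpow : 0 < (1 + ε) ^ j := by positivity
  have hδ : 0 < 1 / (1 + ε) ^ j := by positivity
  have hδ1 : 1 / (1 + ε) ^ j < 1 := by
    rw [div_lt_one hpow]
    exact one_lt_pow₀ (by linarith) hj0
  rw [mainProgram, wp_seq]
  refine wp_mono (wp_preprocess N hε hj hj') ?_
  rintro k₁ σ₁ ⟨hk₁, R₁, S₁, h33⟩
  rw [wp_seq]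
  refine wp_mono (wp_runRounds R₁ S₁ hε hδ h33 ?_
    fun l hl => hl.length_le hε (activeVertices N) fun r _ => r.proc_mem_active) ?_
  · rw [not_saturated_iff]
    simpa [edgeWeight, vertexWeight] using ⟨fun _ => by simpa using hδ1, fun _ => by simpa using hδ1⟩
  rintro k₂ σ₂ ⟨hk₂, R₂, l, S₂, hrun⟩
  have hlen : l.length ≤ _ := S₂.rounds.length_le hε (activeVertices N)
    fun r _ => r.proc_mem_active
  refine wp_mono (wp_frame (wp_scaleAmounts S₂.out.1)) ?_
  rintro k₃ τ ⟨F, hk₃, hsc⟩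
  refine ⟨?_, l, hrun, ?_, ?_⟩
  · have : (roundCost N + 40) * (j * (N.nE + (activeVertices N).card) + 2) =
      (roundCost N + 10) * (j * (N.nE + (activeVertices N).card) + 1 + 1) +
        30 * (j * (N.nE + (activeVertices N).card) + 2) := by ring
    omega
  · rw [F.nat 5 (by decide), List.length_map]
    exact S₂.out.1
  · intro i hi
    rw [List.length_map] at hi
    obtain ⟨a1, a2, a3, a4, a5⟩ := S₂.out.2 i hi
    rw [F.nat 6 (by decide), F.nat 7 (by decide), F.nat 8 (by decide), F.nat 9 (by decide),
      F.nat 10 (by decide), hsc i hi, R₂.divisor, a5, List.getElem_map]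
    exact ⟨a1, a2, a3, a4, rfl⟩

/-! ### The running time in terms of the size of the network -/

/-- This is the reason for choosing the initial weight as a power of 1 + η: the divisor becomes a
number that a loop can count. -/
theorem logb_one_add_div_pow {η : ℝ} (hη : 0 < η) (j : ℕ) :
    Real.logb (1 + η) ((1 + η) / (1 / (1 + η) ^ j)) = j + 1 := by
  have h : (1 + η) / (1 / (1 + η) ^ j) = (1 + η) ^ (j + 1) := by
    rw [div_div_eq_mul_div, div_one, pow_succ']
  rw [h, Real.logb_pow, Real.logb_self_eq_one (by linarith)]
  push_cast
  ring

theorem log_ge_of_two_le {v : ℝ} (hv : 2 ≤ v) : 0.69 ≤ Real.log v :=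
  (by linarith [Real.log_two_gt_d9] : (0.69 : ℝ) ≤ Real.log 2).trans
    (Real.log_le_log (by norm_num) hv)

theorem ceil_four_div_le {ε : ℝ} (hε : 0 < ε) (hε1 : ε < 1) : (⌈4 / ε⌉₊ : ℝ) ≤ 5 / ε := by
  have h1 := Nat.ceil_lt_add_one (a := 4 / ε) (by positivity)
  have h2 : 1 ≤ 1 / ε := by rw [le_div_iff₀ hε]; linarith
  have h3 : 5 / ε = 4 / ε + 1 / ε := by ring
  linarith

/-- By minimality, (1 + ε)^(j-1) is still below the power of X = 2 + v + e. Taking logarithms with X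
≤ v³, ⌈4/ε⌉ ≤ 5/ε and log(1 + ε) ≥ 2ε/3 gives 22.5 log v / ε² for j - 1, and the missing 1 is
absorbed since log v ≥ 0.69. -/
theorem exponent_le {v e ε : ℝ} {j : ℕ} (hv : 2 ≤ v) (he : 0 ≤ e) (hev : e ≤ v * v) (hε : 0 < ε)
    (hε1 : ε < 1) (hj' : ∀ i < j, (1 + ε) ^ i < (2 + v + e) ^ ⌈4 / ε⌉₊) :
    (j : ℝ) ≤ 25 * (Real.log v / ε ^ 2) := by
  have hℓ := log_ge_of_two_le hv
  have hε2 : Real.log v ≤ Real.log v / ε ^ 2 := by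
    rw [le_div_iff₀ (by positivity)]
    exact mul_le_of_le_one_right (by linarith) (pow_le_one₀ hε.le hε1.le)
  rcases j with _ | j
  · simp only [Nat.cast_zero]; linarith
  have h := Real.log_lt_log (by positivity) (hj' j (Nat.lt_succ_self j))
  rw [Real.log_pow, Real.log_pow] at h
  have hX : Real.log (2 + v + e) ≤ 3 * Real.log v := by
    have : (3 : ℝ) * Real.log v = Real.log (v ^ 3) := by rw [Real.log_pow]; norm_num
    rw [this]
    refine Real.log_le_log (by linarith) ?_
    have h1 : 2 * v ≤ v * v := by nlinarith
    have h2 : 2 * (v * v) ≤ v ^ 3 := by nlinarith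
    linarith
  have hlog : 2 / 3 * ε ≤ Real.log (1 + ε) := by
    refine le_trans ?_ (Real.le_log_one_add_of_nonneg hε.le)
    rw [le_div_iff₀ (by linarith)]
    nlinarith
  have h1 : (j : ℝ) * (2 / 3 * ε) ≤ 5 / ε * (3 * Real.log v) :=
    (mul_le_mul_of_nonneg_left hlog (Nat.cast_nonneg j)).trans (h.le.trans
      (mul_le_mul (ceil_four_div_le hε hε1) hX (Real.log_nonneg (by linarith)) (by positivity)))
  have h2 : (j : ℝ) ≤ 22.5 * (Real.log v / ε ^ 2) := by
    rw [mul_div_assoc', le_div_iff₀ (by positivity)]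
    have h3 := mul_le_mul_of_nonneg_right h1 hε.le
    rw [mul_right_comm (5 / ε), div_mul_cancel₀ _ hε.ne'] at h3
    linarith
  push_cast
  linarith

/-- The height is at most 3 + log₂ n. At n = 2 this is 4, just below 6 log 2. -/
theorem height_four_mul_le {n : ℕ} (hn : 2 ≤ n) : (height (4 * n) : ℝ) ≤ 6 * Real.log n := by
  have hv : (2 : ℝ) ≤ n := by exact_mod_cast hn
  have hℓ := log_ge_of_two_le hv
  have h := Real.natLog_le_logb (4 * n) 2
  have h4 : Real.log ((4 * n : ℕ) : ℝ) = 2 * Real.log 2 + Real.log n := by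
    push_cast
    rw [Real.log_mul (by norm_num) (by linarith), show (4 : ℝ) = 2 ^ 2 by norm_num, Real.log_pow]
    norm_num
  have h2 := Real.log_two_gt_d9
  rw [Real.logb, h4, Nat.cast_ofNat, le_div_iff₀ (by linarith)] at h
  rw [height, if_neg (by omega)]
  push_cast
  have hn : (0 : ℝ) ≤ Nat.log 2 (4 * n) := Nat.cast_nonneg _
  by_contra hc
  rw [not_le] at hc
  nlinarith

theorem roundCost_le (N : Network) (hV : 2 ≤ N.nV) (hE : 1 ≤ N.nE) (hD : 1 ≤ N.nD) :
    (roundCost N + 40 : ℝ) ≤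
      300 * (N.nV + N.nE) + 16100 * ((N.nD : ℝ) * N.nE * Real.log N.nV) := by
  have hℓ := log_ge_of_two_le (v := N.nV) (by exact_mod_cast hV)
  have he : (1 : ℝ) ≤ N.nE := by exact_mod_cast hE
  have hd : (1 : ℝ) ≤ N.nD := by exact_mod_cast hD
  have hh := height_four_mul_le hV
  rw [roundCost, searchCost]
  push_cast
  set ℓ := Real.log N.nV
  set e := (N.nE : ℝ)
  set d := (N.nD : ℝ)
  have heℓ : 0.69 ≤ e * ℓ := by nlinarith
  have hdeℓ : e * ℓ ≤ d * e * ℓ := by nlinarith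
  have hd' : d ≤ 1.45 * (d * e * ℓ) := by nlinarith
  have hS : (80 * (height (4 * N.nV) : ℝ) + 130) * (6 * e + 5) + 120 ≤ 7600 * (e * ℓ) := by
    have h1 : 80 * (height (4 * N.nV) : ℝ) + 130 ≤ 669 * ℓ := by linarith
    have h2 := mul_le_mul h1 (by linarith : 6 * e + 5 ≤ 11 * e) (by linarith) (by linarith)
    linarith
  have hdS := mul_le_mul_of_nonneg_left hS (by linarith : 0 ≤ d)
  linarith

/-- The factor e + a is estimated in two ways: by 3de, using a ≤ e + d, when it meets the overhead v
+ e, and by v + e, using a ≤ v, when it meets the searches. -/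
theorem rounds_cost_le {r v e d a ℓ J : ℝ} (hv : 2 ≤ v) (he : 1 ≤ e) (hd : 1 ≤ d) (ha : 0 ≤ a)
    (hav : a ≤ v) (haed : a ≤ e + d) (hℓ : 0.69 ≤ ℓ) (hJ : 1 ≤ J)
    (hr : r ≤ 300 * (v + e) + 16100 * (d * e * ℓ)) :
    r * (J * (e + a) + 2) ≤ 53000 * (J * ℓ * (d * e * (v + e))) := by
  have hde : 1 ≤ d * e := by nlinarith
  have hS0 : 1 ≤ e + a := by linarith
  have hS1 : e + a ≤ v + e := by linarith
  have hS2 : e + a ≤ 3 * (d * e) := by nlinarith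
  have hJS : J * (e + a) + 2 ≤ 3 * (J * (e + a)) := by nlinarith
  have h1 : (v + e) * (e + a) ≤ 3 * (d * e * (v + e)) := by
    linarith [mul_le_mul_of_nonneg_left hS2 (by linarith : 0 ≤ v + e)]
  have h2 : d * e * ℓ * (e + a) ≤ ℓ * (d * e * (v + e)) := by
    linarith [mul_le_mul_of_nonneg_left hS1 (by positivity : 0 ≤ d * e * ℓ)]
  have h3 : d * e * (v + e) ≤ 1.45 * (ℓ * (d * e * (v + e))) := by
    linarith [mul_le_mul_of_nonneg_right (by linarith : 1 ≤ 1.45 * ℓ)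
      (by positivity : 0 ≤ d * e * (v + e))]
  have h4 : 0 ≤ ℓ * (d * e * (v + e)) := by positivity
  calc r * (J * (e + a) + 2)
      ≤ (300 * (v + e) + 16100 * (d * e * ℓ)) * (3 * (J * (e + a))) :=
        mul_le_mul hr hJS (by positivity) (by positivity)
    _ = 3 * J * (300 * ((v + e) * (e + a)) + 16100 * (d * e * ℓ * (e + a))) := by ring
    _ ≤ 3 * J * (53000 / 3 * (ℓ * (d * e * (v + e)))) :=
        mul_le_mul_of_nonneg_left (by linarith) (by linarith)
    _ = 53000 * (J * ℓ * (d * e * (v + e))) := by ring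

theorem total_cost_le {v e d ℓ J c R ε : ℝ} (hv : 2 ≤ v) (he : 1 ≤ e) (hd : 1 ≤ d)
    (hℓ : 0.69 ≤ ℓ) (hε : 0 < ε) (hε1 : ε < 1) (hJ0 : 0 ≤ J) (hJ : J ≤ 25 * (ℓ / ε ^ 2))
    (hC : c ≤ 5 / ε) (hR : R ≤ 53000 * (J * ℓ * (d * e * (v + e)))) :
    400 * (v + e) + 30 * c + 30 * J + 400 + R ≤
      2000000 * (d * e * (e + v * ℓ) * ℓ ^ 2 / ε ^ 2) := by
  have hde : 1 ≤ d * e := by nlinarith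
  obtain ⟨W, hW⟩ : ∃ W, W = d * e * (v + e) := ⟨_, rfl⟩
  have hWve : v + e ≤ W := by
    rw [hW]
    exact le_mul_of_one_le_left (by linarith) hde
  rw [← hW] at hR
  have hW3 : 3 ≤ W := by linarith
  have hε2 : 0 < ε ^ 2 := by positivity
  obtain ⟨Z, hZ⟩ : ∃ Z, Z = ℓ ^ 2 * W / ε ^ 2 := ⟨_, rfl⟩
  have hZ0 : 0 ≤ Z := by rw [hZ]; positivity
  have hJW : J * ℓ * W ≤ 25 * Z := by
    calc J * ℓ * W = J * (ℓ * W) := by ring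
      _ ≤ 25 * (ℓ / ε ^ 2) * (ℓ * W) := mul_le_mul_of_nonneg_right hJ (by positivity)
      _ = 25 * Z := by rw [hZ]; ring
  have hWZ : W / ε ^ 2 ≤ 2.2 * Z := by
    have h1 : 1 ≤ 2.2 * ℓ ^ 2 := by nlinarith
    have h2 := mul_le_mul_of_nonneg_right h1 (by positivity : 0 ≤ W / ε ^ 2)
    rw [hZ, mul_div_assoc]
    linarith
  have hW' : W ≤ W / ε ^ 2 := le_div_self (by linarith) hε2 (pow_le_one₀ hε.le hε1.le)
  have hc : c ≤ 5 * (W / ε ^ 2) := by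
    refine hC.trans ?_
    rw [mul_div_assoc', div_le_div_iff₀ hε hε2]
    have : ε ^ 2 ≤ ε * W := by nlinarith
    linarith
  have hJ2 : J ≤ 40 * Z := by
    have h1 : J ≤ 1.45 * (J * ℓ) := by nlinarith
    have h2 : J * ℓ ≤ J * ℓ * W :=
      le_mul_of_one_le_right (mul_nonneg hJ0 (by linarith)) (by linarith)
    linarith
  have htotal : 400 * (v + e) + 30 * c + 30 * J + 400 + R ≤ 1350000 * Z := by linarith
  refine htotal.trans ?_
  rw [hZ, mul_div_assoc', mul_div_assoc', div_le_div_iff_of_pos_right hε2, hW]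
  -- Here v ≤ vℓ/0.69, and 1350000/0.69 is below 2000000.
  have h1 : 1350000 * (v + e) ≤ 2000000 * (e + v * ℓ) := by nlinarith
  have h2 := mul_le_mul_of_nonneg_left h1 (by positivity : 0 ≤ d * e * ℓ ^ 2)
  linarith

theorem steps_le {N : Network} {ε : ℝ} (hε : 0 < ε) (hε1 : ε < 1) {j k : ℕ} (hj0 : j ≠ 0)
    (hj' : ∀ i < j, (1 + ε) ^ i < (2 + N.nV + N.nE : ℝ) ^ ⌈4 / ε⌉₊)
    (hk : k ≤ 400 * (N.nV + N.nE) + 30 * ⌈4 / ε⌉₊ + 30 * j + 400 +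
        (roundCost N + 40) * (j * (N.nE + (activeVertices N).card) + 2))
    (hV : 2 ≤ N.nV) (hE : 1 ≤ N.nE) (hD : 1 ≤ N.nD) :
    (k : ℝ) ≤ 2000000 * ((N.nD : ℝ) * (N.nE : ℝ) *
      ((N.nE : ℝ) + (N.nV : ℝ) * Real.log N.nV) * Real.log N.nV ^ 2 / ε ^ 2) := by
  have hv : (2 : ℝ) ≤ N.nV := by exact_mod_cast hV
  have he : (1 : ℝ) ≤ N.nE := by exact_mod_cast hE
  have hd : (1 : ℝ) ≤ N.nD := by exact_mod_cast hD
  have hℓ := log_ge_of_two_le hv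
  have hJ := exponent_le hv (by linarith) (by exact_mod_cast N.nE_le) hε hε1 hj'
  have hJ1 : (1 : ℝ) ≤ j := by exact_mod_cast Nat.one_le_iff_ne_zero.2 hj0
  have hC := ceil_four_div_le hε hε1
  have hR := roundCost_le N hV hE hD
  have hA1 : ((activeVertices N).card : ℝ) ≤ N.nV := by exact_mod_cast (activeVertices_card N).1
  have hA2 : ((activeVertices N).card : ℝ) ≤ N.nE + N.nD := by
    exact_mod_cast (activeVertices_card N).2
  have hA0 : (0 : ℝ) ≤ (activeVertices N).card := Nat.cast_nonneg _
  have hk' : (k : ℝ) ≤ 400 * (N.nV + N.nE) + 30 * ⌈4 / ε⌉₊ + 30 * j + 400 +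
      (roundCost N + 40) * (j * (N.nE + (activeVertices N).card) + 2) := by exact_mod_cast hk
  exact hk'.trans (total_cost_le hv he hd hℓ hε hε1 (by linarith) hJ hC
    (rounds_cost_le hv he hd hA0 hA1 hA2 hℓ hJ1 hR))

end ProcFlow

/-! ### The main theorem. -/

theorem mainTheorem2 :
    ∃ (prog : ProcFlow.Program) (K : ℝ), 0 < K ∧
      ∀ (N : ProcFlow.Network) (ε : ℝ), 0 < ε → ε < 1 →
        ∃ (steps : ℕ) (σ : ProcFlow.Mem) (out : List (ProcFlow.FlowWalk N)),
          ProcFlow.Exec prog (ProcFlow.input N ε) steps σ ∧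
          ProcFlow.Outputs σ out ∧
          (∃ (η δ : ℝ) (rounds : List (ProcFlow.FlowWalk N)),
            0 < η ∧ η ≤ ε ∧ 0 < δ ∧ δ < 1 ∧
            ProcFlow.IsMWURun η δ rounds ∧
            out = rounds.map (ProcFlow.FlowWalk.scale (1 / Real.logb (1 + η) ((1 + η) / δ)))) ∧
          ProcFlow.Feasible N (ProcFlow.solutionOf out) ∧
          (1 - ε) * ProcFlow.opt N ≤ ProcFlow.value (ProcFlow.solutionOf out) ∧
          (2 ≤ N.nV → 1 ≤ N.nE → 1 ≤ N.nD →
            (steps : ℝ) ≤ K * ((N.nD : ℝ) * (N.nE : ℝ) *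
              ((N.nE : ℝ) + (N.nV : ℝ) * Real.log N.nV) * Real.log N.nV ^ 2 / ε ^ 2)) := by
  classical
  refine ⟨ProcFlow.mainProgram, 2000000, by norm_num, fun N ε hε hε1 => ?_⟩
  have hex := pow_unbounded_of_one_lt ((2 + N.nV + N.nE : ℝ) ^ ⌈4 / ε⌉₊)
    (by linarith : (1 : ℝ) < 1 + ε)
  have hex' : ∃ j : ℕ, (2 + N.nV + N.nE : ℝ) ^ ⌈4 / ε⌉₊ ≤ (1 + ε) ^ j :=
    hex.imp fun _ h => h.le
  obtain ⟨j, hj, hj'⟩ : ∃ j : ℕ, (2 + N.nV + N.nE : ℝ) ^ ⌈4 / ε⌉₊ ≤ (1 + ε) ^ j ∧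
      ∀ i < j, (1 + ε) ^ i < (2 + N.nV + N.nE : ℝ) ^ ⌈4 / ε⌉₊ :=
    ⟨Nat.find hex', Nat.find_spec hex', fun i hi => not_le.1 (Nat.find_min hex' hi)⟩
  have hV : (0 : ℝ) ≤ N.nV := Nat.cast_nonneg _
  have hE : (0 : ℝ) ≤ N.nE := Nat.cast_nonneg _
  -- The power to be exceeded is greater than 1, so at least one factor 1 + ε is needed; this makes
  -- δ < 1.
  have hj0 : j ≠ 0 := by
    rintro rfl
    refine absurd hj (not_le.2 ?_)
    rw [pow_zero]
    exact one_lt_pow₀ (by linarith) (Nat.ceil_pos.2 (by positivity)).ne'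
  obtain ⟨k, τ, hexec, hk, l, hrun, hout⟩ := ProcFlow.wp_mainProgram N hε hj0 hj hj'
  have hδ : 0 < 1 / (1 + ε) ^ j := by positivity
  have hδ1 : 1 / (1 + ε) ^ j < 1 := by
    rw [div_lt_one (by positivity)]
    exact one_lt_pow₀ (by linarith) hj0
  -- The divisor j + 1 in memory is turned back into the logarithm of the scaled run.
  rw [← ProcFlow.logb_one_add_div_pow hε j] at hout
  refine ⟨k, τ, _, hexec, hout, ⟨ε, _, l, hε, le_rfl, hδ, hδ1, hrun, rfl⟩, ?_, ?_,
    ProcFlow.steps_le hε hε1 hj0 hj' hk⟩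
  · exact ProcFlow.RoundsOK.feasible hε hδ hδ1 hrun.round
  · refine ProcFlow.RoundsOK.value_ge hε hε1 hδ hδ1 hrun.round hrun.halted
      (X := 2 + N.nV + N.nE) (by linarith) (by linarith) (k := ⌈4 / ε⌉₊) ?_ ?_
    · exact (div_le_iff₀ hε).1 (Nat.le_ceil _)
    · rwa [one_div_one_div]
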